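/- **Setting.** Let $(V,\eta)$ be a Lorentzian real vector space with $\dim V>2$ and let $S$ be a (possibly extended) spinor module, i.e. a nonzero finite-dimensional real module of the even Clifford algebra of $(V,\eta)$, so that $\mathfrak{so}(V)$ acts on $S$. Let $\kappa:\bigodot^2S\to V$ be linear, $\mathfrak{so}(V)$-equivariant and causal: $\kappa(s,s)$ is a nonzero timelike or null vector for every $s\neq0$. Let $\mathfrak s=V\oplus S\oplus\mathfrak{so}(V)$, with $V,S,\mathfrak{so}(V)$ in degrees $-2,-1,0$, $S$ odd and the rest even, be the Poincaré superalgebra: $[A,B]=AB-BA$, $[A,v]=Av$, $[A,s]=A\cdot s$, $[s,s]=\kappa(s,s)$, $[V,V]=[V,S]=0$. Let $G=\mathrm{GrAut}(\mathfrak s)$ be the group of linear automorphisms of $\mathfrak s$ preserving the grading and the bracket. **Cocycles.** $\mathcal H^{2,2}$ is the space of $\beta+\gamma$ with $\beta:V\otimes S\to S$ and $\gamma:\bigodot^2S\to\mathfrak{so}(V)$ linear such that, for all $v\in V$ and $s\in S$, $$2\kappa(s,\beta(v,s))+\gamma(s,s)v=0,\qquad \beta(\kappa(s,s),s)+\gamma(s,s)\cdot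 s=0 .$$ For a subspace $S'\subseteq S$, $\mathcal K^{2,2}(V\oplus S')=\{\beta+\gamma\in\mathcal H^{2,2}:\beta|_{V\otimes S'}=0\}$. The Lie algebra $\mathfrak{so}(V)$ and the group $G$ act naturally on these maps, and $\mathfrak h$-invariant means annihilated by $\mathfrak h\subseteq\mathfrak{so}(V)$. **Filtered subdeformations.** A filtered subdeformation of $\mathfrak s$ is a filtered Lie superalgebra $F$ (decreasing, finite filtration $F^k$, $k\in\mathbb Z$, compatible with parity and bracket, the parity of $F^k/F^{k+1}$ being that of $k$) whose associated graded superalgebra is identified with a graded subalgebra $\mathfrak a\subseteq\mathfrak s$. An isomorphism $\Phi:F\to F'$ of subdeformations is an isomorphism of Lie superalgebras with $\Phi(F^k)=F'^k$ for all $k$ such that $\mathrm{Gr}\,\Phi$ is the restriction to $\mathfrak a$ of some $g\in G$. $F$ is *highly supersymmetric* if $\dim F_{\bar1}>\frac12\dim S$, and *odd-generated* if $F_{\bar0}=[F_{\bar1},F_{\bar1}]$. If $F$ is highly supersymmetric, then $\mathfrak a=V\oplus S'\oplus\mathfrak h$; choosing even/odd complements of $F^{k+1}$ in $F^k$ identifies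 $F$ with $V\oplus S'\oplus\mathfrak h$ as a vector space and yields components $\alpha:V\times V\to V$, $\beta_0:V\times S'\to S'$, $\gamma_0:S'\times S'\to\mathfrak h$ of the bracket of $F$. A highly supersymmetric $F$ is *realisable* if there are an $\mathfrak h$-invariant $\beta+\gamma\in\mathcal H^{2,2}$ and a linear map $l:V\to\mathfrak{so}(V)$ such that, for all $v,w\in V$, $s,t\in S'$, $$\alpha(v,w)=l(v)w-l(w)v,\qquad \beta_0(v,s)=\beta(v,s)+l(v)\cdot s,\qquad \gamma_0(s,t)=\gamma(s,t)-l(\kappa(s,t)),$$ that is, if the Spencer cohomology class in $H^{2,2}(V\oplus S';\mathfrak s)$ that $F$ induces is the restriction of the class of $\beta+\gamma$ (this does not depend on the chosen complements). **Lie pairs.** Let $S'\subseteq S$ with $\dim S'>\frac12\dim S$, and $\beta+\gamma\in\mathcal H^{2,2}$. The *Dirac kernel* is $\mathfrak D=\ker(\kappa|_{\bigodot^2S'})$ and the *envelope* is $\mathfrak h_{(S',\beta+\gamma)}=\gamma(\mathfrak D)\subseteq\mathfrak{so}(V)$. The pair $(S',\beta+\gamma)$ is a *Lie pair* if $A\cdot\beta=0$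 and $A\cdot S'\subseteq S'$ for all $A\in\mathfrak h_{(S',\beta+\gamma)}$. For a linear section $\Sigma:V\to\bigodot^2S'$ of $\kappa|_{\bigodot^2S'}$ put $l=\gamma\circ\Sigma$, and let $\Theta:V\otimes\bigodot^2S'\to\mathfrak{so}(V)$ be $$\Theta(v,s,s)=2\gamma(s,\beta(v,s))-(l(v)\cdot\gamma)(s,s).$$ The Lie pair is *integrable* if for some $\Sigma$: (i) (admissibility) $\beta(v,\cdot)+l(v)$ maps $S'$ to $S'$ for all $v\in V$; (ii) $\Theta$ annihilates $V\otimes\mathfrak D$; and (iii) the map $\theta$ determined by $\theta(v,\kappa(s,s))=\Theta(v,s,s)$ for $s\in S'$ is a map $\Lambda^2V\to\mathfrak{so}(V)$ and satisfies, for all $v,w\in V$, $s\in S'$, $$\theta(v,w)\cdot s=\beta(v,\beta(w,s))-\beta(w,\beta(v,s))+(l(v)\cdot\beta)(w,s)-(l(w)\cdot\beta)(v,s).$$ For an integrable Lie pair and $\mathfrak h\subseteq\mathfrak{so}(V)$ equal to $\mathfrak h_{(S',\beta+\gamma)}$ or to $$\mathfrak h^{\max}_{(S',\beta+\gamma)}=\{A\in\mathfrak{so}(V):A\cdot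 S'\subseteq S',\ A\cdot\beta=0\},$$ let $\widetilde{\mathfrak a}_{(S',\beta+\gamma)}$, respectively $\widetilde{\mathfrak a}^{\max}_{(S',\beta+\gamma)}$, be the filtered subdeformation of $\mathfrak s$ with underlying filtered vector space $V\oplus S'\oplus\mathfrak h$ and brackets (for some section $\Sigma$) $$[A,B]=AB-BA,\quad [A,v]=Av+\big([A,l(v)]-l(Av)\big),\quad [A,s]=A\cdot s,$$ $$[s,s]=\kappa(s,s)+\big(\gamma(s,s)-l(\kappa(s,s))\big),\quad [v,s]=\beta(v,s)+l(v)\cdot s,$$ $$[v,w]=\big(l(v)w-l(w)v\big)+\big(\theta(v,w)-l(l(v)w-l(w)v)+[l(v),l(w)]\big).$$ Lie pairs $(S',\beta+\gamma)$ and $(S'',\beta'+\gamma')$ are *weakly equivalent* if $S''=g\cdot S'$ and $\beta'+\gamma'=g\cdot(\beta+\gamma)+\phi$ for some $g\in G$ and some $\mathfrak h_{(S'',\beta'+\gamma')}$-invariant $\phi\in\mathcal K^{2,2}(V\oplus S'')$; they are *strongly equivalent* if one can take $\phi=0$. **Proposition.** Weak equivalence is an equivalence relation on integrable Lie pairs,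 and isomorphism is one on highly supersymmetric, odd-generated, realisable filtered subdeformations of $\mathfrak s$. For every integrable Lie pair, $\widetilde{\mathfrak a}_{(S',\beta+\gamma)}$ exists and is a highly supersymmetric, odd-generated, realisable filtered subdeformation of $\mathfrak s$, and $(S',\beta+\gamma)\mapsto\widetilde{\mathfrak a}_{(S',\beta+\gamma)}$ induces a well-defined bijection $$\{\text{integrable Lie pairs}\}/\text{weak equivalence}\;\longrightarrow\;\{\text{highly supersymmetric, odd-generated, realisable filtered subdeformations of }\mathfrak s\}/\text{isomorphism}.$$ For every integrable Lie pair, $\widetilde{\mathfrak a}^{\max}_{(S',\beta+\gamma)}$ exists and is realisable; and if two integrable Lie pairs $(S',\beta+\gamma)$, $(S'',\beta'+\gamma')$ are strongly equivalent, then $\widetilde{\mathfrak a}^{\max}_{(S',\beta+\gamma)}$ and $\widetilde{\mathfrak a}^{\max}_{(S'',\beta'+\gamma')}$ are isomorphic as subdeformations. -/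

import Mathlib

open scoped TensorProduct

noncomputable section

/- The commutator Lie bracket on an associative ring is not a global instance. -/
attribute [local instance 100] LieRing.ofAssociativeRing

/-! ### Lie superalgebras and filtrations -/

/-- The Koszul sign `(-1)^(i j)` of two parities. -/
def koszulSign (i j : ZMod 2) : ℝ := if i = 1 ∧ j = 1 then -1 else 1

/-- A real Lie superalgebra with underlying vector space `L`; `parity 0` is the even subspace and
`parity 1` is the odd subspace. -/
structure LieSuperalgebra (L : Type*) [AddCommGroup L] [Module ℝ L] where
  parity : ZMod 2 → Submodule ℝ L
  isCompl_parity : IsCompl (parity 0) (parity 1)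
  bracket : L →ₗ[ℝ] L →ₗ[ℝ] L
  bracket_mem : ∀ {i j : ZMod 2} {x y : L}, x ∈ parity i → y ∈ parity j →
    bracket x y ∈ parity (i + j)
  bracket_skew : ∀ {i j : ZMod 2} {x y : L}, x ∈ parity i → y ∈ parity j →
    bracket x y = -(koszulSign i j • bracket y x)
  bracket_jacobi : ∀ {i j : ZMod 2} {x y : L} (z : L), x ∈ parity i → y ∈ parity j →
    bracket x (bracket y z) =
      bracket (bracket x y) z + koszulSign i j • bracket y (bracket x z)

/-- A (finitely) `ℤ`-filtered Lie superalgebra: a decreasing filtration, compatible with the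
parity and with the bracket. -/
structure FilteredLieSuperalgebra (L : Type*) [AddCommGroup L] [Module ℝ L]
    extends LieSuperalgebra L where
  fil : ℤ → Submodule ℝ L
  fil_antitone : Antitone fil
  fil_exhaustive : ∃ k, fil k = ⊤
  fil_separated : ∃ k, fil k = ⊥
  fil_parity : ∀ k, fil k = (fil k ⊓ parity 0) ⊔ (fil k ⊓ parity 1)
  fil_even : ∀ k, fil (2 * k - 1) ⊓ parity 0 = fil (2 * k) ⊓ parity 0
  fil_odd : ∀ k, fil (2 * k) ⊓ parity 1 = fil (2 * k + 1) ⊓ parity 1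
  bracket_fil : ∀ {k l : ℤ} {x y : L}, x ∈ fil k → y ∈ fil l → bracket x y ∈ fil (k + l)

/-! ### Lorentzian vector spaces and spinor modules -/

/-- Symmetric bilinear forms of Lorentzian signature `(n - 1, 1)`: some vector is timelike, and
the form is positive definite on its orthogonal complement. -/
structure IsLorentzian {V : Type*} [AddCommGroup V] [Module ℝ V]
    (η : LinearMap.BilinForm ℝ V) : Prop where
  symm : ∀ v w, η v w = η w v
  exists_timelike : ∃ e, η e e < 0 ∧ ∀ v, η e v = 0 → v ≠ 0 → 0 < η v v

theorem IsLorentzian.isSymm {V : Type*} [AddCommGroup V] [Module ℝ V]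
    {η : LinearMap.BilinForm ℝ V} (h : IsLorentzian η) : η.IsSymm :=
  ⟨fun v w => by simpa using h.symm v w⟩

theorem IsLorentzian.nondegenerate {V : Type*} [AddCommGroup V] [Module ℝ V]
    {η : LinearMap.BilinForm ℝ V} (h : IsLorentzian η) : η.Nondegenerate := by
  have key : ∀ x, (∀ y, η x y = 0) → x = 0 := by
    intro x hx
    by_contra hne
    obtain ⟨e, -, he⟩ := h.exists_timelike
    have h1 := he x (by rw [h.symm]; exact hx e) hne
    rw [hx x] at h1
    exact lt_irrefl _ h1
  exact ⟨key, fun y hy => key y fun x => by rw [h.symm]; exact hy x⟩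

/-- The Lie algebra `so(V)` of `η`-skew-symmetric endomorphisms, with the commutator bracket. -/
abbrev So {V : Type*} [AddCommGroup V] [Module ℝ V] (η : LinearMap.BilinForm ℝ V) : Type _ :=
  skewAdjointLieSubalgebra η

theorem skew_apply {V : Type*} [AddCommGroup V] [Module ℝ V] {η : LinearMap.BilinForm ℝ V}
    (A : So η) (v w : V) :
    η ((A : Module.End ℝ V) v) w = -η v ((A : Module.End ℝ V) w) := by
  have h : LinearMap.IsSkewAdjoint η (A : Module.End ℝ V) := by
    have := A.2
    rwa [← LinearMap.mem_skewAdjointSubmodule]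
  have := h v w
  simpa using this

/-- The even subalgebra of the Clifford algebra of `(V, η)`. It does not depend on the choice of
the sign in the Clifford relation. -/
abbrev EvenClifford {V : Type*} [AddCommGroup V] [Module ℝ V] (η : LinearMap.BilinForm ℝ V) :
    Subalgebra ℝ (CliffordAlgebra (LinearMap.BilinMap.toQuadraticMap η)) :=
  CliffordAlgebra.even (LinearMap.BilinMap.toQuadraticMap η)

section Spin

variable {V : Type*} [AddCommGroup V] [Module ℝ V] [FiniteDimensional ℝ V]
  {η : LinearMap.BilinForm ℝ V}

/-- The bivector of an endomorphism `A`, as an element of the even Clifford algebra: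
`1/4 ∑ᵢ (A eᵢ) eⁱ`, where `eᵢ` is a basis of `V` and `eⁱ` is its `η`-dual basis. For `A` in `so(V)`
it is the unique bivector whose Clifford commutator with every vector `v` is `A v`. -/
def spinLift (hη : η.Nondegenerate) : Module.End ℝ V →ₗ[ℝ] EvenClifford η :=
  (1 / 4 : ℝ) • ∑ i, ((CliffordAlgebra.even.ι (LinearMap.BilinMap.toQuadraticMap η)).bilin.flip
      (LinearMap.BilinForm.dualBasis η hη (Module.finBasis ℝ V) i)) ∘ₗ
    LinearMap.applyₗ (Module.finBasis ℝ V i)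

theorem coe_spinLift (hη : η.Nondegenerate) (A : Module.End ℝ V) :
    (spinLift hη A : CliffordAlgebra (LinearMap.BilinMap.toQuadraticMap η)) =
      (1 / 4 : ℝ) • ∑ i, CliffordAlgebra.ι _ (A (Module.finBasis ℝ V i)) *
        CliffordAlgebra.ι _ (LinearMap.BilinForm.dualBasis η hη (Module.finBasis ℝ V) i) := by
  simp only [spinLift, LinearMap.smul_apply, LinearMap.sum_apply, Subalgebra.coe_smul,
    AddSubmonoidClass.coe_finsetSum]
  rfl

theorem sum_dual_smul (hη : η.Nondegenerate) (hs : η.IsSymm) (v : V) :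
    ∑ i, η (LinearMap.BilinForm.dualBasis η hη (Module.finBasis ℝ V) i) v •
      Module.finBasis ℝ V i = v := by
  conv_rhs => rw [← (Module.finBasis ℝ V).sum_repr v]
  refine Finset.sum_congr rfl fun i _ => ?_
  congr 1
  have h := LinearMap.BilinForm.dualBasis_repr_apply hη
    (LinearMap.BilinForm.dualBasis η hη (Module.finBasis ℝ V)) v i
  rw [LinearMap.BilinForm.dualBasis_dualBasis hη hs] at h
  rw [h]
  simpa using (hs.eq _ _)

theorem sum_smul_dual (hη : η.Nondegenerate) (hs : η.IsSymm) (v : V) :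
    ∑ i, η (Module.finBasis ℝ V i) v •
      LinearMap.BilinForm.dualBasis η hη (Module.finBasis ℝ V) i = v := by
  conv_rhs => rw [← (LinearMap.BilinForm.dualBasis η hη (Module.finBasis ℝ V)).sum_repr v]
  refine Finset.sum_congr rfl fun i _ => ?_
  congr 1
  rw [LinearMap.BilinForm.dualBasis_repr_apply hη]
  simpa using (hs.eq _ _)

/-- The defining property of the spin lift. -/
theorem spinLift_comm (hη : η.Nondegenerate) (hs : η.IsSymm) (A : So η) (v : V) :
    (spinLift hη A : CliffordAlgebra (LinearMap.BilinMap.toQuadraticMap η)) *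
        CliffordAlgebra.ι _ v -
      CliffordAlgebra.ι _ v *
        (spinLift hη A : CliffordAlgebra (LinearMap.BilinMap.toQuadraticMap η)) =
      CliffordAlgebra.ι _ ((A : Module.End ℝ V) v) := by
  have key : ∀ a b : V,
      CliffordAlgebra.ι (LinearMap.BilinMap.toQuadraticMap η) a * CliffordAlgebra.ι _ b *
          CliffordAlgebra.ι _ v -
        CliffordAlgebra.ι _ v * (CliffordAlgebra.ι _ a * CliffordAlgebra.ι _ b) =
      (2 : ℝ) • CliffordAlgebra.ι _ (η b v • a) - (2 : ℝ) • CliffordAlgebra.ι _ (η a v • b) := by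
    intro a b
    have pol : ∀ x y : V, QuadraticMap.polar (LinearMap.BilinMap.toQuadraticMap η) x y
        = 2 * η x y := by
      intro x y
      have := hs.eq x y
      rw [LinearMap.BilinMap.polar_toQuadraticMap, ← this]
      ring
    have h1 := CliffordAlgebra.ι_mul_ι_add_swap (Q := LinearMap.BilinMap.toQuadraticMap η) b v
    have h2 := CliffordAlgebra.ι_mul_ι_add_swap (Q := LinearMap.BilinMap.toQuadraticMap η) a v
    rw [pol] at h1 h2
    rw [← eq_sub_iff_add_eq] at h1
    rw [← eq_sub_iff_add_eq'] at h2
    rw [mul_assoc, h1, mul_sub, ← mul_assoc, ← mul_assoc, h2, sub_mul,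
      ← Algebra.commutes, ← Algebra.smul_def, ← Algebra.smul_def]
    simp only [map_smul, mul_smul]
    abel
  rw [coe_spinLift, smul_mul_assoc, mul_smul_comm, ← smul_sub, Finset.sum_mul, Finset.mul_sum,
    ← Finset.sum_sub_distrib]
  simp only [key]
  rw [Finset.sum_sub_distrib, ← Finset.smul_sum, ← Finset.smul_sum, ← map_sum, ← map_sum]
  have e1 : ∑ i, η (LinearMap.BilinForm.dualBasis η hη (Module.finBasis ℝ V) i) v •
      (A : Module.End ℝ V) (Module.finBasis ℝ V i) = (A : Module.End ℝ V) v := by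
    conv_rhs => rw [← sum_dual_smul hη hs v]
    simp
  have e2 : ∑ i, η ((A : Module.End ℝ V) (Module.finBasis ℝ V i)) v •
      LinearMap.BilinForm.dualBasis η hη (Module.finBasis ℝ V) i = -(A : Module.End ℝ V) v := by
    conv_rhs => rw [← sum_smul_dual hη hs ((A : Module.End ℝ V) v)]
    simp [skew_apply]
  rw [e1, e2, map_neg]
  module

theorem sum_skew_swap (hη : η.Nondegenerate) (hs : η.IsSymm) (A : So η) {W : Type*}
    [AddCommGroup W] [Module ℝ W] (f : V →ₗ[ℝ] V →ₗ[ℝ] W) :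
    ∑ i, f (Module.finBasis ℝ V i)
        ((A : Module.End ℝ V) (LinearMap.BilinForm.dualBasis η hη (Module.finBasis ℝ V) i)) =
      -∑ i, f ((A : Module.End ℝ V) (Module.finBasis ℝ V i))
        (LinearMap.BilinForm.dualBasis η hη (Module.finBasis ℝ V) i) := by
  have h1 : ∀ i, f (Module.finBasis ℝ V i)
      ((A : Module.End ℝ V) (LinearMap.BilinForm.dualBasis η hη (Module.finBasis ℝ V) i)) =
      ∑ j, -(η (LinearMap.BilinForm.dualBasis η hη (Module.finBasis ℝ V) i)
        ((A : Module.End ℝ V) (Module.finBasis ℝ V j)) • f (Module.finBasis ℝ V i)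
        (LinearMap.BilinForm.dualBasis η hη (Module.finBasis ℝ V) j)) := by
    intro i
    conv_lhs => rw [← sum_smul_dual hη hs ((A : Module.End ℝ V)
      (LinearMap.BilinForm.dualBasis η hη (Module.finBasis ℝ V) i))]
    rw [map_sum]
    refine Finset.sum_congr rfl fun j _ => ?_
    rw [map_smul, ← neg_smul]
    congr 1
    have := hs.eq (Module.finBasis ℝ V j) ((A : Module.End ℝ V)
      (LinearMap.BilinForm.dualBasis η hη (Module.finBasis ℝ V) i))
    rw [this, skew_apply]
  have h2 : ∀ j, f ((A : Module.End ℝ V) (Module.finBasis ℝ V j))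
        (LinearMap.BilinForm.dualBasis η hη (Module.finBasis ℝ V) j) =
      ∑ i, (η (LinearMap.BilinForm.dualBasis η hη (Module.finBasis ℝ V) i)
        ((A : Module.End ℝ V) (Module.finBasis ℝ V j)) • f (Module.finBasis ℝ V i)
        (LinearMap.BilinForm.dualBasis η hη (Module.finBasis ℝ V) j)) := by
    intro j
    conv_lhs => rw [← sum_dual_smul hη hs ((A : Module.End ℝ V) (Module.finBasis ℝ V j))]
    simp [LinearMap.sum_apply]
  simp only [h1, h2, Finset.sum_neg_distrib]
  rw [Finset.sum_comm]

theorem spinLift_lie (hη : η.Nondegenerate) (hs : η.IsSymm) (A B : So η) :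
    spinLift hη ((⁅A, B⁆ : So η) : Module.End ℝ V) =
      spinLift hη A * spinLift hη B - spinLift hη B * spinLift hη A := by
  apply Subtype.ext
  simp only [AddSubgroupClass.coe_sub, MulMemClass.coe_mul]
  have hcomm : ∀ a b : V,
      (spinLift hη A : CliffordAlgebra (LinearMap.BilinMap.toQuadraticMap η)) *
          (CliffordAlgebra.ι _ a * CliffordAlgebra.ι _ b) -
        (CliffordAlgebra.ι _ a * CliffordAlgebra.ι _ b) *
          (spinLift hη A : CliffordAlgebra (LinearMap.BilinMap.toQuadraticMap η)) =
      CliffordAlgebra.ι _ ((A : Module.End ℝ V) a) * CliffordAlgebra.ι _ b +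
        CliffordAlgebra.ι _ a * CliffordAlgebra.ι _ ((A : Module.End ℝ V) b) := by
    intro a b
    rw [← spinLift_comm hη hs A a, ← spinLift_comm hη hs A b]
    noncomm_ring
  rw [coe_spinLift hη (B : Module.End ℝ V), mul_smul_comm, smul_mul_assoc, ← smul_sub,
    Finset.mul_sum, Finset.sum_mul, ← Finset.sum_sub_distrib]
  simp only [hcomm]
  rw [Finset.sum_add_distrib]
  have := sum_skew_swap hη hs A (((LinearMap.mul ℝ (CliffordAlgebra
    (LinearMap.BilinMap.toQuadraticMap η))).compl₁₂ (CliffordAlgebra.ι _)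
      (CliffordAlgebra.ι _)) ∘ₗ (B : Module.End ℝ V))
  simp only [LinearMap.comp_apply, LinearMap.compl₁₂_apply, LinearMap.mul_apply'] at this
  rw [this, coe_spinLift, ← sub_eq_add_neg, ← Finset.sum_sub_distrib]
  congr 1
  refine Finset.sum_congr rfl fun i _ => ?_
  rw [← sub_mul, ← map_sub]
  rfl

/-- The action of `so(V)` on a module over the even Clifford algebra. -/
def spinAction {S : Type*} [AddCommGroup S] [Module ℝ S] (hη : η.Nondegenerate)
    (ρ : EvenClifford η →ₐ[ℝ] Module.End ℝ S) : So η →ₗ[ℝ] Module.End ℝ S :=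
  ρ.toLinearMap ∘ₗ spinLift hη ∘ₗ (skewAdjointLieSubalgebra η).toSubmodule.subtype

theorem spinAction_lie {S : Type*} [AddCommGroup S] [Module ℝ S] (hη : η.Nondegenerate)
    (hs : η.IsSymm) (ρ : EvenClifford η →ₐ[ℝ] Module.End ℝ S) (A B : So η) (s : S) :
    spinAction hη ρ (⁅A, B⁆ : So η) s = spinAction hη ρ A (spinAction hη ρ B s) -
      spinAction hη ρ B (spinAction hη ρ A s) := by
  have : spinAction hη ρ (⁅A, B⁆ : So η) = spinAction hη ρ A * spinAction hη ρ B -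
      spinAction hη ρ B * spinAction hη ρ A := by
    change ρ (spinLift hη ((⁅A, B⁆ : So η) : Module.End ℝ V)) = _
    rw [spinLift_lie hη hs, map_sub, map_mul, map_mul]
    rfl
  rw [this]
  rfl

end Spin

/-! ### The Poincaré superalgebra -/

/-- The data of an (extended) Poincaré superalgebra: a Lorentzian vector space `(V, η)` of
dimension greater than `2`, an (extended) spinor module `S`, that is, a nonzero finite-dimensional
module of the even Clifford algebra, and a squaring map `κ : ⊙² S → V` which is symmetric,
`so(V)`-equivariant and causal. Here causal means that `κ(s, s)` is a nonzero timelike or null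
vector for every `s ≠ 0`. -/
structure PoincareData (V : Type*) (S : Type*) [AddCommGroup V] [Module ℝ V]
    [FiniteDimensional ℝ V] [AddCommGroup S] [Module ℝ S] [FiniteDimensional ℝ S] where
  η : LinearMap.BilinForm ℝ V
  lorentzian : IsLorentzian η
  two_lt_dim : 2 < Module.finrank ℝ V
  ρ : EvenClifford η →ₐ[ℝ] Module.End ℝ S
  nontrivial_spinor : Nontrivial S
  κ : S →ₗ[ℝ] S →ₗ[ℝ] V
  κ_symm : ∀ s t, κ s t = κ t s
  κ_equivariant : ∀ (A : So η) (s t : S),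
    (A : Module.End ℝ V) (κ s t) =
      κ (spinAction lorentzian.nondegenerate ρ A s) t +
        κ s (spinAction lorentzian.nondegenerate ρ A t)
  κ_causal : ∀ s, s ≠ 0 → κ s s ≠ 0 ∧ η (κ s s) (κ s s) ≤ 0

namespace PoincareData

universe u v

variable {V : Type u} {S : Type v} [AddCommGroup V] [Module ℝ V] [FiniteDimensional ℝ V]
  [AddCommGroup S] [Module ℝ S] [FiniteDimensional ℝ S] (D : PoincareData V S)

/-- The action of `so(V)` on `V`. -/
def vec : So D.η →ₗ[ℝ] Module.End ℝ V := (skewAdjointLieSubalgebra D.η).toSubmodule.subtype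

/-- The action of `so(V)` on `S`. -/
def spin : So D.η →ₗ[ℝ] Module.End ℝ S := spinAction D.lorentzian.nondegenerate D.ρ

/-- The underlying vector space `V ⊕ S ⊕ so(V)` of the Poincaré superalgebra. -/
abbrev Total : Type (max u v) := V × S × So D.η

/-- The `ℤ`-grading: `V` in degree `-2`, `S` in degree `-1`, `so(V)` in degree `0`. -/
def grade (k : ℤ) : Submodule ℝ D.Total where
  carrier := {x | (k ≠ -2 → x.1 = 0) ∧ (k ≠ -1 → x.2.1 = 0) ∧ (k ≠ 0 → x.2.2 = 0)}
  zero_mem' := by simp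
  add_mem' := by
    rintro x y ⟨h1, h2, h3⟩ ⟨h4, h5, h6⟩
    exact ⟨fun h => by simp [h1 h, h4 h], fun h => by simp [h2 h, h5 h],
      fun h => by simp [h3 h, h6 h]⟩
  smul_mem' := by
    rintro c x ⟨h1, h2, h3⟩
    exact ⟨fun h => by simp [h1 h], fun h => by simp [h2 h], fun h => by simp [h3 h]⟩

/-- The bracket of the Poincaré superalgebra:
`[A, B] = AB - BA`, `[A, v] = A v`, `[A, s] = A · s`, `[s, t] = κ(s, t)`, others zero. -/
def bracket : D.Total →ₗ[ℝ] D.Total →ₗ[ℝ] D.Total :=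
  LinearMap.mk₂ ℝ
    (fun x y => (D.vec x.2.2 y.1 - D.vec y.2.2 x.1 + D.κ x.2.1 y.2.1,
      D.spin x.2.2 y.2.1 - D.spin y.2.2 x.2.1, ⁅x.2.2, y.2.2⁆))
    (fun x x' y => by
      refine Prod.ext ?_ (Prod.ext ?_ ?_)
      · simp only [Prod.fst_add, Prod.snd_add, map_add, LinearMap.add_apply]; abel
      · simp only [Prod.fst_add, Prod.snd_add, map_add, LinearMap.add_apply]; abel
      · simp only [Prod.snd_add, add_lie])
    (fun c x y => by
      refine Prod.ext ?_ (Prod.ext ?_ ?_)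
      · simp only [Prod.smul_fst, Prod.smul_snd, map_smul, LinearMap.smul_apply]; module
      · simp only [Prod.smul_fst, Prod.smul_snd, map_smul, LinearMap.smul_apply]; module
      · simp only [Prod.smul_snd, smul_lie])
    (fun x y y' => by
      refine Prod.ext ?_ (Prod.ext ?_ ?_)
      · simp only [Prod.fst_add, Prod.snd_add, map_add, LinearMap.add_apply]; abel
      · simp only [Prod.fst_add, Prod.snd_add, map_add, LinearMap.add_apply]; abel
      · simp only [Prod.snd_add, lie_add])
    (fun c x y => by
      refine Prod.ext ?_ (Prod.ext ?_ ?_)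
      · simp only [Prod.smul_fst, Prod.smul_snd, map_smul, LinearMap.smul_apply]; module
      · simp only [Prod.smul_fst, Prod.smul_snd, map_smul, LinearMap.smul_apply]; module
      · simp only [Prod.smul_snd, lie_smul])

theorem bracket_apply (x y : D.Total) :
    D.bracket x y = (D.vec x.2.2 y.1 - D.vec y.2.2 x.1 + D.κ x.2.1 y.2.1,
      D.spin x.2.2 y.2.1 - D.spin y.2.2 x.2.1, ⁅x.2.2, y.2.2⁆) := rfl

theorem vec_lie (A B : So D.η) (w : V) :
    D.vec (⁅A, B⁆ : So D.η) w = D.vec A (D.vec B w) - D.vec B (D.vec A w) := rfl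

theorem spin_lie (A B : So D.η) (s : S) :
    D.spin (⁅A, B⁆ : So D.η) s = D.spin A (D.spin B s) - D.spin B (D.spin A s) :=
  spinAction_lie D.lorentzian.nondegenerate D.lorentzian.isSymm D.ρ A B s

theorem vec_κ (A : So D.η) (s t : S) :
    D.vec A (D.κ s t) = D.κ (D.spin A s) t + D.κ s (D.spin A t) := D.κ_equivariant A s t

/-- The parity of the Poincaré superalgebra: `V ⊕ so(V)` is even and `S` is odd. -/
def parity (i : ZMod 2) : Submodule ℝ D.Total where
  carrier := {x | (i = 0 → x.2.1 = 0) ∧ (i = 1 → x.1 = 0 ∧ x.2.2 = 0)}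
  zero_mem' := by simp
  add_mem' := by
    rintro x y ⟨h1, h2⟩ ⟨h3, h4⟩
    exact ⟨fun h => by simp [h1 h, h3 h],
      fun h => ⟨by simp [(h2 h).1, (h4 h).1], by simp [(h2 h).2, (h4 h).2]⟩⟩
  smul_mem' := by
    rintro c x ⟨h1, h2⟩
    exact ⟨fun h => by simp [h1 h], fun h => ⟨by simp [(h2 h).1], by simp [(h2 h).2]⟩⟩

theorem mem_even {x : D.Total} : x ∈ D.parity 0 ↔ x.2.1 = 0 :=
  ⟨fun h => h.1 rfl, fun h => ⟨fun _ => h, fun h' => absurd h' (by decide)⟩⟩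

theorem mem_odd {x : D.Total} : x ∈ D.parity 1 ↔ x.1 = 0 ∧ x.2.2 = 0 :=
  ⟨fun h => h.2 rfl, fun h => ⟨fun h' => absurd h' (by decide), fun _ => h⟩⟩

/-- The Poincaré superalgebra as a Lie superalgebra. -/
def superalgebra : LieSuperalgebra D.Total where
  parity := D.parity
  isCompl_parity := by
    rw [isCompl_iff, Submodule.disjoint_def, codisjoint_iff, Submodule.eq_top_iff']
    refine ⟨fun x h0 h1 => ?_, fun x => ?_⟩
    · exact Prod.ext (h1.2 rfl).1 (Prod.ext (h0.1 rfl) (h1.2 rfl).2)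
    · rw [Submodule.mem_sup]
      exact ⟨(x.1, 0, x.2.2), ⟨fun _ => rfl, by simp⟩, (0, x.2.1, 0), ⟨by simp, by simp⟩, by simp⟩
  bracket := D.bracket
  bracket_mem := by
    intro i j x y hx hy
    have h2 : ∀ i : ZMod 2, i = 0 ∨ i = 1 := by decide
    rcases h2 i with rfl | rfl <;> rcases h2 j with rfl | rfl
    · rw [add_zero]
      rw [mem_even] at *
      simp [bracket_apply, hx, hy]
    · rw [zero_add]
      rw [mem_odd] at *
      rw [mem_even] at hx
      simp [bracket_apply, hx, hy]
    · rw [add_zero]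
      rw [mem_odd] at *
      rw [mem_even] at hy
      simp [bracket_apply, hx, hy]
    · rw [mem_odd] at *
      rw [show (1 : ZMod 2) + 1 = 0 by decide, mem_even]
      simp [bracket_apply, hx, hy]
  bracket_skew := by
    intro i j x y hx hy
    have h2 : ∀ i : ZMod 2, i = 0 ∨ i = 1 := by decide
    have h01 : ¬ ((0 : ZMod 2) = 1) := by decide
    rcases h2 i with rfl | rfl <;> rcases h2 j with rfl | rfl
    all_goals
      simp only [mem_even, mem_odd] at hx hy
      simp [bracket_apply, koszulSign, hx, hy, h01]
    exact D.κ_symm _ _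
  bracket_jacobi := by
    intro i j x y z hx hy
    have h2 : ∀ i : ZMod 2, i = 0 ∨ i = 1 := by decide
    have h01 : ¬ ((0 : ZMod 2) = 1) := by decide
    rcases h2 i with rfl | rfl <;> rcases h2 j with rfl | rfl
    all_goals
      simp only [mem_even, mem_odd] at hx hy
      simp only [bracket_apply, koszulSign, hx, hy, h01, and_self, and_true, and_false,
        if_true, if_false, map_zero, LinearMap.zero_apply, zero_add, add_zero, zero_sub, sub_zero,
        zero_lie, lie_zero, map_neg, LinearMap.neg_apply, map_sub, one_smul, neg_smul,
        neg_zero, vec_lie, spin_lie, vec_κ, Prod.mk_add_mk, Prod.neg_mk]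
      refine Prod.ext ?_ (Prod.ext ?_ ?_)
    all_goals
      simp only [D.κ_symm _ z.2.1]
    all_goals first
      | done
      | exact leibniz_lie _ _ _
      | abel1
      | (rw [D.κ_symm (D.spin z.2.2 x.2.1) y.2.1]; abel1)

/-- The group `GrAut(s)` of graded automorphisms: a linear automorphism preserving every graded
component is a triple of linear automorphisms of `V`, `S` and `so(V)`. -/
structure GrAut where
  onV : V ≃ₗ[ℝ] V
  onS : S ≃ₗ[ℝ] S
  onSo : So D.η ≃ₗ[ℝ] So D.η
  map_bracket : ∀ x y : D.Total,
    (onV.prodCongr (onS.prodCongr onSo)) (D.bracket x y) =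
      D.bracket ((onV.prodCongr (onS.prodCongr onSo)) x) ((onV.prodCongr (onS.prodCongr onSo)) y)

variable {D} in
/-- The action of a graded automorphism on the Poincaré superalgebra. -/
def GrAut.toEquiv (g : D.GrAut) : D.Total ≃ₗ[ℝ] D.Total := g.onV.prodCongr (g.onS.prodCongr g.onSo)

/-! ### Normalised Spencer cocycles -/

/-- The space `Hom(V ⊗ S, S) ⊕ Hom(S ⊗ S, so(V))` of pairs `(β, γ)`. -/
abbrev BetaGamma : Type (max u v) := (V →ₗ[ℝ] S →ₗ[ℝ] S) × (S →ₗ[ℝ] S →ₗ[ℝ] So D.η)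

/-- The space `ℋ^{2,2}` of normalised Spencer `(2,2)`-cocycles `β + γ` of the Poincaré
superalgebra: `γ` is symmetric and the two Spencer cocycle conditions hold. -/
def normCocycles : Submodule ℝ D.BetaGamma where
  carrier := {b | (∀ s t, b.2 s t = b.2 t s) ∧
    (∀ v s, (2 : ℝ) • D.κ s (b.1 v s) + D.vec (b.2 s s) v = 0) ∧
    (∀ s, b.1 (D.κ s s) s + D.spin (b.2 s s) s = 0)}
  zero_mem' := by simp
  add_mem' := by
    rintro b c ⟨h1, h2, h3⟩ ⟨k1, k2, k3⟩
    refine ⟨fun s t => ?_, fun v s => ?_, fun s => ?_⟩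
    · simp [h1 s t, k1 s t]
    · have := congrArg₂ (· + ·) (h2 v s) (k2 v s)
      simp only [add_zero] at this
      simp only [Prod.fst_add, Prod.snd_add, LinearMap.add_apply, map_add, smul_add]
      rw [← this]
      abel
    · have := congrArg₂ (· + ·) (h3 s) (k3 s)
      simp only [add_zero] at this
      simp only [Prod.fst_add, Prod.snd_add, LinearMap.add_apply, map_add]
      rw [← this]
      abel
  smul_mem' := by
    rintro r b ⟨h1, h2, h3⟩
    refine ⟨fun s t => ?_, fun v s => ?_, fun s => ?_⟩
    · simp [h1 s t]
    · have := congrArg (r • ·) (h2 v s)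
      simp only [smul_zero, smul_add] at this
      simp only [Prod.smul_fst, Prod.smul_snd, LinearMap.smul_apply, map_smul]
      rw [← this, smul_comm]
    · have := congrArg (r • ·) (h3 s)
      simp only [smul_zero, smul_add] at this
      simp only [Prod.smul_fst, Prod.smul_snd, LinearMap.smul_apply, map_smul]
      rw [← this]

/-- `(A · β)(v, s) = A · β(v, s) - β(A v, s) - β(v, A · s)`. -/
def actBeta (A : So D.η) (β : V →ₗ[ℝ] S →ₗ[ℝ] S) : V →ₗ[ℝ] S →ₗ[ℝ] S :=
  β.compr₂ (D.spin A) - β ∘ₗ D.vec A - β.compl₂ (D.spin A)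

/-- `(A · γ)(s, t) = [A, γ(s, t)] - γ(A · s, t) - γ(s, A · t)`. -/
def actGamma (A : So D.η) (γ : S →ₗ[ℝ] S →ₗ[ℝ] So D.η) : S →ₗ[ℝ] S →ₗ[ℝ] So D.η :=
  γ.compr₂ (LieAlgebra.ad ℝ (So D.η) A) - γ ∘ₗ D.spin A - γ.compl₂ (D.spin A)

/-- Invariance of `β + γ` under a subspace of `so(V)`. -/
def IsInvariant (h : Submodule ℝ (So D.η)) (b : D.BetaGamma) : Prop :=
  ∀ A ∈ h, D.actBeta A b.1 = 0 ∧ D.actGamma A b.2 = 0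

/-- The action of graded automorphisms:
`(g · β)(v, s) = g β(g⁻¹ v, g⁻¹ s)` and `(g · γ)(s, t) = g γ(g⁻¹ s, g⁻¹ t)`. -/
def smulBetaGamma (g : D.GrAut) (b : D.BetaGamma) : D.BetaGamma :=
  (g.onV.arrowCongr (g.onS.arrowCongr g.onS) b.1, g.onS.arrowCongr (g.onS.arrowCongr g.onSo) b.2)

/-- The space `𝒦^{2,2}(V ⊕ S')` of normalised cocycles whose `β` vanishes on `V ⊗ S'`. -/
def kernelCocycles (S' : Submodule ℝ S) : Submodule ℝ D.BetaGamma where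
  carrier := {b | b ∈ D.normCocycles ∧ ∀ v, ∀ s ∈ S', b.1 v s = 0}
  zero_mem' := ⟨zero_mem _, by simp⟩
  add_mem' := fun hb hc => ⟨add_mem hb.1 hc.1, fun v s hs => by
    simp [hb.2 v s hs, hc.2 v s hs]⟩
  smul_mem' := fun r _ hb => ⟨Submodule.smul_mem _ r hb.1, fun v s hs => by simp [hb.2 v s hs]⟩

/-! ### The degree two Spencer complex of `V ⊕ S' ⊕ h` with values in the Poincaré superalgebra -/

/-- Degree two, homological degree two cochains `α + β + γ` on `V ⊕ S'` with values in the
Poincaré superalgebra. -/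
abbrev Cochain (S' : Submodule ℝ S) : Type (max u v) :=
  (V →ₗ[ℝ] V →ₗ[ℝ] V) × (V →ₗ[ℝ] S' →ₗ[ℝ] S) × (S' →ₗ[ℝ] S' →ₗ[ℝ] So D.η)

/-- The restriction `i^*(β + γ)` to `V ⊕ S'`. -/
def restrictCocycle (S' : Submodule ℝ S) (b : D.BetaGamma) : D.Cochain S' :=
  (0, b.1.compl₂ S'.subtype, b.2.compl₁₂ S'.subtype S'.subtype)

/-- The Spencer differential of `l : V → so(V)`:
`∂l(v, w) = l(v) w - l(w) v`, `∂l(v, s) = l(v) · s`, `∂l(s, t) = -l(κ(s, t))`. -/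
def spencerD (S' : Submodule ℝ S) (l : V →ₗ[ℝ] So D.η) : D.Cochain S' :=
  ((D.vec ∘ₗ l) - (D.vec ∘ₗ l).flip, (D.spin ∘ₗ l).compl₂ S'.subtype,
    -((D.κ.compl₁₂ S'.subtype S'.subtype).compr₂ l))

/-! ### Filtered subdeformations -/

/-- A filtered subdeformation of the Poincaré superalgebra `s`: a filtered Lie superalgebra `F`
together with an injective morphism of graded Lie superalgebras from its associated graded
superalgebra into `s` (so `Gr F` is identified with a graded subalgebra of `s`). The component
`Gr_k F = F^k / F^(k+1) → s_k` of that morphism is given as a linear map `symb k` on `F^k` with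
kernel `F^(k+1)`. -/
structure Subdeformation where
  carrier : Type (max u v)
  [addCommGroup : AddCommGroup carrier]
  [module : Module ℝ carrier]
  alg : FilteredLieSuperalgebra carrier
  symb : ∀ k, alg.fil k →ₗ[ℝ] D.Total
  symb_mem : ∀ k x, symb k x ∈ D.grade k
  symb_eq_zero_iff : ∀ k x, symb k x = 0 ↔ (x : carrier) ∈ alg.fil (k + 1)
  symb_bracket : ∀ k l (x : alg.fil k) (y : alg.fil l),
    symb (k + l) ⟨alg.bracket x y, alg.bracket_fil x.2 y.2⟩ = D.bracket (symb k x) (symb l y)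

attribute [instance] Subdeformation.addCommGroup Subdeformation.module

variable {D}

/-- Isomorphism of filtered subdeformations: a strict isomorphism of filtered Lie superalgebras
whose associated graded morphism is the restriction of some `g ∈ GrAut(s)`. -/
def Subdeformation.Iso (F F' : D.Subdeformation) : Prop :=
  ∃ Φ : F.carrier ≃ₗ[ℝ] F'.carrier,
    (∀ x y, Φ (F.alg.bracket x y) = F'.alg.bracket (Φ x) (Φ y)) ∧
    (∀ i x, x ∈ F.alg.parity i ↔ Φ x ∈ F'.alg.parity i) ∧
    ∃ (hfil : ∀ k x, x ∈ F.alg.fil k ↔ Φ x ∈ F'.alg.fil k) (g : D.GrAut),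
      ∀ k (x : F.alg.fil k), F'.symb k ⟨Φ x, (hfil k x).1 x.2⟩ = g.toEquiv (F.symb k x)

/-- Highly supersymmetric: the dimension of the odd part exceeds half the dimension of `S`. -/
def Subdeformation.IsHighlySusy (F : D.Subdeformation) : Prop :=
  Module.finrank ℝ S < 2 * Module.finrank ℝ (F.alg.parity 1)

/-- Odd-generated: the even part is spanned by brackets of odd elements. -/
def Subdeformation.IsOddGenerated (F : D.Subdeformation) : Prop :=
  F.alg.parity 0 =
    Submodule.span ℝ {z | ∃ x ∈ F.alg.parity 1, ∃ y ∈ F.alg.parity 1, z = F.alg.bracket x y}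

/-- A presentation of `F` as a filtered deformation of the graded subalgebra `V ⊕ S' ⊕ h` of `s`:
an identification of `F` with the vector space `V ⊕ S' ⊕ h` coming from a choice, compatible with
parity, of complements of `F^(k+1)` in `F^k`. In particular `Gr F = V ⊕ S' ⊕ h`. -/
structure Presentation (F : D.Subdeformation) (S' : Submodule ℝ S)
    (h : Submodule ℝ (So D.η)) where
  toEquiv : (V × S' × h) ≃ₗ[ℝ] F.carrier
  parity_V : ∀ v, toEquiv (v, 0, 0) ∈ F.alg.parity 0
  parity_S : ∀ s, toEquiv (0, s, 0) ∈ F.alg.parity 1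
  parity_h : ∀ A, toEquiv (0, 0, A) ∈ F.alg.parity 0
  fil_V : ∀ v, toEquiv (v, 0, 0) ∈ F.alg.fil (-2)
  fil_S : ∀ s, toEquiv (0, s, 0) ∈ F.alg.fil (-1)
  fil_h : ∀ A, toEquiv (0, 0, A) ∈ F.alg.fil 0
  symb_V : ∀ v, F.symb (-2) ⟨toEquiv (v, 0, 0), fil_V v⟩ = (v, 0, 0)
  symb_S : ∀ s, F.symb (-1) ⟨toEquiv (0, s, 0), fil_S s⟩ = (0, (s : S), 0)
  symb_h : ∀ A, F.symb 0 ⟨toEquiv (0, 0, A), fil_h A⟩ = (0, 0, (A : So D.η))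

section Presentation

variable {F : D.Subdeformation} {S' : Submodule ℝ S} {h : Submodule ℝ (So D.η)}

/-- The bracket of `F`, transported to `V ⊕ S' ⊕ h`. -/
def Presentation.bracket (T : Presentation F S' h) :
    (V × S' × h) →ₗ[ℝ] (V × S' × h) →ₗ[ℝ] (V × S' × h) :=
  (F.alg.bracket.compl₁₂ T.toEquiv.toLinearMap T.toEquiv.toLinearMap).compr₂
    T.toEquiv.symm.toLinearMap

/-- The Spencer cochain `α + β + γ` of a presentation: the degree two component of the deformed
bracket, restricted to `V ⊕ S'` and considered with values in `s`. -/
def Presentation.cochain (T : Presentation F S' h) : D.Cochain S' :=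
  ((T.bracket.compl₁₂ (LinearMap.inl ℝ V (S' × h)) (LinearMap.inl ℝ V (S' × h))).compr₂
      (LinearMap.fst ℝ V (S' × h)),
    (T.bracket.compl₁₂ (LinearMap.inl ℝ V (S' × h))
        (LinearMap.inr ℝ V (S' × h) ∘ₗ LinearMap.inl ℝ S' h)).compr₂
      (S'.subtype ∘ₗ LinearMap.fst ℝ S' h ∘ₗ LinearMap.snd ℝ V (S' × h)),
    (T.bracket.compl₁₂ (LinearMap.inr ℝ V (S' × h) ∘ₗ LinearMap.inl ℝ S' h)
        (LinearMap.inr ℝ V (S' × h) ∘ₗ LinearMap.inl ℝ S' h)).compr₂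
      (h.subtype ∘ₗ LinearMap.snd ℝ S' h ∘ₗ LinearMap.snd ℝ V (S' × h)))

end Presentation

/-- A cochain on `V ⊕ S'` with values in `V ⊕ S' ⊕ h` is admissible if its cohomology class with
values in `s` is the restriction of the class of some `h`-invariant normalised cocycle of `s`, that
is, if it differs from such a restriction by a coboundary. -/
def IsAdmissibleCochain {S' : Submodule ℝ S} (h : Submodule ℝ (So D.η)) (c : D.Cochain S') : Prop :=
  ∃ b ∈ D.normCocycles, D.IsInvariant h b ∧
    ∃ l : V →ₗ[ℝ] So D.η, c = D.restrictCocycle S' b + D.spencerD S' l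

/-- (Geometrically) realisable: highly supersymmetric, and the associated Spencer cohomology class
is admissible. -/
def Subdeformation.IsRealisable (F : D.Subdeformation) : Prop :=
  F.IsHighlySusy ∧ ∃ (S' : Submodule ℝ S) (h : Submodule ℝ (So D.η)) (T : Presentation F S' h),
    IsAdmissibleCochain h T.cochain

/-! ### Lie pairs -/

/-- The symmetric square `⊙² S'`, as the space of symmetric tensors in `S' ⊗ S'`. -/
def symSq (S' : Submodule ℝ S) : Submodule ℝ (S' ⊗[ℝ] S') :=
  LinearMap.eqLocus (TensorProduct.comm ℝ S' S').toLinearMap LinearMap.id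

/-- The map on `S' ⊗ S'` induced by a bilinear map on `S`. -/
def tensorLift (S' : Submodule ℝ S) {W : Type*} [AddCommGroup W] [Module ℝ W]
    (f : S →ₗ[ℝ] S →ₗ[ℝ] W) : S' ⊗[ℝ] S' →ₗ[ℝ] W :=
  TensorProduct.lift (f.compl₁₂ S'.subtype S'.subtype)

variable (D)

/-- The Dirac kernel: the kernel of `κ` on `⊙² S'`. -/
def diracKernel (S' : Submodule ℝ S) : Submodule ℝ (S' ⊗[ℝ] S') :=
  symSq S' ⊓ LinearMap.ker (tensorLift S' D.κ)

/-- Sections `V → ⊙² S'` of the squaring map. -/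
structure SquaringSection (S' : Submodule ℝ S) where
  toMap : V →ₗ[ℝ] symSq S'
  section_eq : ∀ v, tensorLift S' D.κ (toMap v : S' ⊗[ℝ] S') = v

/-- The envelope `γ(𝔇)` of `(S', β + γ)`. -/
def envelope (S' : Submodule ℝ S) (b : D.BetaGamma) : Submodule ℝ (So D.η) :=
  (D.diracKernel S').map (tensorLift S' b.2)

/-- Lie pairs `(S', β + γ)`: `S'` is a subspace of dimension greater than half that of `S`,
`β + γ` is a normalised cocycle, and the envelope annihilates `β` and preserves `S'`. -/
structure LiePair where
  sub : Submodule ℝ S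
  cocycle : D.BetaGamma
  dim_lt : Module.finrank ℝ S < 2 * Module.finrank ℝ sub
  cocycle_mem : cocycle ∈ D.normCocycles
  act_beta : ∀ A ∈ D.envelope sub cocycle, D.actBeta A cocycle.1 = 0
  act_sub : ∀ A ∈ D.envelope sub cocycle, ∀ s ∈ sub, D.spin A s ∈ sub

variable {D}

namespace LiePair

variable (P : D.LiePair)

/-- The envelope of a Lie pair. -/
def env : Submodule ℝ (So D.η) := D.envelope P.sub P.cocycle

/-- The subalgebra of all `A ∈ so(V)` which preserve `S'` and annihilate `β`. -/
def maxEnv : Submodule ℝ (So D.η) where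
  carrier := {A | (∀ s ∈ P.sub, D.spin A s ∈ P.sub) ∧ D.actBeta A P.cocycle.1 = 0}
  zero_mem' := by
    refine ⟨by simp, ?_⟩
    ext v s
    simp [actBeta]
  add_mem' := by
    rintro A B ⟨h1, h2⟩ ⟨k1, k2⟩
    refine ⟨fun s hs => by simpa using add_mem (h1 s hs) (k1 s hs), ?_⟩
    have : D.actBeta (A + B) P.cocycle.1 = D.actBeta A P.cocycle.1 + D.actBeta B P.cocycle.1 := by
      ext v s
      simp [actBeta]
      abel
    rw [this, h2, k2, add_zero]
  smul_mem' := by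
    rintro r A ⟨h1, h2⟩
    refine ⟨fun s hs => by simpa using P.sub.smul_mem r (h1 s hs), ?_⟩
    have : D.actBeta (r • A) P.cocycle.1 = r • D.actBeta A P.cocycle.1 := by
      ext v s
      simp [actBeta, smul_sub]
    rw [this, h2, smul_zero]

/-- The map `l = γ ∘ Σ : V → so(V)` of a section `Σ`. -/
def lam (sec : D.SquaringSection P.sub) : V →ₗ[ℝ] So D.η :=
  tensorLift P.sub P.cocycle.2 ∘ₗ (symSq P.sub).subtype ∘ₗ sec.toMap

/-- Admissibility of a Lie pair: `β(v, -) + γ(Σ(v))` preserves `S'` for all `v`, where `Σ` is a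
given section. -/
def IsAdmissible (sec : D.SquaringSection P.sub) : Prop :=
  ∀ v, ∀ s ∈ P.sub, P.cocycle.1 v s + D.spin (P.lam sec v) s ∈ P.sub

/-- The map `Θ(v, s, s) = 2 γ(s, β(v, s)) - (l(v) · γ)(s, s)`, in depolarised form. -/
def Theta (l : V →ₗ[ℝ] So D.η) (v : V) : S →ₗ[ℝ] S →ₗ[ℝ] So D.η :=
  P.cocycle.2.compl₂ (P.cocycle.1 v) + P.cocycle.2 ∘ₗ (P.cocycle.1 v) -
    D.actGamma (l v) P.cocycle.2

/-- `θ : Λ² V → so(V)` is the map with `θ ∘ κ = Θ` on `V ⊗ ⊙² S'`. -/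
def IsTheta (l : V →ₗ[ℝ] So D.η) (θ : V →ₗ[ℝ] V →ₗ[ℝ] So D.η) : Prop :=
  (∀ v, θ v v = 0) ∧ ∀ v, ∀ s ∈ P.sub, θ v (D.κ s s) = P.Theta l v s s

/-- Integrable Lie pairs: for some section the pair is admissible and the associated admissible
cocycle is integrable, that is, `Θ` annihilates the Dirac kernel and the induced map `θ` satisfies
`θ(v, w) · s = β(v, β(w, s)) - β(w, β(v, s)) + (l(v) · β)(w, s) - (l(w) · β)(v, s)` on `S'`. -/
def IsIntegrable : Prop :=
  ∃ sec : D.SquaringSection P.sub,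
    P.IsAdmissible sec ∧
    (∀ v, ∀ ω ∈ D.diracKernel P.sub, tensorLift P.sub (P.Theta (P.lam sec) v) ω = 0) ∧
    ∃ θ, P.IsTheta (P.lam sec) θ ∧ ∀ v w, ∀ s ∈ P.sub,
      D.spin (θ v w) s =
        P.cocycle.1 v (P.cocycle.1 w s) - P.cocycle.1 w (P.cocycle.1 v s) +
          D.actBeta (P.lam sec v) P.cocycle.1 w s - D.actBeta (P.lam sec w) P.cocycle.1 v s

/-- The deformed bracket determined by `β + γ`, `l` and `θ`:
`[A, B] = AB - BA`, `[A, v] = A v + ([A, l(v)] - l(A v))`, `[A, s] = A · s`,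
`[s, s] = κ(s, s) + (γ(s, s) - l(κ(s, s)))`, `[v, s] = β(v, s) + l(v) · s`,
`[v, w] = (l(v) w - l(w) v) + (θ(v, w) - l(l(v) w - l(w) v) + [l(v), l(w)])`. -/
def deformedBracket (l : V →ₗ[ℝ] So D.η) (θ : V →ₗ[ℝ] V →ₗ[ℝ] So D.η) (x y : D.Total) :
    D.Total :=
  let v := x.1
  let s := x.2.1
  let A := x.2.2
  let w := y.1
  let t := y.2.1
  let B := y.2.2
  (D.vec A w - D.vec B v + D.κ s t + (D.vec (l v) w - D.vec (l w) v),
    D.spin A t - D.spin B s + (P.cocycle.1 v t + D.spin (l v) t) -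
      (P.cocycle.1 w s + D.spin (l w) s),
    ⁅A, B⁆ + (⁅A, l w⁆ - l (D.vec A w)) - (⁅B, l v⁆ - l (D.vec B v)) +
      (P.cocycle.2 s t - l (D.κ s t)) +
      (θ v w - l (D.vec (l v) w - D.vec (l w) v) + ⁅l v, l w⁆))

/-- `F` is the filtered deformation of `V ⊕ S' ⊕ h` with the deformed bracket determined by the
Lie pair `P = (S', β + γ)` (for some section of the squaring map). -/
def IsDeformationOver (h : Submodule ℝ (So D.η)) (F : D.Subdeformation) : Prop :=
  ∃ (sec : D.SquaringSection P.sub) (θ : V →ₗ[ℝ] V →ₗ[ℝ] So D.η) (T : Presentation F P.sub h),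
    P.IsTheta (P.lam sec) θ ∧
    ∀ x y, Prod.map id (Prod.map P.sub.subtype h.subtype) (T.bracket x y) =
      P.deformedBracket (P.lam sec) θ (Prod.map id (Prod.map P.sub.subtype h.subtype) x)
        (Prod.map id (Prod.map P.sub.subtype h.subtype) y)

/-- `F` is the subdeformation associated with the Lie pair. -/
def IsAssociated (F : D.Subdeformation) : Prop := P.IsDeformationOver P.env F

/-- `F` is the maximal realisable subdeformation associated with the Lie pair. -/
def IsMaxAssociated (F : D.Subdeformation) : Prop := P.IsDeformationOver P.maxEnv F

/-- Weak equivalence of Lie pairs. -/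
def WeakEquiv (Q : D.LiePair) : Prop :=
  ∃ (g : D.GrAut) (φ : D.BetaGamma), φ ∈ D.kernelCocycles Q.sub ∧ D.IsInvariant Q.env φ ∧
    Q.sub = P.sub.map g.onS.toLinearMap ∧ Q.cocycle = D.smulBetaGamma g P.cocycle + φ

/-- Strong equivalence of Lie pairs. -/
def StrongEquiv (Q : D.LiePair) : Prop :=
  ∃ g : D.GrAut, Q.sub = P.sub.map g.onS.toLinearMap ∧ Q.cocycle = D.smulBetaGamma g P.cocycle

end LiePair

variable (D)

/-- Integrable Lie pairs. -/
abbrev IntegrableLiePair : Type (max u v) := {P : D.LiePair // P.IsIntegrable}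

/-- Highly supersymmetric, odd-generated, realisable filtered subdeformations. -/
abbrev OddGenRealisable : Type (max u v + 1) :=
  {F : D.Subdeformation // F.IsHighlySusy ∧ F.IsOddGenerated ∧ F.IsRealisable}

end PoincareData

end

noncomputable section

attribute [local instance 100] LieRing.ofAssociativeRing

/-! The auxiliary map `l` can be removed by a change of coordinates. Sending (v, s, A) to (v, s, A +
l(v)) identifies the deformation of V ⊕ S' ⊕ h with E ⊕ S', where E ⊆ V ⊕ so(V) is spanned by the
squares κ(s, t) + γ(s, t) with s, t in S', together with h. In these coordinates the brackets are
the Poincaré ones corrected by β, γ and θ, and `l` no longer appears. The subspace E depends only on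
S', β + γ and h, so the choice of section disappears as well. This is the content of `FlatModel`.

In a flat model the Jacobi identities have a direct meaning. For two even elements and an odd one
they give the equation for θ acting on S'; for one even element and two odd ones they give the first
cocycle condition and θ ∘ κ = Θ; for three odd elements they give the second cocycle condition. The
identity for three even elements then follows (`IsFlat.of_jac`). Integrability is therefore exactly
what makes E ⊕ S' a Lie superalgebra, for h the envelope or the maximal subalgebra.

Two rigidity facts carry the classification. The first is local homogeneity (`span_κ_eq_top`): if
dim S' exceeds half of dim S, the squares of S' span V. Otherwise some v ≠ 0 is orthogonal to all of
them, so the quadratic form η(v, κ(s, s)) vanishes on S'; but by causality this form is anisotropic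
on a subspace of at least half the dimension (`exists_anisotropic`), which would have to meet S'. It
follows that sections exist and that so(V) acts faithfully on S'. The second is that so(V) has no
first prolongation (`eq_zero_of_symm`).

Well-definedness: a cocycle whose β vanishes on V ⊗ S' has γ vanishing on ⊙²S', because γ is
determined by β. It therefore changes neither E nor the brackets, and θ is itself determined by the
remaining data, so g ∈ G induces the isomorphism (`FlatModel.iso`).

Injectivity: an isomorphism with symbol g, read in flat models, agrees with g on the V- and
S-components. Its so(V)-component differs from that of g by a family which the prolongation argument
kills, so β and g · β agree on S' and the difference of the cocycles is the required φ
(`weakEquiv_of_iso`).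

Surjectivity: for a realisable F, the Jacobi identity on S' and faithfulness force all brackets that
the cochain does not prescribe, which gives a flat model (`Presentation.exists_flatModel`). Odd
generation forces h to be the envelope, and the Jacobi identities then say that the resulting Lie
pair is integrable (`exists_liePair`). -/

/-- A symmetric bilinear map which vanishes on the diagonal of a submodule vanishes on it. -/
theorem LinearMap.eq_zero_of_diag {S W : Type*} [AddCommGroup S] [Module ℝ S] [AddCommGroup W]
    [Module ℝ W] (f : S →ₗ[ℝ] S →ₗ[ℝ] W) (hf : ∀ s t, f s t = f t s) (N : Submodule ℝ S)
    (h : ∀ s ∈ N, f s s = 0) {s t : S} (hs : s ∈ N) (ht : t ∈ N) : f s t = 0 := by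
  have h1 := h (s + t) (N.add_mem hs ht)
  simp only [map_add, LinearMap.add_apply, h s hs, h t ht, hf t s] at h1
  have h2 : (2 : ℝ) • f s t = 0 := by rw [← h1]; module
  simpa using h2

namespace PoincareData

universe u v

variable {V : Type u} {S : Type v} [AddCommGroup V] [Module ℝ V] [FiniteDimensional ℝ V]
  [AddCommGroup S] [Module ℝ S] [FiniteDimensional ℝ S] {D : PoincareData V S}

theorem vec_injective : Function.Injective D.vec := Subtype.val_injective

theorem so_ext {A B : So D.η} (h : ∀ v, D.vec A v = D.vec B v) : A = B :=
  vec_injective (LinearMap.ext h)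

@[simp] theorem actBeta_apply (A : So D.η) (β : V →ₗ[ℝ] S →ₗ[ℝ] S) (v : V) (s : S) :
    D.actBeta A β v s = D.spin A (β v s) - β (D.vec A v) s - β v (D.spin A s) := rfl

@[simp] theorem actGamma_apply (A : So D.η) (γ : S →ₗ[ℝ] S →ₗ[ℝ] So D.η) (s t : S) :
    D.actGamma A γ s t = ⁅A, γ s t⁆ - γ (D.spin A s) t - γ s (D.spin A t) := rfl

/-! ### Normalised cocycles -/

section Cocycles

variable {b : D.BetaGamma}

theorem gamma_symm (hb : b ∈ D.normCocycles) (s t : S) : b.2 s t = b.2 t s := hb.1 s t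

/-- Polarisation of the first cocycle condition. Since so(V) acts faithfully on V, this shows that
`γ` on ⊙²S' is determined by `β` on V ⊗ S'; vanishing and invariance of `γ` are always deduced from
those of `β` in this way. -/
theorem vec_gamma (hb : b ∈ D.normCocycles) (v : V) (s t : S) :
    D.vec (b.2 s t) v = -(D.κ (b.1 v s) t + D.κ s (b.1 v t)) := by
  have key := LinearMap.eq_zero_of_diag
    (b.2.compr₂ (LinearMap.applyₗ v ∘ₗ D.vec) + D.κ ∘ₗ b.1 v + D.κ.compl₂ (b.1 v))
    (fun s t => by
      simp only [LinearMap.add_apply, LinearMap.compr₂_apply, LinearMap.comp_apply,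
        LinearMap.compl₂_apply, LinearMap.applyₗ_apply_apply, gamma_symm hb s t,
        D.κ_symm s, D.κ_symm _ t]
      abel) ⊤
    (fun s _ => by
      have := hb.2.1 v s
      simp only [LinearMap.add_apply, LinearMap.compr₂_apply, LinearMap.comp_apply,
        LinearMap.compl₂_apply, LinearMap.applyₗ_apply_apply, D.κ_symm (b.1 v s) s]
      rw [← this]; module) (s := s) (t := t) trivial trivial
  simp only [LinearMap.add_apply, LinearMap.compr₂_apply, LinearMap.comp_apply,
    LinearMap.compl₂_apply, LinearMap.applyₗ_apply_apply] at key
  rw [← sub_eq_zero, ← key]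
  abel

/-- Full polarisation of the cubic second cocycle condition. In a flat model it is the Jacobi
identity of three odd elements. -/
theorem cocycle_cyclic (hb : b ∈ D.normCocycles) (s t u : S) :
    (b.1 (D.κ s t) u + D.spin (b.2 s t) u) + (b.1 (D.κ t u) s + D.spin (b.2 t u) s) +
      (b.1 (D.κ u s) t + D.spin (b.2 u s) t) = 0 := by
  have h := hb.2.2
  have h1 := h (s + t + u)
  have h2 := h (s + t)
  have h3 := h (s + u)
  have h4 := h (t + u)
  have h5 := h s
  have h6 := h t
  have h7 := h u
  simp only [map_add, LinearMap.add_apply, gamma_symm hb t s, gamma_symm hb u s,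
    gamma_symm hb u t, D.κ_symm t s, D.κ_symm u s, D.κ_symm u t] at *
  -- Inclusion-exclusion over the nonempty subsets of {s, t, u}. Each cyclic term occurs twice in
  -- the polarised cube because κ and γ are symmetric, whence the factor 1/2.
  linear_combination (norm := module) (1 / 2 : ℝ) • h1 - (1 / 2 : ℝ) • h2 - (1 / 2 : ℝ) • h3
    - (1 / 2 : ℝ) • h4 + (1 / 2 : ℝ) • h5 + (1 / 2 : ℝ) • h6 + (1 / 2 : ℝ) • h7

/-- If `β` vanishes on `V ⊗ S'`, then `γ` vanishes on `⊙² S'`. -/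
theorem gamma_eq_zero (hb : b ∈ D.normCocycles) {N : Submodule ℝ S}
    (h : ∀ v, ∀ s ∈ N, b.1 v s = 0) {s t : S} (hs : s ∈ N) (ht : t ∈ N) : b.2 s t = 0 :=
  so_ext fun v => by rw [vec_gamma hb, h v s hs, h v t ht]; simp

/-- The action of `so(V)` preserves the normalised cocycle condition relating `β` and `γ`. -/
theorem actGamma_eq_zero (hb : b ∈ D.normCocycles) {A : So D.η} (h : D.actBeta A b.1 = 0) :
    D.actGamma A b.2 = 0 := by
  ext1 s
  ext1 t
  -- Applied to a vector, γ can be rewritten through β by `vec_gamma`, and κ is equivariant.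
  refine so_ext fun v => ?_
  have e : ∀ v s, D.spin A (b.1 v s) = b.1 (D.vec A v) s + b.1 v (D.spin A s) := fun v s => by
    have := LinearMap.congr_fun (LinearMap.congr_fun h v) s
    rw [actBeta_apply, LinearMap.zero_apply, LinearMap.zero_apply, sub_sub, sub_eq_zero] at this
    exact this
  simp only [actGamma_apply, map_sub, LinearMap.sub_apply, vec_lie, vec_gamma hb, map_neg, map_add,
    vec_κ, e, LinearMap.zero_apply, map_zero, LinearMap.add_apply]
  abel

theorem lie_gamma (hb : b ∈ D.normCocycles) {A : So D.η} (h : D.actBeta A b.1 = 0) (s t : S) :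
    ⁅A, b.2 s t⁆ = b.2 (D.spin A s) t + b.2 s (D.spin A t) := by
  have := LinearMap.congr_fun (LinearMap.congr_fun (actGamma_eq_zero hb h) s) t
  rwa [actGamma_apply, LinearMap.zero_apply, LinearMap.zero_apply, sub_sub, sub_eq_zero] at this

end Cocycles

/-! ### Graded automorphisms -/

namespace GrAut

theorem map_vec (g : D.GrAut) (A : So D.η) (v : V) :
    g.onV (D.vec A v) = D.vec (g.onSo A) (g.onV v) := by
  have := congrArg Prod.fst (g.map_bracket (0, 0, A) (v, 0, 0))
  simpa [bracket_apply] using this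

theorem map_spin (g : D.GrAut) (A : So D.η) (s : S) :
    g.onS (D.spin A s) = D.spin (g.onSo A) (g.onS s) := by
  have := congrArg (fun x => x.2.1) (g.map_bracket (0, 0, A) (0, s, 0))
  simpa [bracket_apply] using this

theorem map_lie (g : D.GrAut) (A B : So D.η) :
    g.onSo ⁅A, B⁆ = ⁅g.onSo A, g.onSo B⁆ := by
  have := congrArg (fun x => x.2.2) (g.map_bracket (0, 0, A) (0, 0, B))
  simpa [bracket_apply] using this

theorem map_κ (g : D.GrAut) (s t : S) : g.onV (D.κ s t) = D.κ (g.onS s) (g.onS t) := by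
  have := congrArg Prod.fst (g.map_bracket (0, s, 0) (0, t, 0))
  simpa [bracket_apply] using this

theorem toEquiv_apply (g : D.GrAut) (x : D.Total) :
    g.toEquiv x = (g.onV x.1, g.onS x.2.1, g.onSo x.2.2) := rfl

variable (D) in
/-- The identity automorphism. -/
def refl : D.GrAut where
  onV := .refl ℝ V
  onS := .refl ℝ S
  onSo := .refl ℝ _
  map_bracket _ _ := rfl

/-- The inverse automorphism. -/
def symm (g : D.GrAut) : D.GrAut where
  onV := g.onV.symm
  onS := g.onS.symm
  onSo := g.onSo.symm
  map_bracket x y := by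
    apply (g.onV.prodCongr (g.onS.prodCongr g.onSo)).injective
    rw [g.map_bracket]
    simp

/-- Composition of automorphisms. -/
def trans (g k : D.GrAut) : D.GrAut where
  onV := g.onV.trans k.onV
  onS := g.onS.trans k.onS
  onSo := g.onSo.trans k.onSo
  map_bracket x y := by
    have h := congrArg (k.onV.prodCongr (k.onS.prodCongr k.onSo)) (g.map_bracket x y)
    rw [k.map_bracket] at h
    exact h

end GrAut

theorem smulBetaGamma_fst (g : D.GrAut) (b : D.BetaGamma) (v : V) (s : S) :
    (D.smulBetaGamma g b).1 v s = g.onS (b.1 (g.onV.symm v) (g.onS.symm s)) := rfl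

theorem smulBetaGamma_snd (g : D.GrAut) (b : D.BetaGamma) (s t : S) :
    (D.smulBetaGamma g b).2 s t = g.onSo (b.2 (g.onS.symm s) (g.onS.symm t)) := rfl

theorem smulBetaGamma_map_fst (g : D.GrAut) (b : D.BetaGamma) (v : V) (s : S) :
    (D.smulBetaGamma g b).1 (g.onV v) (g.onS s) = g.onS (b.1 v s) := by
  simp [smulBetaGamma_fst]

theorem smulBetaGamma_map_snd (g : D.GrAut) (b : D.BetaGamma) (s t : S) :
    (D.smulBetaGamma g b).2 (g.onS s) (g.onS t) = g.onSo (b.2 s t) := by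
  simp [smulBetaGamma_snd]

theorem betaGamma_ext {b c : D.BetaGamma} (h1 : ∀ v s, b.1 v s = c.1 v s)
    (h2 : ∀ s t, b.2 s t = c.2 s t) : b = c :=
  Prod.ext (LinearMap.ext₂ h1) (LinearMap.ext₂ h2)

theorem smulBetaGamma_refl (b : D.BetaGamma) : D.smulBetaGamma (GrAut.refl D) b = b := rfl

theorem smulBetaGamma_trans (g k : D.GrAut) (b : D.BetaGamma) :
    D.smulBetaGamma (g.trans k) b = D.smulBetaGamma k (D.smulBetaGamma g b) := rfl

theorem smulBetaGamma_symm (g : D.GrAut) (b : D.BetaGamma) :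
    D.smulBetaGamma g.symm (D.smulBetaGamma g b) = b :=
  betaGamma_ext
    (fun v s => by simp [smulBetaGamma_fst, GrAut.symm])
    (fun s t => by simp [smulBetaGamma_snd, GrAut.symm])

theorem smulBetaGamma_add (g : D.GrAut) (b c : D.BetaGamma) :
    D.smulBetaGamma g (b + c) = D.smulBetaGamma g b + D.smulBetaGamma g c :=
  betaGamma_ext (fun v s => by simp [smulBetaGamma_fst]) (fun s t => by simp [smulBetaGamma_snd])

theorem smulBetaGamma_mem (g : D.GrAut) {b : D.BetaGamma} (hb : b ∈ D.normCocycles) :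
    D.smulBetaGamma g b ∈ D.normCocycles := by
  refine ⟨fun s t => ?_, fun v s => ?_, fun s => ?_⟩
  · rw [smulBetaGamma_snd, smulBetaGamma_snd, gamma_symm hb]
  · obtain ⟨s, rfl⟩ := g.onS.surjective s
    obtain ⟨v, rfl⟩ := g.onV.surjective v
    rw [smulBetaGamma_map_fst, smulBetaGamma_map_snd, ← g.map_κ, ← g.map_vec, ← map_smul,
      ← map_add, hb.2.1, map_zero]
  · obtain ⟨s, rfl⟩ := g.onS.surjective s
    rw [← g.map_κ, smulBetaGamma_map_fst, smulBetaGamma_map_snd, ← g.map_spin, ← map_add,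
      hb.2.2, map_zero]

theorem actBeta_smul_map (g : D.GrAut) (b : D.BetaGamma) (A : So D.η) (v : V) (s : S) :
    D.actBeta (g.onSo A) (D.smulBetaGamma g b).1 (g.onV v) (g.onS s) =
      g.onS (D.actBeta A b.1 v s) := by
  simp only [actBeta_apply, smulBetaGamma_map_fst, ← g.map_spin, ← g.map_vec, map_sub]

theorem actBeta_smul_eq_zero (g : D.GrAut) (b : D.BetaGamma) {A : So D.η} :
    D.actBeta (g.onSo A) (D.smulBetaGamma g b).1 = 0 ↔ D.actBeta A b.1 = 0 := by
  constructor
  · intro h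
    ext v s
    apply g.onS.injective
    rw [← actBeta_smul_map, h]
    simp
  · intro h
    refine LinearMap.ext₂ fun v s => ?_
    obtain ⟨s, rfl⟩ := g.onS.surjective s
    obtain ⟨v, rfl⟩ := g.onV.surjective v
    rw [actBeta_smul_map, h]
    simp

/-- By `actGamma_eq_zero` invariance need only be tested on `β`, which is why the axioms of a Lie
pair mention `β` alone. -/
theorem isInvariant_iff {h : Submodule ℝ (So D.η)} {b : D.BetaGamma} (hb : b ∈ D.normCocycles) :
    D.IsInvariant h b ↔ ∀ A ∈ h, D.actBeta A b.1 = 0 :=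
  ⟨fun H A hA => (H A hA).1, fun H A hA => ⟨H A hA, actGamma_eq_zero hb (H A hA)⟩⟩

theorem actBeta_add_right (A : So D.η) (β β' : V →ₗ[ℝ] S →ₗ[ℝ] S) :
    D.actBeta A (β + β') = D.actBeta A β + D.actBeta A β' := by
  refine LinearMap.ext₂ fun v s => ?_
  simp only [actBeta_apply, LinearMap.add_apply, map_add]
  abel

theorem actBeta_sub_left (A B : So D.η) (β : V →ₗ[ℝ] S →ₗ[ℝ] S) :
    D.actBeta (A - B) β = D.actBeta A β - D.actBeta B β := by
  refine LinearMap.ext₂ fun v s => ?_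
  simp only [actBeta_apply, LinearMap.sub_apply, map_sub]
  abel

theorem actBeta_lie (A B : So D.η) (β : V →ₗ[ℝ] S →ₗ[ℝ] S) (hA : D.actBeta A β = 0)
    (hB : D.actBeta B β = 0) : D.actBeta ⁅A, B⁆ β = 0 := by
  have e : ∀ {A : So D.η}, D.actBeta A β = 0 → ∀ v s,
      D.spin A (β v s) = β (D.vec A v) s + β v (D.spin A s) := fun {A} h v s => by
    have := LinearMap.congr_fun (LinearMap.congr_fun h v) s
    rw [actBeta_apply, LinearMap.zero_apply, LinearMap.zero_apply, sub_sub, sub_eq_zero] at this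
    exact this
  refine LinearMap.ext₂ fun v s => ?_
  simp only [actBeta_apply, spin_lie, vec_lie, e hA, e hB, map_add, map_sub,
    LinearMap.sub_apply, LinearMap.zero_apply]
  abel

/-! ### The flat bracket -/

variable (D) in
/-- The bracket on `V ⊕ so(V)` with `[A, v] = A v`, `[A, B] = AB - BA` and `[v, w] = θ(v, w)`. -/
def evenBracket (θ : V →ₗ[ℝ] V →ₗ[ℝ] So D.η) :
    (V × So D.η) →ₗ[ℝ] (V × So D.η) →ₗ[ℝ] (V × So D.η) :=
  LinearMap.mk₂ ℝ (fun x y => (D.vec x.2 y.1 - D.vec y.2 x.1, ⁅x.2, y.2⁆ + θ x.1 y.1))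
    (fun x x' y => by
      refine Prod.ext ?_ ?_
      · simp only [Prod.fst_add, Prod.snd_add, map_add, LinearMap.add_apply]; abel
      · simp only [Prod.fst_add, Prod.snd_add, map_add, LinearMap.add_apply, add_lie]; abel)
    (fun c x y => by
      refine Prod.ext ?_ ?_
      · simp only [Prod.smul_fst, Prod.smul_snd, map_smul, LinearMap.smul_apply]; module
      · simp only [Prod.smul_fst, Prod.smul_snd, map_smul, LinearMap.smul_apply, smul_lie,
          smul_add])
    (fun x y y' => by
      refine Prod.ext ?_ ?_
      · simp only [Prod.fst_add, Prod.snd_add, map_add, LinearMap.add_apply]; abel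
      · simp only [Prod.fst_add, Prod.snd_add, map_add, lie_add]; abel)
    (fun c x y => by
      refine Prod.ext ?_ ?_
      · simp only [Prod.smul_fst, Prod.smul_snd, map_smul, LinearMap.smul_apply]; module
      · simp only [Prod.smul_fst, Prod.smul_snd, map_smul, lie_smul, smul_add])

theorem evenBracket_apply (θ : V →ₗ[ℝ] V →ₗ[ℝ] So D.η) (x y : V × So D.η) :
    D.evenBracket θ x y = (D.vec x.2 y.1 - D.vec y.2 x.1, ⁅x.2, y.2⁆ + θ x.1 y.1) := rfl

theorem evenBracket_skew {θ : V →ₗ[ℝ] V →ₗ[ℝ] So D.η} (hθ : ∀ v, θ v v = 0)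
    (x y : V × So D.η) : D.evenBracket θ x y = -D.evenBracket θ y x := by
  have h : θ x.1 y.1 = -θ y.1 x.1 := by
    have := hθ (x.1 + y.1)
    simp only [map_add, LinearMap.add_apply, hθ, zero_add, add_zero] at this
    exact eq_neg_of_add_eq_zero_right this
  rw [evenBracket_apply, evenBracket_apply, h, ← lie_skew]
  refine Prod.ext ?_ ?_
  · simp
  · simp [add_comm]

variable (D) in
/-- The action `(v, A) · s = β(v, s) + A · s` of `V ⊕ so(V)` on `S`. -/
def evenAct (b : D.BetaGamma) : (V × So D.η) →ₗ[ℝ] S →ₗ[ℝ] S := b.1.coprod D.spin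

theorem evenAct_apply (b : D.BetaGamma) (x : V × So D.η) (s : S) :
    D.evenAct b x s = b.1 x.1 s + D.spin x.2 s := rfl

variable (D) in
/-- The squaring map `(s, t) ↦ κ(s, t) + γ(s, t)`. -/
def square (b : D.BetaGamma) : S →ₗ[ℝ] S →ₗ[ℝ] (V × So D.η) :=
  D.κ.compr₂ (LinearMap.inl ℝ V _) + b.2.compr₂ (LinearMap.inr ℝ V _)

theorem square_apply (b : D.BetaGamma) (s t : S) : D.square b s t = (D.κ s t, b.2 s t) := by
  simp [square]

theorem square_symm {b : D.BetaGamma} (hb : b ∈ D.normCocycles) (s t : S) :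
    D.square b s t = D.square b t s := by
  rw [square_apply, square_apply, D.κ_symm, gamma_symm hb]

/-! ### The span of the squares -/

variable (D) in
/-- The span of `κ(s, t) + γ(s, t)`, for `s` and `t` in `S'`. -/
def squareSpan (S' : Submodule ℝ S) (b : D.BetaGamma) : Submodule ℝ (V × So D.η) :=
  Submodule.span ℝ {x | ∃ s ∈ S', ∃ t ∈ S', x = D.square b s t}

theorem square_mem {S' : Submodule ℝ S} {b : D.BetaGamma} {s t : S} (hs : s ∈ S') (ht : t ∈ S') :
    D.square b s t ∈ D.squareSpan S' b := Submodule.subset_span ⟨s, hs, t, ht, rfl⟩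

theorem tensorLift_tmul {W : Type*} [AddCommGroup W] [Module ℝ W] (S' : Submodule ℝ S)
    (f : S →ₗ[ℝ] S →ₗ[ℝ] W) (s t : S') : tensorLift S' f (s ⊗ₜ t) = f s t := rfl

theorem tensorLift_mem {S' : Submodule ℝ S} (b : D.BetaGamma) (ω : S' ⊗[ℝ] S') :
    (tensorLift S' D.κ ω, tensorLift S' b.2 ω) ∈ D.squareSpan S' b := by
  induction ω using TensorProduct.induction_on with
  | zero => rw [map_zero, map_zero]; exact zero_mem _
  | tmul s t =>
    rw [tensorLift_tmul, tensorLift_tmul, ← square_apply]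
    exact square_mem s.2 t.2
  | add x y hx hy => simpa using add_mem hx hy

/-- Symmetrising a tensor changes neither κ nor γ, so lifts can be taken in ⊙²S' and not merely in
S' ⊗ S'. The Dirac kernel and the sections live there. -/
theorem exists_symSq {S' : Submodule ℝ S} {b : D.BetaGamma} (hb : b ∈ D.normCocycles)
    {x : V × So D.η} (hx : x ∈ D.squareSpan S' b) :
    ∃ ω ∈ symSq S', tensorLift S' D.κ ω = x.1 ∧ tensorLift S' b.2 ω = x.2 := by
  induction hx using Submodule.span_induction with
  | mem x hx =>
    obtain ⟨s, hs, t, ht, rfl⟩ := hx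
    refine ⟨(1 / 2 : ℝ) • ((⟨s, hs⟩ : S') ⊗ₜ (⟨t, ht⟩ : S') + (⟨t, ht⟩ : S') ⊗ₜ (⟨s, hs⟩ : S')),
      ?_, ?_, ?_⟩
    · simp [symSq, add_comm]
    · simp only [map_smul, map_add, tensorLift_tmul, square_apply, D.κ_symm t s]
      module
    · simp only [map_smul, map_add, tensorLift_tmul, square_apply, gamma_symm hb t s]
      module
  | zero => exact ⟨0, zero_mem _, by simp, by simp⟩
  | add x y _ _ hx hy =>
    obtain ⟨ω, h1, h2, h3⟩ := hx
    obtain ⟨ω', h1', h2', h3'⟩ := hy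
    exact ⟨ω + ω', add_mem h1 h1', by simp [h2, h2'], by simp [h3, h3']⟩
  | smul r x _ hx =>
    obtain ⟨ω, h1, h2, h3⟩ := hx
    exact ⟨r • ω, Submodule.smul_mem _ r h1, by simp [h2], by simp [h3]⟩

/-- The Dirac kernel is where the V-component of a square vanishes, so the envelope is the
intersection of the span of the squares with so(V). This description replaces tensors in what
follows. -/
theorem mem_envelope_iff {S' : Submodule ℝ S} {b : D.BetaGamma} (hb : b ∈ D.normCocycles)
    {A : So D.η} : A ∈ D.envelope S' b ↔ ((0, A) : V × So D.η) ∈ D.squareSpan S' b := by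
  constructor
  · rintro ⟨ω, hω, rfl⟩
    have := tensorLift_mem b ω
    rwa [show tensorLift S' D.κ ω = 0 from hω.2] at this
  · intro h
    obtain ⟨ω, h1, h2, h3⟩ := exists_symSq hb h
    exact ⟨ω, ⟨h1, h2⟩, h3⟩

variable (D) in
/-- The even subspace `⟨κ(s, t) + γ(s, t)⟩ + h` of `V ⊕ so(V)`. -/
def evenSub (S' : Submodule ℝ S) (b : D.BetaGamma) (h : Submodule ℝ (So D.η)) :
    Submodule ℝ (V × So D.η) := D.squareSpan S' b ⊔ h.map (LinearMap.inr ℝ V (So D.η))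

theorem squareSpan_le_evenSub {S' : Submodule ℝ S} {b : D.BetaGamma} {h : Submodule ℝ (So D.η)} :
    D.squareSpan S' b ≤ D.evenSub S' b h := le_sup_left

theorem inr_mem_evenSub {S' : Submodule ℝ S} {b : D.BetaGamma} {h : Submodule ℝ (So D.η)}
    {A : So D.η} (hA : A ∈ h) : ((0, A) : V × So D.η) ∈ D.evenSub S' b h :=
  Submodule.mem_sup_right ⟨A, hA, rfl⟩

theorem evenSub_induction {S' : Submodule ℝ S} {b : D.BetaGamma} {h : Submodule ℝ (So D.η)}
    {N : Submodule ℝ (V × So D.η)} (h1 : ∀ s ∈ S', ∀ t ∈ S', D.square b s t ∈ N)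
    (h2 : ∀ A ∈ h, ((0, A) : V × So D.η) ∈ N) : D.evenSub S' b h ≤ N := by
  refine sup_le (Submodule.span_le.2 ?_) ?_
  · rintro _ ⟨s, hs, t, ht, rfl⟩
    exact h1 s hs t ht
  · rintro _ ⟨A, hA, rfl⟩
    exact h2 A hA

/-- Two elements of the even subspace with the same V-component differ by an element of the envelope
plus h, that is, of h. Hence the subspace is the graph of `l` translated by h, and `shear` can
identify it with V ⊕ h. -/
theorem mem_evenSub_iff {S' : Submodule ℝ S} {b : D.BetaGamma} (hb : b ∈ D.normCocycles)
    {h : Submodule ℝ (So D.η)} (hh : D.envelope S' b ≤ h) {l : V →ₗ[ℝ] So D.η}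
    (hl : ∀ v, (v, l v) ∈ D.evenSub S' b h) {x : V × So D.η} :
    x ∈ D.evenSub S' b h ↔ x.2 - l x.1 ∈ h := by
  constructor
  · intro hx
    have h1 := sub_mem hx (hl x.1)
    obtain ⟨y, hy, z, ⟨A, hA, rfl⟩, hz⟩ := Submodule.mem_sup.1 h1
    obtain ⟨y1, y2⟩ := y
    have e1 : y1 = 0 := by simpa using congrArg Prod.fst hz
    have e2 : y2 + A = x.2 - l x.1 := by simpa using congrArg Prod.snd hz
    subst e1
    rw [← e2]
    exact add_mem (hh ((mem_envelope_iff hb).2 hy)) hA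
  · intro hx
    have h1 := add_mem (inr_mem_evenSub (S' := S') (b := b) hx) (hl x.1)
    simpa using h1

end PoincareData

/-! ### Lorentzian geometry -/

namespace IsLorentzian

variable {V : Type*} [AddCommGroup V] [Module ℝ V] {η : LinearMap.BilinForm ℝ V}

/-- A timelike vector is only orthogonal to spacelike vectors. -/
theorem eq_zero_of_timelike (h : IsLorentzian η) {v x : V} (hv : η v v < 0) (hx : η x x ≤ 0)
    (hvx : η v x = 0) : x = 0 := by
  obtain ⟨e, he, hpos⟩ := h.exists_timelike
  set a := η e v with ha
  set c := η e x with hc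
  have hxv : η x v = 0 := by rw [h.symm]; exact hvx
  -- This combination is orthogonal to e, hence spacelike or zero, whereas its square is a sum of
  -- two nonpositive terms.
  have hz : η e (c • v - a • x) = 0 := by
    simp only [map_sub, map_smul, smul_eq_mul, ← ha, ← hc]; ring
  have hzz : η (c • v - a • x) (c • v - a • x) = c ^ 2 * η v v + a ^ 2 * η x x := by
    simp only [map_sub, map_smul, LinearMap.sub_apply, LinearMap.smul_apply, smul_eq_mul, hvx, hxv]
    ring
  have ha0 : a ≠ 0 := fun h0 => by
    have hv0 : v ≠ 0 := by rintro rfl; simp at hv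
    exact absurd (hpos v h0 hv0) (not_lt.2 hv.le)
  have hz0 : c • v - a • x = 0 := by
    by_contra hne
    have h1 := hpos _ hz hne
    rw [hzz] at h1
    nlinarith [mul_nonneg (sq_nonneg c) (neg_nonneg.2 hv.le),
      mul_nonneg (sq_nonneg a) (neg_nonneg.2 hx)]
  have hc0 : c = 0 := by
    rw [hz0] at hzz
    simp only [map_zero] at hzz
    have h1 : c ^ 2 * η v v = 0 := by
      nlinarith [mul_nonneg (sq_nonneg c) (neg_nonneg.2 hv.le),
        mul_nonneg (sq_nonneg a) (neg_nonneg.2 hx)]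
    rcases mul_eq_zero.1 h1 with h2 | h2
    · exact pow_eq_zero_iff (two_ne_zero) |>.1 h2
    · exact absurd h2 hv.ne
  rw [hc0, zero_smul, zero_sub, neg_eq_zero] at hz0
  exact (smul_eq_zero.1 hz0).resolve_left ha0

theorem pos_of_orthogonal (h : IsLorentzian η) {v x : V} (hv : η v v < 0) (hx : x ≠ 0)
    (hvx : η v x = 0) : 0 < η x x := by
  by_contra hne
  exact hx (h.eq_zero_of_timelike hv (not_lt.1 hne) hvx)

end IsLorentzian

/-! ### Infinitesimal rotations acting on spinors, and local homogeneity -/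

namespace PoincareData

universe u v

variable {V : Type u} {S : Type v} [AddCommGroup V] [Module ℝ V] [FiniteDimensional ℝ V]
  [AddCommGroup S] [Module ℝ S] [FiniteDimensional ℝ S] (D : PoincareData V S)

/-- The infinitesimal rotation `v ↦ η(y, v) x - η(x, v) y` in the plane of `x` and `y`. -/
def rot (x y : V) : So D.η :=
  ⟨(D.η y).smulRight x - (D.η x).smulRight y, by
    rw [← LieSubalgebra.mem_toSubmodule]
    change _ ∈ LinearMap.skewAdjointSubmodule D.η
    rw [LinearMap.mem_skewAdjointSubmodule]
    intro v w
    rw [Pi.neg_apply]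
    simp only [LinearMap.sub_apply, LinearMap.smulRight_apply, map_sub, map_smul,
      LinearMap.smul_apply, smul_eq_mul, map_neg]
    rw [D.lorentzian.symm v x, D.lorentzian.symm v y]
    ring⟩

theorem vec_rot (x y v : V) : D.vec (D.rot x y) v = D.η y v • x - D.η x v • y := rfl

/-- The product of two vectors in the even Clifford algebra. -/
abbrev evenι (x y : V) : EvenClifford D.η :=
  (CliffordAlgebra.even.ι (LinearMap.BilinMap.toQuadraticMap D.η)).bilin x y

theorem coe_evenι (x y : V) : (D.evenι x y : CliffordAlgebra (LinearMap.BilinMap.toQuadraticMap D.η)) =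
    CliffordAlgebra.ι _ x * CliffordAlgebra.ι _ y := rfl

theorem ι_mul_self (x : V) :
    CliffordAlgebra.ι (LinearMap.BilinMap.toQuadraticMap D.η) x * CliffordAlgebra.ι _ x =
      algebraMap ℝ _ (D.η x x) := CliffordAlgebra.ι_sq_scalar _ x

theorem ι_mul_ι_swap {x y : V} (h : D.η x y = 0) :
    CliffordAlgebra.ι (LinearMap.BilinMap.toQuadraticMap D.η) x * CliffordAlgebra.ι _ y =
      -(CliffordAlgebra.ι _ y * CliffordAlgebra.ι _ x) := by
  rw [eq_neg_iff_add_eq_zero, CliffordAlgebra.ι_mul_ι_add_swap,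
    LinearMap.BilinMap.polar_toQuadraticMap, D.lorentzian.symm y x, h]
  simp

/-- The bivector is (xy − yx)/4, which collapses to xy/2 because orthogonal vectors anticommute. -/
theorem spinLift_rot {x y : V} (h : D.η x y = 0) :
    spinLift D.lorentzian.nondegenerate (D.rot x y : Module.End ℝ V) =
      (1 / 2 : ℝ) • D.evenι x y := by
  have hn := D.lorentzian.nondegenerate
  have hs := D.lorentzian.isSymm
  apply Subtype.ext
  rw [coe_spinLift, Subalgebra.coe_smul, coe_evenι]
  have e : ∀ i, (D.rot x y : Module.End ℝ V) (Module.finBasis ℝ V i) =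
    D.η (Module.finBasis ℝ V i) y • x - D.η (Module.finBasis ℝ V i) x • y := fun i => by
      rw [D.lorentzian.symm _ y, D.lorentzian.symm _ x]; rfl
  simp only [e, map_sub, map_smul, sub_mul, smul_mul_assoc, ← mul_smul_comm]
  rw [Finset.sum_sub_distrib, ← Finset.mul_sum, ← Finset.mul_sum]
  simp only [← map_smul]
  rw [← map_sum, ← map_sum, sum_smul_dual hn hs, sum_smul_dual hn hs,
    D.ι_mul_ι_swap (x := y) (y := x) (by rw [D.lorentzian.symm]; exact h)]
  rw [map_smul, mul_smul_comm]
  module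

theorem spin_rot {x y : V} (h : D.η x y = 0) (s : S) :
    D.spin (D.rot x y) s = (1 / 2 : ℝ) • D.ρ (D.evenι x y) s := by
  change D.ρ (spinLift D.lorentzian.nondegenerate (D.rot x y : Module.End ℝ V)) s = _
  rw [spinLift_rot D h, map_smul]
  rfl

/-- Since x and y anticommute, (xy)² = −x²y². In a Lorentzian plane this is positive, so the boost
has real eigenvalues on S. -/
theorem spin_rot_sq {x y : V} (h : D.η x y = 0) (s : S) :
    D.spin (D.rot x y) (D.spin (D.rot x y) s) = (-(1 / 4) * (D.η x x * D.η y y)) • s := by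
  have e : D.evenι x y * D.evenι x y = algebraMap ℝ _ (-(D.η x x * D.η y y)) := by
    apply Subtype.ext
    rw [MulMemClass.coe_mul, coe_evenι]
    change _ = algebraMap ℝ (CliffordAlgebra _) _
    calc _ = CliffordAlgebra.ι (LinearMap.BilinMap.toQuadraticMap D.η) x *
          (CliffordAlgebra.ι _ y * CliffordAlgebra.ι _ x) * CliffordAlgebra.ι _ y := by noncomm_ring
      _ = -((CliffordAlgebra.ι (LinearMap.BilinMap.toQuadraticMap D.η) x *
          CliffordAlgebra.ι _ x) * (CliffordAlgebra.ι _ y * CliffordAlgebra.ι _ y)) := by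
        rw [D.ι_mul_ι_swap (x := y) (y := x) (by rw [D.lorentzian.symm]; exact h)]
        noncomm_ring
      _ = _ := by rw [ι_mul_self, ι_mul_self, map_neg, map_mul]
  rw [spin_rot D h, spin_rot D h, map_smul, ← Module.End.mul_apply, ← map_mul, e,
    AlgHom.commutes, Module.algebraMap_end_apply]
  module

/-- For an orthogonal triple, the bivectors xy and yz share exactly one vector and so anticommute.
Each therefore maps an eigenspace of the other into the one with the opposite eigenvalue. -/
theorem spin_rot_anticomm {x y z : V} (hxy : D.η x y = 0) (hyz : D.η y z = 0) (hxz : D.η x z = 0)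
    (s : S) : D.spin (D.rot x y) (D.spin (D.rot y z) s) =
      -D.spin (D.rot y z) (D.spin (D.rot x y) s) := by
  have e : D.evenι x y * D.evenι y z = -(D.evenι y z * D.evenι x y) := by
    apply Subtype.ext
    simp only [MulMemClass.coe_mul, coe_evenι, NegMemClass.coe_neg]
    have h1 := D.ι_mul_ι_swap hxy
    have h2 := D.ι_mul_ι_swap hyz
    have h3 := D.ι_mul_ι_swap hxz
    set a := CliffordAlgebra.ι (LinearMap.BilinMap.toQuadraticMap D.η) x
    set b := CliffordAlgebra.ι (LinearMap.BilinMap.toQuadraticMap D.η) y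
    set c := CliffordAlgebra.ι (LinearMap.BilinMap.toQuadraticMap D.η) z
    calc a * b * (b * c) = -(b * a * (b * c)) := by rw [h1]; noncomm_ring
      _ = b * a * (c * b) := by rw [h2]; noncomm_ring
      _ = b * (a * c) * b := by noncomm_ring
      _ = -(b * c * (a * b)) := by rw [h3]; noncomm_ring
  rw [spin_rot D hxy, spin_rot D hyz, map_smul, ← Module.End.mul_apply, ← map_mul, e,
    spin_rot D hxy, map_smul, map_neg, map_mul, spin_rot D hyz]
  simp

/-- The square of an eigenspinor of an infinitesimal rotation. -/
theorem η_vec_κ_eigen (A : So D.η) {c : ℝ} {s : S} (h : D.spin A s = c • s) (v : V) :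
    D.η (D.vec A v) (D.κ s s) = -(2 * c) * D.η v (D.κ s s) := by
  rw [show D.η (D.vec A v) (D.κ s s) = -D.η v (D.vec A (D.κ s s)) from skew_apply A v _, vec_κ, h]
  simp only [map_smul, LinearMap.smul_apply, map_add, smul_eq_mul]
  ring

/-- For s ≠ 0 causality makes κ(s, s) nonzero and not spacelike, and such a vector is never
orthogonal to a timelike one. -/
theorem η_κ_eq_zero {v : V} (hv : D.η v v < 0) {s : S} (h : D.η v (D.κ s s) = 0) : s = 0 := by
  by_contra hs
  obtain ⟨h1, h2⟩ := D.κ_causal s hs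
  exact h1 (D.lorentzian.eq_zero_of_timelike hv h2 h)

/-- The eigenspace of an endomorphism, as a kernel. -/
abbrev eig (f : Module.End ℝ S) (c : ℝ) : Submodule ℝ S := LinearMap.ker (f - c • LinearMap.id)

theorem mem_eig {f : Module.End ℝ S} {c : ℝ} {s : S} : s ∈ eig f c ↔ f s = c • s := by
  rw [LinearMap.mem_ker, LinearMap.sub_apply, sub_eq_zero]; rfl

/-- From (f − c)(f + c) = 0 the range of f + c lies in the eigenspace of c; rank-nullity for f + c
gives the bound, with no need for c ≠ 0. -/
theorem finrank_le_eig {f : Module.End ℝ S} {c : ℝ} (h : ∀ s, f (f s) = (c ^ 2) • s) :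
    Module.finrank ℝ S ≤ Module.finrank ℝ (eig f c) + Module.finrank ℝ (eig f (-c)) := by
  rw [← LinearMap.finrank_range_add_finrank_ker (f - (-c) • LinearMap.id)]
  refine Nat.add_le_add_right (Submodule.finrank_mono ?_) _
  rintro _ ⟨s, rfl⟩
  rw [mem_eig]
  simp only [LinearMap.sub_apply, LinearMap.smul_apply, LinearMap.id_apply, map_sub, map_smul, h]
  module

/-- For every `v ≠ 0`, the quadratic form `s ↦ η(v, κ(s, s))` is anisotropic on some subspace of at
least half the dimension. -/
theorem exists_anisotropic {v : V} (hv : v ≠ 0) : ∃ N : Submodule ℝ S,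
    Module.finrank ℝ S ≤ 2 * Module.finrank ℝ N ∧
      ∀ s ∈ N, D.η v (D.κ s s) = 0 → s = 0 := by
  have hsymm := D.lorentzian.symm
  rcases lt_trichotomy (D.η v v) 0 with hneg | hnull | hpos
  · exact ⟨⊤, by rw [finrank_top]; omega, fun s _ h => D.η_κ_eq_zero hneg h⟩
  -- Null v: write v = a e + w with e timelike and w orthogonal to e. On the eigenspace of c for the
  -- boost in the plane of e and w one has η(w, κ(s, s)) = a η(e, κ(s, s)), so the form is 2a η(e,
  -- κ(s, s)) and is anisotropic. On the eigenspace of −c it vanishes identically, so the sign of c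
  -- matters.
  · obtain ⟨e, he, -⟩ := D.lorentzian.exists_timelike
    set a := D.η e v / D.η e e with ha
    have hae : a * D.η e e = D.η e v := div_mul_cancel₀ _ he.ne
    set w := v - a • e with hw
    have hew : D.η e w = 0 := by
      simp only [hw, map_sub, map_smul, smul_eq_mul, hae, sub_self]
    have hww : D.η w w = -(a ^ 2 * D.η e e) := by
      simp only [hw, map_sub, map_smul, LinearMap.sub_apply, LinearMap.smul_apply, smul_eq_mul,
        hsymm v e, hnull, ← hae]
      ring
    have ha0 : a ≠ 0 := by
      intro h0
      rw [h0, zero_smul, sub_zero] at hw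
      rw [hw] at hew
      exact hv (D.lorentzian.eq_zero_of_timelike he hnull.le hew)
    have hwpos : 0 < D.η w w := by
      rw [hww]; have := sq_pos_of_ne_zero ha0; nlinarith
    have hvew : v = a • e + w := by rw [hw]; abel
    -- Here dim V > 2 is essential: a third orthogonal direction provides an invertible operator
    -- anticommuting with the boost, so the eigenspace of c is at least as large as that of −c.
    obtain ⟨z, hz0, hez, hwz⟩ : ∃ z : V, z ≠ 0 ∧ D.η e z = 0 ∧ D.η w z = 0 := by
      have hlt : Module.finrank ℝ (Fin 2 → ℝ) < Module.finrank ℝ V := by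
        simpa using D.two_lt_dim
      have := LinearMap.ker_ne_bot_of_finrank_lt (f := LinearMap.pi ![D.η e, D.η w]) hlt
      obtain ⟨z, hz, hz0⟩ := Submodule.exists_mem_ne_zero_of_ne_bot this
      refine ⟨z, hz0, ?_, ?_⟩
      · simpa using congrFun hz 0
      · simpa using congrFun hz 1
    have hzpos := D.lorentzian.pos_of_orthogonal he hz0 hez
    set ε := D.η e e with hε
    set f := D.spin (D.rot e w) with hf
    set c := (1 / 2) * (a * ε) with hc
    have hc0 : c ≠ 0 := mul_ne_zero (by norm_num) (mul_ne_zero ha0 he.ne)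
    have hsq : ∀ s, f (f s) = (c ^ 2) • s := fun s => by
      rw [hf, spin_rot_sq D hew, hww]
      congr 1
      rw [← hε, hc]; ring
    set g := D.spin (D.rot w z) with hg
    have hanti : ∀ s, f (g s) = -g (f s) := fun s => spin_rot_anticomm D hew hwz hez s
    have hginj : Function.Injective g := by
      rw [← LinearMap.ker_eq_bot, LinearMap.ker_eq_bot']
      intro s hs
      have h1 := spin_rot_sq D hwz s
      rw [← hg, hs, map_zero] at h1
      refine (smul_eq_zero.1 h1.symm).resolve_left ?_
      have := mul_pos hwpos hzpos
      nlinarith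
    have hle : Module.finrank ℝ (eig f (-c)) ≤ Module.finrank ℝ (eig f c) := by
      have hmap : ∀ s ∈ eig f (-c), g s ∈ eig f c := fun s hs => by
        rw [mem_eig] at hs ⊢
        rw [hanti, hs, map_smul]; module
      exact LinearMap.finrank_le_finrank_of_injective (f := g.restrict hmap)
        fun x y hxy => Subtype.ext (hginj (congrArg Subtype.val hxy))
    refine ⟨eig f c, by have := finrank_le_eig hsq; omega, fun s hs h => ?_⟩
    rw [mem_eig] at hs
    have h1 := η_vec_κ_eigen D _ hs e
    rw [vec_rot, hsymm w e, hew, zero_smul, zero_sub, map_neg, LinearMap.neg_apply, map_smul,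
      LinearMap.smul_apply, smul_eq_mul] at h1
    rw [hvew, map_add, map_smul, LinearMap.add_apply, LinearMap.smul_apply, smul_eq_mul] at h
    refine D.η_κ_eq_zero he ?_
    have h2 : (2 * a * ε) * D.η e (D.κ s s) = 0 := by
      rw [← hε] at h1
      linear_combination h1 + ε * h - 2 * (D.η e (D.κ s s)) * hc
    exact (mul_eq_zero.1 h2).resolve_left (mul_ne_zero (mul_ne_zero two_ne_zero ha0) he.ne)
  -- Spacelike v: Gram–Schmidt, scaled by p = η(v, v) to avoid a division, gives a timelike e
  -- orthogonal to v. On either eigenspace of the boost in the plane of e and v, the vanishing of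
  -- η(v, κ(s, s)) forces that of η(e, κ(s, s)), so the larger eigenspace serves.
  · obtain ⟨e', he', -⟩ := D.lorentzian.exists_timelike
    set p := D.η v v with hp
    set e := p • e' - D.η e' v • v with hedef
    have hev : D.η e v = 0 := by
      simp only [hedef, map_sub, map_smul, LinearMap.sub_apply, LinearMap.smul_apply, smul_eq_mul,
        ← hp]
      ring
    have he : D.η e e < 0 := by
      have : D.η e e = p * (p * D.η e' e' - D.η e' v ^ 2) := by
        simp only [hedef, map_sub, map_smul, LinearMap.sub_apply, LinearMap.smul_apply,
          smul_eq_mul, ← hp, hsymm v e']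
        ring
      rw [this]
      refine mul_neg_of_pos_of_neg hpos ?_
      nlinarith [sq_nonneg (D.η e' v), mul_neg_of_pos_of_neg hpos he']
    set ε := D.η e e with hε
    set f := D.spin (D.rot e v) with hf
    set c := (1 / 2) * Real.sqrt (-(ε * p)) with hc
    have hεp : 0 < -(ε * p) := by nlinarith
    have hsq : ∀ s, f (f s) = (c ^ 2) • s := fun s => by
      rw [hf, spin_rot_sq D hev, ← hε, ← hp, hc, mul_pow, Real.sq_sqrt hεp.le]
      congr 1
      ring
    have key : ∀ (d : ℝ) (s : S), f s = d • s → D.η v (D.κ s s) = 0 → s = 0 := by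
      intro d s hs h
      have h1 := η_vec_κ_eigen D _ hs v
      rw [vec_rot, hev, zero_smul, sub_zero, map_smul, LinearMap.smul_apply, h, mul_zero,
        smul_eq_mul, ← hp] at h1
      exact D.η_κ_eq_zero he ((mul_eq_zero.1 h1).resolve_left hpos.ne')
    have hsum := finrank_le_eig hsq
    rcases le_total (Module.finrank ℝ (eig f c)) (Module.finrank ℝ (eig f (-c))) with hle | hle
    · exact ⟨eig f (-c), by omega, fun s hs => key _ s (mem_eig.1 hs)⟩
    · exact ⟨eig f c, by omega, fun s hs => key _ s (mem_eig.1 hs)⟩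

/-- Local homogeneity: if `dim S' > 1/2 dim S`, the squaring map of `S'` is onto `V`. -/
theorem span_κ_eq_top {S' : Submodule ℝ S} (h : Module.finrank ℝ S < 2 * Module.finrank ℝ S') :
    Submodule.span ℝ {v | ∃ s ∈ S', ∃ t ∈ S', v = D.κ s t} = ⊤ := by
  by_contra hne
  -- A proper span lies in the kernel of some η(v, ·) with v ≠ 0. The form η(v, κ(s, s)) then
  -- vanishes on S' and is anisotropic on a subspace of at least half the dimension. The two
  -- subspaces meet only in 0, which their dimensions exclude.
  obtain ⟨φ, hφ, hle⟩ := Submodule.exists_le_ker_of_lt_top _ (lt_top_iff_ne_top.2 hne)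
  obtain ⟨v, rfl⟩ := (LinearMap.BilinForm.toDual D.η D.lorentzian.nondegenerate).surjective φ
  have hv : v ≠ 0 := by rintro rfl; simp at hφ
  obtain ⟨N, hN, haniso⟩ := D.exists_anisotropic hv
  have hdisj : Disjoint S' N := by
    rw [Submodule.disjoint_def]
    intro s hs hsN
    refine haniso s hsN ?_
    exact hle (Submodule.subset_span ⟨s, hs, s, hs, rfl⟩)
  have := Submodule.finrank_add_finrank_le_of_disjoint hdisj
  omega

variable {D}

theorem eq_top_of_κ_mem {S' : Submodule ℝ S} (h : Module.finrank ℝ S < 2 * Module.finrank ℝ S')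
    {N : Submodule ℝ V} (hN : ∀ s ∈ S', ∀ t ∈ S', D.κ s t ∈ N) (v : V) : v ∈ N := by
  have : Submodule.span ℝ {v | ∃ s ∈ S', ∃ t ∈ S', v = D.κ s t} ≤ N := by
    rw [Submodule.span_le]
    rintro _ ⟨s, hs, t, ht, rfl⟩
    exact hN s hs t ht
  exact this (by rw [D.span_κ_eq_top h]; trivial)

/-- `so(V)` acts faithfully on `S'`. -/
theorem spin_faithful {S' : Submodule ℝ S} (h : Module.finrank ℝ S < 2 * Module.finrank ℝ S')
    {A B : So D.η} (hAB : ∀ s ∈ S', D.spin A s = D.spin B s) : A = B := by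
  refine so_ext fun v => ?_
  -- Equivariance of κ carries agreement on S' over to the squares, and these span V.
  refine eq_top_of_κ_mem (D := D) h (N := LinearMap.eqLocus (D.vec A) (D.vec B)) (fun s hs t ht => ?_) v
  rw [LinearMap.mem_eqLocus, vec_κ, vec_κ, hAB s hs, hAB t ht]

theorem exists_squaringSection {S' : Submodule ℝ S}
    (h : Module.finrank ℝ S < 2 * Module.finrank ℝ S') : Nonempty (D.SquaringSection S') := by
  have hsurj : LinearMap.range (tensorLift S' D.κ ∘ₗ (symSq S').subtype) = ⊤ := by
    rw [Submodule.eq_top_iff']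
    refine eq_top_of_κ_mem (D := D) h fun s hs t ht => ?_
    obtain ⟨ω, h1, h2, -⟩ := exists_symSq (zero_mem D.normCocycles)
      (square_mem (b := 0) hs ht)
    exact ⟨⟨ω, h1⟩, by simpa [square_apply] using h2⟩
  obtain ⟨f, hf⟩ := LinearMap.exists_rightInverse_of_surjective _ hsurj
  exact ⟨⟨f, fun v => LinearMap.congr_fun hf v⟩⟩

end PoincareData

/-! ### Lie superalgebras from their even and odd parts -/

/-- The restriction of a bilinear map to submodules of the domains and of the codomain. -/
def LinearMap.restrict₁₂ {A B C : Type*} [AddCommGroup A] [Module ℝ A] [AddCommGroup B] [Module ℝ B]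
    [AddCommGroup C] [Module ℝ C] (f : A →ₗ[ℝ] B →ₗ[ℝ] C) (P : Submodule ℝ A) (Q : Submodule ℝ B)
    (R : Submodule ℝ C) (h : ∀ x ∈ P, ∀ y ∈ Q, f x y ∈ R) : P →ₗ[ℝ] Q →ₗ[ℝ] R :=
  LinearMap.mk₂ ℝ (fun x y => ⟨f x y, h x x.2 y y.2⟩)
    (fun x x' y => Subtype.ext (by simp)) (fun c x y => Subtype.ext (by simp))
    (fun x y y' => Subtype.ext (by simp)) (fun c x y => Subtype.ext (by simp))

section Build

variable {E N : Type*} [AddCommGroup E] [Module ℝ E] [AddCommGroup N] [Module ℝ N]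

/-- The bracket on `E ⊕ N` determined by its components `E × E → E`, `E × N → N` and
`N × N → E`. -/
def superBracket (f : E →ₗ[ℝ] E →ₗ[ℝ] E) (a : E →ₗ[ℝ] N →ₗ[ℝ] N) (q : N →ₗ[ℝ] N →ₗ[ℝ] E) :
    (E × N) →ₗ[ℝ] (E × N) →ₗ[ℝ] (E × N) :=
  LinearMap.mk₂ ℝ (fun x y => (f x.1 y.1 + q x.2 y.2, a x.1 y.2 - a y.1 x.2))
    (fun x x' y => by
      refine Prod.ext ?_ ?_
      · simp only [Prod.fst_add, Prod.snd_add, map_add, LinearMap.add_apply]; abel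
      · simp only [Prod.fst_add, Prod.snd_add, map_add, LinearMap.add_apply]; abel)
    (fun c x y => by
      refine Prod.ext ?_ ?_
      · simp only [Prod.smul_fst, Prod.smul_snd, map_smul, LinearMap.smul_apply]; module
      · simp only [Prod.smul_fst, Prod.smul_snd, map_smul, LinearMap.smul_apply]; module)
    (fun x y y' => by
      refine Prod.ext ?_ ?_
      · simp only [Prod.fst_add, Prod.snd_add, map_add]; abel
      · simp only [Prod.fst_add, Prod.snd_add, map_add, LinearMap.add_apply]; abel)
    (fun c x y => by
      refine Prod.ext ?_ ?_
      · simp only [Prod.smul_fst, Prod.smul_snd, map_smul]; module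
      · simp only [Prod.smul_fst, Prod.smul_snd, map_smul, LinearMap.smul_apply]; module)

theorem superBracket_apply (f : E →ₗ[ℝ] E →ₗ[ℝ] E) (a : E →ₗ[ℝ] N →ₗ[ℝ] N)
    (q : N →ₗ[ℝ] N →ₗ[ℝ] E) (x y : E × N) :
    superBracket f a q x y = (f x.1 y.1 + q x.2 y.2, a x.1 y.2 - a y.1 x.2) := rfl

/-- The parity of `E ⊕ N`, with `E` even and `N` odd. -/
def prodParity (E N : Type*) [AddCommGroup E] [Module ℝ E] [AddCommGroup N] [Module ℝ N]
    (i : ZMod 2) : Submodule ℝ (E × N) where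
  carrier := {x | (i = 0 → x.2 = 0) ∧ (i = 1 → x.1 = 0)}
  zero_mem' := by simp
  add_mem' := fun {x y} h k => ⟨fun hi => by simp [h.1 hi, k.1 hi],
    fun hi => by simp [h.2 hi, k.2 hi]⟩
  smul_mem' := fun c x h => ⟨fun hi => by simp [h.1 hi], fun hi => by simp [h.2 hi]⟩

theorem mem_prodParity_zero {x : E × N} : x ∈ prodParity E N 0 ↔ x.2 = 0 :=
  ⟨fun h => h.1 rfl, fun h => ⟨fun _ => h, fun h' => absurd h' (by decide)⟩⟩

theorem mem_prodParity_one {x : E × N} : x ∈ prodParity E N 1 ↔ x.1 = 0 :=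
  ⟨fun h => h.2 rfl, fun h => ⟨fun h' => absurd h' (by decide), fun _ => h⟩⟩

/-- The Lie superalgebra with even part `E` and odd part `N` determined by the components of the
bracket. -/
def LieSuperalgebra.ofParts (f : E →ₗ[ℝ] E →ₗ[ℝ] E) (a : E →ₗ[ℝ] N →ₗ[ℝ] N)
    (q : N →ₗ[ℝ] N →ₗ[ℝ] E) (skew : ∀ x y, f x y = -f y x) (symm : ∀ s t, q s t = q t s)
    (jac₀ : ∀ x y z, f x (f y z) = f (f x y) z + f y (f x z))
    (jac₁ : ∀ x y s, a x (a y s) = a (f x y) s + a y (a x s))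
    (jac₂ : ∀ x s t, f x (q s t) = q (a x s) t + q s (a x t))
    (jac₃ : ∀ s t u, a (q s t) u + a (q t u) s + a (q u s) t = 0) :
    LieSuperalgebra (E × N) where
  parity := prodParity E N
  isCompl_parity := by
    rw [isCompl_iff, Submodule.disjoint_def, codisjoint_iff, Submodule.eq_top_iff']
    refine ⟨fun x h0 h1 => Prod.ext (h1.2 rfl) (h0.1 rfl), fun x => ?_⟩
    rw [Submodule.mem_sup]
    exact ⟨(x.1, 0), mem_prodParity_zero.2 rfl, (0, x.2), mem_prodParity_one.2 rfl, by simp⟩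
  bracket := superBracket f a q
  bracket_mem := by
    intro i j x y hx hy
    have h2 : ∀ i : ZMod 2, i = 0 ∨ i = 1 := by decide
    rcases h2 i with rfl | rfl <;> rcases h2 j with rfl | rfl
    · rw [add_zero]
      rw [mem_prodParity_zero] at *
      simp [superBracket_apply, hx, hy]
    · rw [zero_add]
      rw [mem_prodParity_one] at *
      rw [mem_prodParity_zero] at hx
      simp [superBracket_apply, hx, hy]
    · rw [add_zero]
      rw [mem_prodParity_one] at *
      rw [mem_prodParity_zero] at hy
      simp [superBracket_apply, hx, hy]
    · rw [mem_prodParity_one] at *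
      rw [show (1 : ZMod 2) + 1 = 0 by decide, mem_prodParity_zero]
      simp [superBracket_apply, hx, hy]
  bracket_skew := by
    intro i j x y hx hy
    have h2 : ∀ i : ZMod 2, i = 0 ∨ i = 1 := by decide
    have h01 : ¬ ((0 : ZMod 2) = 1) := by decide
    rcases h2 i with rfl | rfl <;> rcases h2 j with rfl | rfl
    all_goals
      simp only [mem_prodParity_zero, mem_prodParity_one] at hx hy
      simp [superBracket_apply, koszulSign, hx, hy, h01]
    · exact skew _ _
    · exact symm _ _
  bracket_jacobi := by
    intro i j x y z hx hy
    have h2 : ∀ i : ZMod 2, i = 0 ∨ i = 1 := by decide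
    have h01 : ¬ ((0 : ZMod 2) = 1) := by decide
    rcases h2 i with rfl | rfl <;> rcases h2 j with rfl | rfl
    all_goals
      simp only [mem_prodParity_zero, mem_prodParity_one] at hx hy
      simp only [superBracket_apply, koszulSign, hx, hy, h01, and_self, and_true, and_false,
        if_true, if_false, map_zero, LinearMap.zero_apply, zero_add, add_zero, zero_sub, sub_zero,
        map_neg, LinearMap.neg_apply, one_smul, neg_smul, neg_zero,
        Prod.mk_add_mk, Prod.neg_mk, neg_neg]
      refine Prod.ext ?_ ?_
    · exact jac₀ _ _ _
    · exact jac₁ _ _ _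
    · exact jac₂ _ _ _
    -- The remaining cases are `jac₁` and `jac₂` with their arguments reordered by skew-symmetry
    -- and, for three odd elements, `jac₃`.
    · change -a x.1 (a z.1 y.2) = -a z.1 (a x.1 y.2) + -a (f x.1 z.1) y.2
      rw [jac₁ x.1 z.1]; abel
    · change q x.2 (a y.1 z.2) = -q (a y.1 x.2) z.2 + f y.1 (q x.2 z.2)
      rw [jac₂]; abel
    · change -a (f y.1 z.1) x.2 = a z.1 (a y.1 x.2) + -a y.1 (a z.1 x.2)
      rw [jac₁ y.1 z.1]; abel
    · change -q x.2 (a z.1 y.2) = f (q x.2 y.2) z.1 + q y.2 (a z.1 x.2)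
      rw [skew, jac₂, symm y.2]; abel
    · change -a (q y.2 z.2) x.2 = a (q x.2 y.2) z.2 + a (q x.2 z.2) y.2
      rw [symm x.2 z.2, ← sub_eq_zero, ← neg_eq_zero, ← jac₃ x.2 y.2 z.2]; abel

end Build

namespace PoincareData

universe u v

variable {V : Type u} {S : Type v} [AddCommGroup V] [Module ℝ V] [FiniteDimensional ℝ V]
  [AddCommGroup S] [Module ℝ S] [FiniteDimensional ℝ S] {D : PoincareData V S}

/-! ### The filtration of `V ⊕ S ⊕ so(V)` -/

variable (D) in
/-- The filtration of `V ⊕ S ⊕ so(V)` associated with the grading. -/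
def totalFil (k : ℤ) : Submodule ℝ D.Total where
  carrier := {x | (-2 < k → x.1 = 0) ∧ (-1 < k → x.2.1 = 0) ∧ (0 < k → x.2.2 = 0)}
  zero_mem' := by simp
  add_mem' := by
    rintro x y ⟨h1, h2, h3⟩ ⟨h4, h5, h6⟩
    exact ⟨fun h => by simp [h1 h, h4 h], fun h => by simp [h2 h, h5 h],
      fun h => by simp [h3 h, h6 h]⟩
  smul_mem' := by
    rintro c x ⟨h1, h2, h3⟩
    exact ⟨fun h => by simp [h1 h], fun h => by simp [h2 h], fun h => by simp [h3 h]⟩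

theorem mem_totalFil {k : ℤ} {x : D.Total} : x ∈ D.totalFil k ↔
    (-2 < k → x.1 = 0) ∧ (-1 < k → x.2.1 = 0) ∧ (0 < k → x.2.2 = 0) := Iff.rfl

theorem totalFil_antitone : Antitone D.totalFil := fun _ _ h _ hx =>
  ⟨fun h' => hx.1 (by omega), fun h' => hx.2.1 (by omega), fun h' => hx.2.2 (by omega)⟩

theorem mem_totalFil_of_le {k : ℤ} (hk : k ≤ -2) (x : D.Total) : x ∈ D.totalFil k :=
  ⟨fun h => by omega, fun h => by omega, fun h => by omega⟩

theorem eq_zero_of_mem_totalFil {k : ℤ} (hk : 0 < k) {x : D.Total} (h : x ∈ D.totalFil k) :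
    x = 0 := Prod.ext (h.1 (by omega)) (Prod.ext (h.2.1 (by omega)) (h.2.2 hk))

variable (D) in
/-- The projection to the graded component of degree `k`. -/
def totalSymb (k : ℤ) : D.Total →ₗ[ℝ] D.Total where
  toFun x := (if k = -2 then x.1 else 0, if k = -1 then x.2.1 else 0, if k = 0 then x.2.2 else 0)
  map_add' x y := by
    refine Prod.ext ?_ (Prod.ext ?_ ?_)
    all_goals dsimp only [Prod.fst_add, Prod.snd_add]; split_ifs <;> simp
  map_smul' c x := by
    refine Prod.ext ?_ (Prod.ext ?_ ?_)
    all_goals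
      dsimp only [Prod.smul_fst, Prod.smul_snd, RingHom.id_apply]; split_ifs <;> simp

theorem totalSymb_apply (k : ℤ) (x : D.Total) : D.totalSymb k x =
    (if k = -2 then x.1 else 0, if k = -1 then x.2.1 else 0, if k = 0 then x.2.2 else 0) := rfl

theorem totalSymb_mem (k : ℤ) (x : D.Total) : D.totalSymb k x ∈ D.grade k :=
  ⟨fun h => if_neg h, fun h => if_neg h, fun h => if_neg h⟩

theorem totalSymb_eq_zero_iff {k : ℤ} {x : D.Total} (hx : x ∈ D.totalFil k) :
    D.totalSymb k x = 0 ↔ x ∈ D.totalFil (k + 1) := by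
  rw [mem_totalFil] at *
  rw [totalSymb_apply, Prod.mk_eq_zero, Prod.mk_eq_zero]
  obtain ⟨h1, h2, h3⟩ := hx
  constructor
  · rintro ⟨e1, e2, e3⟩
    refine ⟨fun h => ?_, fun h => ?_, fun h => ?_⟩
    · by_cases hk : k = -2
      · rwa [if_pos hk] at e1
      · exact h1 (by omega)
    · by_cases hk : k = -1
      · rwa [if_pos hk] at e2
      · exact h2 (by omega)
    · by_cases hk : k = 0
      · rwa [if_pos hk] at e3
      · exact h3 (by omega)
  · rintro ⟨e1, e2, e3⟩
    refine ⟨?_, ?_, ?_⟩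
    · split_ifs with h
      exacts [e1 (by omega), rfl]
    · split_ifs with h
      exacts [e2 (by omega), rfl]
    · split_ifs with h
      exacts [e3 (by omega), rfl]

variable (D) in
/-- The bracket of `V ⊕ S ⊕ so(V)` which deforms the Poincaré superalgebra by `β`, `γ` and `θ`. -/
def flatBracket (b : D.BetaGamma) (θ : V →ₗ[ℝ] V →ₗ[ℝ] So D.η) (x y : D.Total) : D.Total :=
  (D.vec x.2.2 y.1 - D.vec y.2.2 x.1 + D.κ x.2.1 y.2.1,
    (b.1 x.1 y.2.1 + D.spin x.2.2 y.2.1) - (b.1 y.1 x.2.1 + D.spin y.2.2 x.2.1),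
    ⁅x.2.2, y.2.2⁆ + θ x.1 y.1 + b.2 x.2.1 y.2.1)

theorem flatBracket_mem_fil (b : D.BetaGamma) (θ : V →ₗ[ℝ] V →ₗ[ℝ] So D.η) {k l : ℤ}
    {x y : D.Total} (hx : x ∈ D.totalFil k) (hy : y ∈ D.totalFil l) :
    D.flatBracket b θ x y ∈ D.totalFil (k + l) := by
  obtain ⟨v, s, A⟩ := x
  obtain ⟨w, t, B⟩ := y
  simp only [mem_totalFil] at *
  obtain ⟨h1, h2, h3⟩ := hx
  obtain ⟨k1, k2, k3⟩ := hy
  have hv : -2 < k ∨ k ≤ -2 := by omega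
  have hs : -1 < k ∨ k ≤ -1 := by omega
  have hA : 0 < k ∨ k ≤ 0 := by omega
  have hw : -2 < l ∨ l ≤ -2 := by omega
  have ht : -1 < l ∨ l ≤ -1 := by omega
  have hB : 0 < l ∨ l ≤ 0 := by omega
  have z1 : -2 < k + l → D.vec A w = 0 := fun h => by
    rcases hA with hA | hA
    · simp [h3 hA]
    · simp [k1 (by omega)]
  have z2 : -2 < k + l → D.vec B v = 0 := fun h => by
    rcases hB with hA | hA
    · simp [k3 hA]
    · simp [h1 (by omega)]
  have z3 : -2 < k + l → D.κ s t = 0 := fun h => by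
    rcases hs with hA | hA
    · simp [h2 hA]
    · simp [k2 (by omega)]
  have z4 : -1 < k + l → b.1 v t + D.spin A t = 0 := fun h => by
    rcases ht with hA | hA
    · simp [k2 hA]
    · simp [h1 (by omega), h3 (by omega)]
  have z5 : -1 < k + l → b.1 w s + D.spin B s = 0 := fun h => by
    rcases hs with hA | hA
    · simp [h2 hA]
    · simp [k1 (by omega), k3 (by omega)]
  have z6 : 0 < k + l → ⁅A, B⁆ = 0 := fun h => by
    rcases hA with hA | hA
    · simp [h3 hA]
    · simp [k3 (by omega)]
  have z7 : 0 < k + l → θ v w = 0 := fun h => by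
    rcases hv with hA | hA
    · simp [h1 hA]
    · simp [k1 (by omega)]
  have z8 : 0 < k + l → b.2 s t = 0 := fun h => by
    rcases hs with hA | hA
    · simp [h2 hA]
    · simp [k2 (by omega)]
  refine ⟨fun h => ?_, fun h => ?_, fun h => ?_⟩
  · simp [flatBracket, z1 h, z2 h, z3 h]
  · simp only [flatBracket, z4 h, z5 h, sub_zero]
  · simp [flatBracket, z6 h, z7 h, z8 h]

/-- The maps β and γ raise the degree by 2 and θ raises it by 4, so only the Poincaré bracket
survives in the associated graded. If an argument lies one step deeper in the filtration, both sides
vanish; otherwise both degrees are −2, −1 or 0 and nine cases remain. -/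
theorem totalSymb_flatBracket (b : D.BetaGamma) (θ : V →ₗ[ℝ] V →ₗ[ℝ] So D.η) {k l : ℤ}
    {x y : D.Total} (hx : x ∈ D.totalFil k) (hy : y ∈ D.totalFil l) :
    D.totalSymb (k + l) (D.flatBracket b θ x y) = D.bracket (D.totalSymb k x) (D.totalSymb l y) := by
  by_cases hx' : x ∈ D.totalFil (k + 1)
  · rw [(totalSymb_eq_zero_iff hx).2 hx', map_zero, LinearMap.zero_apply,
      totalSymb_eq_zero_iff (flatBracket_mem_fil b θ hx hy), add_right_comm]
    exact flatBracket_mem_fil b θ hx' hy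
  by_cases hy' : y ∈ D.totalFil (l + 1)
  · rw [(totalSymb_eq_zero_iff hy).2 hy', map_zero,
      totalSymb_eq_zero_iff (flatBracket_mem_fil b θ hx hy), add_assoc]
    exact flatBracket_mem_fil b θ hx hy'
  have bound : ∀ {k : ℤ} {x : D.Total}, x ∈ D.totalFil k → x ∉ D.totalFil (k + 1) →
      k = -2 ∨ k = -1 ∨ k = 0 := fun {k x} h h' => by
    have h1 : ¬ k + 1 ≤ -2 := fun hk => h' (mem_totalFil_of_le hk x)
    have h2 : ¬ 0 < k := fun hk => h' (by rw [eq_zero_of_mem_totalFil hk h]; exact zero_mem _)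
    omega
  obtain ⟨v, s, A⟩ := x
  obtain ⟨w, t, B⟩ := y
  simp only [mem_totalFil] at hx hy
  rcases bound hx hx' with rfl | rfl | rfl <;> rcases bound hy hy' with rfl | rfl | rfl <;>
    norm_num at hx hy <;> simp [totalSymb_apply, bracket_apply, flatBracket, hx, hy]

/-! ### Flat models -/

variable (D) in
/-- The inclusion of `V ⊕ so(V)` and `S` into `V ⊕ S ⊕ so(V)`. -/
def toTotal (E : Submodule ℝ (V × So D.η)) (N : Submodule ℝ S) : (E × N) →ₗ[ℝ] D.Total where
  toFun x := (x.1.1.1, x.2, x.1.1.2)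
  map_add' _ _ := rfl
  map_smul' _ _ := rfl

theorem toTotal_apply {E : Submodule ℝ (V × So D.η)} {N : Submodule ℝ S} (x : E × N) :
    D.toTotal E N x = (x.1.1.1, (x.2 : S), x.1.1.2) := rfl

/-- An identification of a subdeformation with `E ⊕ S'`, where `E` is a subspace of `V ⊕ so(V)`,
for which the bracket of the subdeformation is the one determined by `β`, `γ` and `θ`. -/
structure FlatModel (F : D.Subdeformation) (b : D.BetaGamma) (θ : V →ₗ[ℝ] V →ₗ[ℝ] So D.η)
    (E : Submodule ℝ (V × So D.η)) (N : Submodule ℝ S) where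
  equiv : F.carrier ≃ₗ[ℝ] (E × N)
  mem_even : ∀ x, x ∈ F.alg.parity 0 ↔ (equiv x).2 = 0
  mem_odd : ∀ x, x ∈ F.alg.parity 1 ↔ (equiv x).1 = 0
  mem_fil : ∀ k x, x ∈ F.alg.fil k ↔ D.toTotal E N (equiv x) ∈ D.totalFil k
  symb_eq : ∀ k (x : F.alg.fil k), F.symb k x = D.totalSymb k (D.toTotal E N (equiv x))
  bracket_fst : ∀ x y, ((equiv (F.alg.bracket x y)).1 : V × So D.η) =
    D.evenBracket θ (equiv x).1 (equiv y).1 + D.square b (equiv x).2 (equiv y).2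
  bracket_snd : ∀ x y, ((equiv (F.alg.bracket x y)).2 : S) =
    D.evenAct b (equiv x).1 (equiv y).2 - D.evenAct b (equiv y).1 (equiv x).2

/-- The conditions under which `β`, `γ` and `θ` determine a Lie superalgebra `E ⊕ S'`. -/
structure IsFlat (b : D.BetaGamma) (θ : V →ₗ[ℝ] V →ₗ[ℝ] So D.η)
    (E : Submodule ℝ (V × So D.η)) (N : Submodule ℝ S) : Prop where
  bracket_mem : ∀ x ∈ E, ∀ y ∈ E, D.evenBracket θ x y ∈ E
  act_mem : ∀ x ∈ E, ∀ s ∈ N, D.evenAct b x s ∈ N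
  square_mem : ∀ s ∈ N, ∀ t ∈ N, D.square b s t ∈ E
  jac₀ : ∀ x ∈ E, ∀ y ∈ E, ∀ z ∈ E, D.evenBracket θ x (D.evenBracket θ y z) =
    D.evenBracket θ (D.evenBracket θ x y) z + D.evenBracket θ y (D.evenBracket θ x z)
  jac₁ : ∀ x ∈ E, ∀ y ∈ E, ∀ s ∈ N, D.evenAct b x (D.evenAct b y s) =
    D.evenAct b (D.evenBracket θ x y) s + D.evenAct b y (D.evenAct b x s)
  jac₂ : ∀ x ∈ E, ∀ s ∈ N, ∀ t ∈ N, D.evenBracket θ x (D.square b s t) =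
    D.square b (D.evenAct b x s) t + D.square b s (D.evenAct b x t)

section IsFlat

variable {b : D.BetaGamma} {θ : V →ₗ[ℝ] V →ₗ[ℝ] So D.η} {E : Submodule ℝ (V × So D.η)}
  {N : Submodule ℝ S}

/-- The Lie superalgebra `E ⊕ S'`. -/
def IsFlat.superalgebra (H : IsFlat b θ E N) (hb : b ∈ D.normCocycles) (hθ : ∀ v, θ v v = 0) :
    LieSuperalgebra (E × N) :=
  LieSuperalgebra.ofParts
    ((D.evenBracket θ).restrict₁₂ E E E H.bracket_mem)
    ((D.evenAct b).restrict₁₂ E N N H.act_mem)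
    ((D.square b).restrict₁₂ N N E H.square_mem)
    (fun x y => Subtype.ext (evenBracket_skew hθ x y))
    (fun s t => Subtype.ext (square_symm hb s t))
    (fun x y z => Subtype.ext (H.jac₀ x x.2 y y.2 z z.2))
    (fun x y s => Subtype.ext (H.jac₁ x x.2 y y.2 s s.2))
    (fun x s t => Subtype.ext (H.jac₂ x x.2 s s.2 t t.2))
    (fun s t u => Subtype.ext (by
      refine Eq.trans ?_ (cocycle_cyclic hb s t u)
      change D.evenAct b (D.square b s t) u + D.evenAct b (D.square b t u) s +
        D.evenAct b (D.square b u s) t = _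
      simp only [square_apply, evenAct_apply]))

theorem IsFlat.toTotal_bracket (H : IsFlat b θ E N) (hb : b ∈ D.normCocycles)
    (hθ : ∀ v, θ v v = 0) (x y : E × N) :
    D.toTotal E N ((H.superalgebra hb hθ).bracket x y) =
      D.flatBracket b θ (D.toTotal E N x) (D.toTotal E N y) := by
  have h : (((H.superalgebra hb hθ).bracket x y).1 : V × So D.η) =
    D.evenBracket θ x.1 y.1 + D.square b x.2 y.2 := rfl
  have h' : (((H.superalgebra hb hθ).bracket x y).2 : S) =
    D.evenAct b x.1 y.2 - D.evenAct b y.1 x.2 := rfl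
  rw [toTotal_apply, h, h', square_apply]
  rfl

/-- The filtered Lie superalgebra `E ⊕ S'`. -/
def IsFlat.filtered (H : IsFlat b θ E N) (hb : b ∈ D.normCocycles) (hθ : ∀ v, θ v v = 0) :
    FilteredLieSuperalgebra (E × N) where
  toLieSuperalgebra := H.superalgebra hb hθ
  fil k := (D.totalFil k).comap (D.toTotal E N)
  fil_antitone := fun _ _ h _ hx => totalFil_antitone h hx
  fil_exhaustive := ⟨-2, Submodule.eq_top_iff'.2 fun _ => mem_totalFil_of_le le_rfl _⟩
  fil_separated := ⟨1, by
    rw [eq_bot_iff]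
    intro x hx
    have h := eq_zero_of_mem_totalFil one_pos (Submodule.mem_comap.1 hx)
    rw [toTotal_apply, Prod.mk_eq_zero, Prod.mk_eq_zero] at h
    exact Prod.ext (Subtype.ext (Prod.ext h.1 h.2.2)) (Subtype.ext h.2.1)⟩
  fil_parity := fun k => by
    refine le_antisymm (fun x hx => ?_) (sup_le inf_le_left inf_le_left)
    obtain ⟨h1, h2, h3⟩ := hx
    rw [Submodule.mem_sup]
    exact ⟨(x.1, 0), ⟨⟨h1, fun _ => rfl, h3⟩, mem_prodParity_zero.2 rfl⟩, (0, x.2),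
      ⟨⟨fun _ => rfl, h2, fun _ => rfl⟩, mem_prodParity_one.2 rfl⟩, by simp⟩
  fil_even := fun k => by
    ext x
    refine and_congr_left fun hx => ?_
    have hx : x.2 = 0 := mem_prodParity_zero.1 hx
    simp only [SetLike.mem_coe, Submodule.mem_comap, mem_totalFil,
      toTotal_apply, hx, ZeroMemClass.coe_zero, implies_true, true_and]
    -- The even components sit in the even degrees −2 and 0, which do not separate 2k − 1 from 2k.
    have e1 : -2 < 2 * k - 1 ↔ -2 < 2 * k := by omega
    have e2 : 0 < 2 * k - 1 ↔ 0 < 2 * k := by omega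
    rw [e1, e2]
  fil_odd := fun k => by
    ext x
    refine and_congr_left fun hx => ?_
    have hx : x.1 = 0 := mem_prodParity_one.1 hx
    simp only [SetLike.mem_coe, Submodule.mem_comap, mem_totalFil,
      toTotal_apply, hx, ZeroMemClass.coe_zero, Prod.fst_zero, Prod.snd_zero, implies_true,
      true_and, and_true]
    have e1 : -1 < 2 * k ↔ -1 < 2 * k + 1 := by omega
    rw [e1]
  bracket_fil := fun {k l x y} hx hy => by
    rw [Submodule.mem_comap, H.toTotal_bracket]
    exact flatBracket_mem_fil b θ hx hy

/-- The filtered subdeformation `E ⊕ S'`. -/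
def IsFlat.subdeformation (H : IsFlat b θ E N) (hb : b ∈ D.normCocycles)
    (hθ : ∀ v, θ v v = 0) : D.Subdeformation where
  carrier := E × N
  alg := H.filtered hb hθ
  symb k := D.totalSymb k ∘ₗ D.toTotal E N ∘ₗ Submodule.subtype _
  symb_mem _ _ := totalSymb_mem _ _
  symb_eq_zero_iff _ x := totalSymb_eq_zero_iff x.2
  symb_bracket k l x y := by
    change D.totalSymb (k + l) (D.toTotal E N ((H.superalgebra hb hθ).bracket x y)) = _
    rw [H.toTotal_bracket]
    exact totalSymb_flatBracket b θ x.2 y.2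

/-- The tautological model of `E ⊕ S'`. -/
def IsFlat.model (H : IsFlat b θ E N) (hb : b ∈ D.normCocycles) (hθ : ∀ v, θ v v = 0) :
    FlatModel (H.subdeformation hb hθ) b θ E N where
  equiv := .refl ℝ _
  mem_even _ := mem_prodParity_zero
  mem_odd _ := mem_prodParity_one
  mem_fil _ _ := Iff.rfl
  symb_eq _ _ := rfl
  bracket_fst _ _ := rfl
  bracket_snd _ _ := rfl

end IsFlat

end PoincareData

namespace PoincareData

universe u v

variable {V : Type u} {S : Type v} [AddCommGroup V] [Module ℝ V] [FiniteDimensional ℝ V]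
  [AddCommGroup S] [Module ℝ S] [FiniteDimensional ℝ S] {D : PoincareData V S}

/-! ### Flatness of integrable Lie pairs -/

/-- The Jacobi identity of three even elements follows from the other ones. -/
theorem IsFlat.of_jac {b : D.BetaGamma} {θ : V →ₗ[ℝ] V →ₗ[ℝ] So D.η} {N : Submodule ℝ S}
    {h : Submodule ℝ (So D.η)} (hθ : ∀ v, θ v v = 0) (hlie : ∀ A ∈ h, ∀ B ∈ h, ⁅A, B⁆ ∈ h)
    (act_mem : ∀ x ∈ D.evenSub N b h, ∀ s ∈ N, D.evenAct b x s ∈ N)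
    (jac₁ : ∀ x ∈ D.evenSub N b h, ∀ y ∈ D.evenSub N b h, ∀ s ∈ N,
      D.evenAct b x (D.evenAct b y s) =
        D.evenAct b (D.evenBracket θ x y) s + D.evenAct b y (D.evenAct b x s))
    (jac₂ : ∀ x ∈ D.evenSub N b h, ∀ s ∈ N, ∀ t ∈ N, D.evenBracket θ x (D.square b s t) =
      D.square b (D.evenAct b x s) t + D.square b s (D.evenAct b x t)) :
    IsFlat b θ (D.evenSub N b h) N := by
  have skew := evenBracket_skew hθ
  have square_mem' : ∀ s ∈ N, ∀ t ∈ N, D.square b s t ∈ D.evenSub N b h :=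
    fun s hs t ht => squareSpan_le_evenSub (PoincareData.square_mem hs ht)
  have hAB : ∀ A B : So D.η, D.evenBracket θ (0, A) (0, B) = (0, ⁅A, B⁆) := fun A B => by
    simp [evenBracket_apply]
  have mem_square : ∀ x ∈ D.evenSub N b h, ∀ s ∈ N, ∀ t ∈ N,
      D.evenBracket θ x (D.square b s t) ∈ D.evenSub N b h := fun x hx s hs t ht => by
    rw [jac₂ x hx s hs t ht]
    exact add_mem (square_mem' _ (act_mem x hx s hs) _ ht) (square_mem' _ hs _ (act_mem x hx t ht))
  have bracket_mem : ∀ x ∈ D.evenSub N b h, ∀ y ∈ D.evenSub N b h,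
      D.evenBracket θ x y ∈ D.evenSub N b h := by
    intro x hx y hy
    refine evenSub_induction (N := (D.evenSub N b h).comap (D.evenBracket θ x))
      (mem_square x hx) (fun B hB => ?_) hy
    rw [Submodule.mem_comap, skew]
    refine neg_mem (evenSub_induction (N := (D.evenSub N b h).comap (D.evenBracket θ (0, B)))
      (mem_square _ (inr_mem_evenSub hB)) (fun A hA => ?_) hx)
    rw [Submodule.mem_comap, hAB]
    exact inr_mem_evenSub (hlie B hB A hA)
  refine ⟨bracket_mem, act_mem, square_mem', ?_, jac₁, jac₂⟩
  -- When the third element is a square, both sides expand by `jac₂` and then reduce to `jac₁` on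
  -- the two odd factors.
  have j1 : ∀ x ∈ D.evenSub N b h, ∀ y ∈ D.evenSub N b h, ∀ s ∈ N, ∀ t ∈ N,
      D.evenBracket θ x (D.evenBracket θ y (D.square b s t)) =
        D.evenBracket θ (D.evenBracket θ x y) (D.square b s t) +
          D.evenBracket θ y (D.evenBracket θ x (D.square b s t)) := by
    intro x hx y hy s hs t ht
    have xs := act_mem x hx s hs
    have xt := act_mem x hx t ht
    have ys := act_mem y hy s hs
    have yt := act_mem y hy t ht
    rw [jac₂ y hy s hs t ht, jac₂ x hx s hs t ht, map_add, map_add, jac₂ x hx _ ys t ht,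
      jac₂ x hx s hs _ yt, jac₂ y hy _ xs t ht, jac₂ y hy s hs _ xt,
      jac₂ _ (bracket_mem x hx y hy) s hs t ht, jac₁ x hx y hy s hs, jac₁ x hx y hy t ht]
    simp only [map_add, LinearMap.add_apply]
    abel
  -- Elements of h need not be combinations of squares. As the identity is invariant under
  -- permutations, each argument can be moved to the last place and reduced to squares or h; with
  -- all three in h it is the Jacobi identity of so(V).
  have swap : ∀ x y z, D.evenBracket θ x (D.evenBracket θ z y) =
        D.evenBracket θ (D.evenBracket θ x z) y + D.evenBracket θ z (D.evenBracket θ x y) →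
      D.evenBracket θ x (D.evenBracket θ y z) =
        D.evenBracket θ (D.evenBracket θ x y) z + D.evenBracket θ y (D.evenBracket θ x z) := by
    intro x y z e
    rw [skew y z, map_neg, e, skew (D.evenBracket θ x z) y, skew z (D.evenBracket θ x y)]
    abel
  have swap' : ∀ x y z, D.evenBracket θ y (D.evenBracket θ x z) =
        D.evenBracket θ (D.evenBracket θ y x) z + D.evenBracket θ x (D.evenBracket θ y z) →
      D.evenBracket θ x (D.evenBracket θ y z) =
        D.evenBracket θ (D.evenBracket θ x y) z + D.evenBracket θ y (D.evenBracket θ x z) := by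
    intro x y z e
    rw [e, skew x y, map_neg, LinearMap.neg_apply]
    abel
  have j2 : ∀ x ∈ D.evenSub N b h, ∀ A ∈ h, ∀ z ∈ D.evenSub N b h,
      (∀ C ∈ h, D.evenBracket θ x (D.evenBracket θ (0, A) (0, C)) =
        D.evenBracket θ (D.evenBracket θ x (0, A)) (0, C) +
          D.evenBracket θ (0, A) (D.evenBracket θ x (0, C))) →
      D.evenBracket θ x (D.evenBracket θ (0, A) z) =
        D.evenBracket θ (D.evenBracket θ x (0, A)) z +
          D.evenBracket θ (0, A) (D.evenBracket θ x z) := by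
    intro x hx A hA z hz H
    have := evenSub_induction (S' := N) (b := b) (h := h)
      (N := LinearMap.eqLocus (D.evenBracket θ x ∘ₗ D.evenBracket θ (0, A))
        (D.evenBracket θ (D.evenBracket θ x (0, A)) +
          D.evenBracket θ (0, A) ∘ₗ D.evenBracket θ x))
      (fun s hs t ht => j1 x hx _ (inr_mem_evenSub hA) s hs t ht) H hz
    exact this
  have j3 : ∀ x ∈ D.evenSub N b h, ∀ A ∈ h, ∀ C ∈ h,
      D.evenBracket θ x (D.evenBracket θ (0, A) (0, C)) =
        D.evenBracket θ (D.evenBracket θ x (0, A)) (0, C) +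
          D.evenBracket θ (0, A) (D.evenBracket θ x (0, C)) := by
    intro x hx A hA C hC
    apply swap'
    apply swap
    refine j2 _ (inr_mem_evenSub hA) C hC x hx fun B hB => ?_
    simp only [hAB]
    simp
  intro x hx y hy z hz
  have := evenSub_induction (S' := N) (b := b) (h := h)
    (N := LinearMap.eqLocus (D.evenBracket θ x ∘ₗ D.evenBracket θ y)
        (D.evenBracket θ (D.evenBracket θ x y) + D.evenBracket θ y ∘ₗ D.evenBracket θ x))
    (fun s hs t ht => j1 x hx y hy s hs t ht)
    (fun A hA => swap x y (0, A) (j2 x hx A hA y hy fun C hC => j3 x hx A hA C hC)) hz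
  exact this

namespace LiePair

variable (P : D.LiePair)

/-- Whatever the section, the graph of l = γ ∘ Σ lies in the span of the squares. This is why the
flat picture does not depend on the section. -/
theorem lam_mem (sec : D.SquaringSection P.sub) (v : V) :
    (v, P.lam sec v) ∈ D.squareSpan P.sub P.cocycle := by
  have h := tensorLift_mem P.cocycle (sec.toMap v : P.sub ⊗[ℝ] P.sub)
  rwa [sec.section_eq] at h

theorem env_le_maxEnv : P.env ≤ P.maxEnv := fun A hA => ⟨P.act_sub A hA, P.act_beta A hA⟩

theorem maxEnv_lie {A B : So D.η} (hA : A ∈ P.maxEnv) (hB : B ∈ P.maxEnv) : ⁅A, B⁆ ∈ P.maxEnv := by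
  refine ⟨fun s hs => ?_, actBeta_lie A B _ hA.2 hB.2⟩
  rw [spin_lie]
  exact sub_mem (hA.1 _ (hB.1 _ hs)) (hB.1 _ (hA.1 _ hs))

theorem lie_square {A : So D.η} (hA : A ∈ P.maxEnv) (s t : S) :
    ⁅A, P.cocycle.2 s t⁆ =
      P.cocycle.2 (D.spin A s) t + P.cocycle.2 s (D.spin A t) :=
  lie_gamma P.cocycle_mem hA.2 s t

/-- An element of `maxEnv` acts on squares as a derivation, so it preserves their span and therefore
the part of that span in so(V). The bracket with θ = 0 suffices, because θ does not enter a bracket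
with an element of so(V). -/
theorem env_lie {A B : So D.η} (hA : A ∈ P.maxEnv) (hB : B ∈ P.env) : ⁅A, B⁆ ∈ P.env := by
  refine (mem_envelope_iff P.cocycle_mem).2 ?_
  have key : D.squareSpan P.sub P.cocycle ≤
      (D.squareSpan P.sub P.cocycle).comap (D.evenBracket 0 (0, A)) := by
    refine Submodule.span_le.2 ?_
    rintro _ ⟨s, hs, t, ht, rfl⟩
    have e : D.evenBracket 0 (0, A) (D.square P.cocycle s t) =
        D.square P.cocycle (D.spin A s) t + D.square P.cocycle s (D.spin A t) := by
      rw [evenBracket_apply, square_apply, square_apply, square_apply]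
      refine Prod.ext ?_ ?_
      · simp [vec_κ]
      · simp [P.lie_square hA]
    rw [SetLike.mem_coe, Submodule.mem_comap, e]
    exact add_mem (square_mem (hA.1 s hs) ht) (square_mem hs (hA.1 t ht))
  have := key ((mem_envelope_iff P.cocycle_mem).1 hB)
  rw [Submodule.mem_comap, evenBracket_apply] at this
  simpa using this

theorem theta_symm (l : V →ₗ[ℝ] So D.η) (v : V) (s t : S) :
    P.Theta l v s t = P.Theta l v t s := by
  have := gamma_symm P.cocycle_mem
  simp only [Theta, LinearMap.sub_apply, LinearMap.add_apply, LinearMap.compl₂_apply,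
    LinearMap.comp_apply, actGamma_apply]
  rw [this s (P.cocycle.1 v t), this (P.cocycle.1 v s) t, this s t, this (D.spin (l v) s) t,
    this s (D.spin (l v) t)]
  abel

theorem Theta_apply (l : V →ₗ[ℝ] So D.η) (v : V) (s t : S) :
    P.Theta l v s t = P.cocycle.2 s (P.cocycle.1 v t) + P.cocycle.2 (P.cocycle.1 v s) t -
      (⁅l v, P.cocycle.2 s t⁆ - P.cocycle.2 (D.spin (l v) s) t -
        P.cocycle.2 s (D.spin (l v) t)) := rfl

theorem IsTheta.apply {P : D.LiePair} {l : V →ₗ[ℝ] So D.η} {θ : V →ₗ[ℝ] V →ₗ[ℝ] So D.η}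
    (h : P.IsTheta l θ) (v : V) {s t : S} (hs : s ∈ P.sub) (ht : t ∈ P.sub) :
    θ v (D.κ s t) = P.Theta l v s t := by
  have := LinearMap.eq_zero_of_diag (D.κ.compr₂ (θ v) - P.Theta l v)
    (fun s t => by
      rw [LinearMap.sub_apply, LinearMap.sub_apply, LinearMap.sub_apply, LinearMap.sub_apply,
        P.theta_symm, LinearMap.compr₂_apply, LinearMap.compr₂_apply, D.κ_symm]) P.sub
    (fun s hs => sub_eq_zero.2 (h.2 v s hs)) hs ht
  exact sub_eq_zero.1 this

/-- Integrability of a Lie pair amounts to the Jacobi identities. -/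
theorem isFlat {sec : D.SquaringSection P.sub} {θ : V →ₗ[ℝ] V →ₗ[ℝ] So D.η}
    (hadm : P.IsAdmissible sec) (hθ : P.IsTheta (P.lam sec) θ)
    (hint : ∀ v w, ∀ s ∈ P.sub, D.spin (θ v w) s =
        P.cocycle.1 v (P.cocycle.1 w s) - P.cocycle.1 w (P.cocycle.1 v s) +
          D.actBeta (P.lam sec v) P.cocycle.1 w s - D.actBeta (P.lam sec w) P.cocycle.1 v s)
    {h : Submodule ℝ (So D.η)} (hle : P.env ≤ h) (hle' : h ≤ P.maxEnv)
    (hlie : ∀ A ∈ h, ∀ B ∈ h, ⁅A, B⁆ ∈ h) :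
    IsFlat P.cocycle θ (D.evenSub P.sub P.cocycle h) P.sub := by
  have hl : ∀ v, (v, P.lam sec v) ∈ D.evenSub P.sub P.cocycle h :=
    fun v => squareSpan_le_evenSub (P.lam_mem sec v)
  -- The so(V)-component of an even element differs from l(v) by something that kills β and
  -- preserves S'. Each condition thus reduces to its instance at l(v), which integrability
  -- supplies.
  have hmem : ∀ x ∈ D.evenSub P.sub P.cocycle h, x.2 - P.lam sec x.1 ∈ P.maxEnv :=
    fun x hx => hle' ((mem_evenSub_iff P.cocycle_mem hle hl).1 hx)
  refine IsFlat.of_jac hθ.1 hlie ?_ ?_ ?_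
  · intro x hx s hs
    have h1 := add_mem (hadm x.1 s hs) ((hmem x hx).1 s hs)
    rw [map_sub, LinearMap.sub_apply] at h1
    rw [evenAct_apply]
    convert h1 using 1
    abel
  · intro x hx y hy s hs
    have h1 := LinearMap.congr_fun (LinearMap.congr_fun (hmem x hx).2 y.1) s
    have h2 := LinearMap.congr_fun (LinearMap.congr_fun (hmem y hy).2 x.1) s
    rw [actBeta_sub_left, LinearMap.sub_apply, LinearMap.sub_apply, LinearMap.zero_apply,
      LinearMap.zero_apply, sub_eq_zero] at h1 h2
    have h3 := hint x.1 y.1 s hs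
    rw [← h1, ← h2] at h3
    simp only [evenAct_apply, evenBracket_apply, map_add, LinearMap.add_apply, h3, spin_lie,
      actBeta_apply, map_sub, LinearMap.sub_apply]
    abel
  · intro x hx s hs t ht
    rw [square_apply, square_apply, square_apply, evenBracket_apply]
    -- The V-component is the first cocycle condition. The so(V)-component is θ ∘ κ = Θ, with l(v)
    -- replaced by the actual component by means of the invariance of γ.
    refine Prod.ext ?_ ?_
    · simp only [Prod.fst_add, vec_κ, vec_gamma P.cocycle_mem, evenAct_apply, map_add,
        LinearMap.add_apply]
      abel
    · have h1 := P.lie_square (hmem x hx) s t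
      simp only [Prod.snd_add, hθ.apply x.1 hs ht, Theta_apply, evenAct_apply, map_add,
        LinearMap.add_apply]
      simp only [sub_lie, map_sub, LinearMap.sub_apply] at h1
      rw [sub_eq_iff_eq_add] at h1
      rw [h1]
      abel

end LiePair

/-! ### Presentations and flat models -/

section Shear

variable {b : D.BetaGamma} {N : Submodule ℝ S} {h : Submodule ℝ (So D.η)}
  {E : Submodule ℝ (V × So D.η)} {l : V →ₗ[ℝ] So D.η}

/-- The linear equivalence `(v, s, A) ↦ (v, A + l(v), s)`. -/
def shear (hE : ∀ x, x ∈ E ↔ x.2 - l x.1 ∈ h) (N : Submodule ℝ S) :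
    (V × N × h) ≃ₗ[ℝ] (E × N) where
  toFun x := (⟨(x.1, x.2.2 + l x.1), (hE _).2 (by simp)⟩, x.2.1)
  invFun y := (y.1.1.1, y.2, ⟨y.1.1.2 - l y.1.1.1, (hE _).1 y.1.2⟩)
  map_add' x y := by
    refine Prod.ext (Subtype.ext (Prod.ext rfl ?_)) rfl
    simp only [Prod.fst_add, Prod.snd_add, map_add, Submodule.coe_add]
    abel
  map_smul' c x := by
    refine Prod.ext (Subtype.ext (Prod.ext rfl ?_)) rfl
    simp
  left_inv x := by simp
  right_inv y := by simp

theorem shear_fst (hE : ∀ x, x ∈ E ↔ x.2 - l x.1 ∈ h) (x : V × N × h) :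
    ((shear hE N x).1 : V × So D.η) = (x.1, x.2.2 + l x.1) := rfl

theorem shear_snd (hE : ∀ x, x ∈ E ↔ x.2 - l x.1 ∈ h) (x : V × N × h) :
    (shear hE N x).2 = x.2.1 := rfl

/-- The shear adds to the degree 0 part a term depending on the degree −2 part alone. It therefore
preserves the filtration and, as the next lemma shows, the symbols. -/
theorem shear_mem_totalFil (hE : ∀ x, x ∈ E ↔ x.2 - l x.1 ∈ h) (x : V × N × h) (k : ℤ) :
    D.toTotal E N (shear hE N x) ∈ D.totalFil k ↔
      ((x.1, (x.2.1 : S), (x.2.2 : So D.η)) : D.Total) ∈ D.totalFil k := by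
  rw [mem_totalFil, mem_totalFil, toTotal_apply, shear_fst, shear_snd]
  refine and_congr_right fun h1 => and_congr_right fun h2 => forall_congr' fun h3 => ?_
  have h1' : x.1 = 0 := h1 (by omega)
  simp [h1']

theorem totalSymb_shear (hE : ∀ x, x ∈ E ↔ x.2 - l x.1 ∈ h) (x : V × N × h) (k : ℤ)
    (hx : ((x.1, (x.2.1 : S), (x.2.2 : So D.η)) : D.Total) ∈ D.totalFil k) :
    D.totalSymb k (D.toTotal E N (shear hE N x)) =
      D.totalSymb k (x.1, (x.2.1 : S), (x.2.2 : So D.η)) := by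
  rw [totalSymb_apply, totalSymb_apply, toTotal_apply, shear_fst, shear_snd]
  refine Prod.ext rfl (Prod.ext rfl ?_)
  by_cases hk : k = 0
  · simp only [hk, if_true]
    have : x.1 = 0 := hx.1 (by omega)
    simp [this]
  · simp only [hk, if_false]

/-- A presentation determined by a flat model. -/
def FlatModel.presentation {F : D.Subdeformation} {θ : V →ₗ[ℝ] V →ₗ[ℝ] So D.η}
    (m : FlatModel F b θ E N) (hE : ∀ x, x ∈ E ↔ x.2 - l x.1 ∈ h) : Presentation F N h where
  toEquiv := (shear hE N).trans m.equiv.symm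
  parity_V v := by
    rw [m.mem_even, LinearEquiv.trans_apply, LinearEquiv.apply_symm_apply]; rfl
  parity_S s := by
    rw [m.mem_odd, LinearEquiv.trans_apply, LinearEquiv.apply_symm_apply]
    exact Subtype.ext (by simp [shear_fst])
  parity_h A := by
    rw [m.mem_even, LinearEquiv.trans_apply, LinearEquiv.apply_symm_apply]; rfl
  fil_V v := by
    rw [m.mem_fil]; exact mem_totalFil_of_le le_rfl _
  fil_S s := by
    rw [m.mem_fil, LinearEquiv.trans_apply, LinearEquiv.apply_symm_apply, shear_mem_totalFil,
      mem_totalFil]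
    simp
  fil_h A := by
    rw [m.mem_fil, LinearEquiv.trans_apply, LinearEquiv.apply_symm_apply, shear_mem_totalFil,
      mem_totalFil]
    simp
  symb_V v := by
    rw [m.symb_eq]
    dsimp only
    rw [LinearEquiv.trans_apply, LinearEquiv.apply_symm_apply,
      totalSymb_shear _ _ _ (mem_totalFil_of_le le_rfl _), totalSymb_apply]
    simp
  symb_S s := by
    rw [m.symb_eq]
    dsimp only
    rw [LinearEquiv.trans_apply, LinearEquiv.apply_symm_apply,
      totalSymb_shear _ _ _ (by rw [mem_totalFil]; simp), totalSymb_apply]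
    simp
  symb_h A := by
    rw [m.symb_eq]
    dsimp only
    rw [LinearEquiv.trans_apply, LinearEquiv.apply_symm_apply,
      totalSymb_shear _ _ _ (by rw [mem_totalFil]; simp), totalSymb_apply]
    simp

end Shear

/-- The deformed bracket is the flat bracket, sheared by `l`. -/
theorem deformedBracket_shear (P : D.LiePair) (l : V →ₗ[ℝ] So D.η)
    (θ : V →ₗ[ℝ] V →ₗ[ℝ] So D.η) (x y z : D.Total)
    (hE : ((z.1, z.2.2 + l z.1) : V × So D.η) =
      D.evenBracket θ (x.1, x.2.2 + l x.1) (y.1, y.2.2 + l y.1) + D.square P.cocycle x.2.1 y.2.1)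
    (hN : z.2.1 = D.evenAct P.cocycle (x.1, x.2.2 + l x.1) y.2.1 -
      D.evenAct P.cocycle (y.1, y.2.2 + l y.1) x.2.1) :
    z = P.deformedBracket l θ x y := by
  have e1 := congrArg Prod.fst hE
  have e2 := congrArg Prod.snd hE
  simp only [evenBracket_apply, square_apply, Prod.fst_add, Prod.snd_add] at e1 e2
  simp only [evenAct_apply] at hN
  rw [← eq_sub_iff_add_eq] at e2
  refine Prod.ext ?_ (Prod.ext ?_ ?_)
  · simp only [LiePair.deformedBracket, e1, map_add, LinearMap.add_apply]
    abel
  · simp only [LiePair.deformedBracket, hN, map_add, LinearMap.add_apply]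
    abel
  · rw [e2, e1]
    simp only [LiePair.deformedBracket, map_add, map_sub, LinearMap.add_apply, add_lie, lie_add]
    rw [← lie_skew (l x.1) y.2.2]
    abel

/-- Flat models of `V ⊕ S' ⊕ h` are deformations in the sense of the deformed bracket. -/
theorem LiePair.isDeformationOver {P : D.LiePair} {h : Submodule ℝ (So D.η)} (hle : P.env ≤ h)
    {F : D.Subdeformation} (sec : D.SquaringSection P.sub) {θ : V →ₗ[ℝ] V →ₗ[ℝ] So D.η}
    (hθ : P.IsTheta (P.lam sec) θ)
    (m : FlatModel F P.cocycle θ (D.evenSub P.sub P.cocycle h) P.sub) :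
    P.IsDeformationOver h F := by
  have hl : ∀ v, (v, P.lam sec v) ∈ D.evenSub P.sub P.cocycle h :=
    fun v => squareSpan_le_evenSub (P.lam_mem sec v)
  have hE := fun x => mem_evenSub_iff P.cocycle_mem hle hl (x := x)
  refine ⟨sec, θ, m.presentation hE, hθ, fun x y => ?_⟩
  set z := (m.presentation hE).bracket x y with hz
  have hz' : shear hE P.sub z = m.equiv (F.alg.bracket (m.equiv.symm (shear hE P.sub x))
      (m.equiv.symm (shear hE P.sub y))) := by
    rw [← m.equiv.symm_apply_eq]
    exact (m.presentation hE).toEquiv.apply_symm_apply _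
  have h1 := congrArg (fun e => (e.1 : V × So D.η)) hz'
  have h2 := congrArg (fun e => (e.2 : S)) hz'
  simp only [m.bracket_fst, m.bracket_snd, LinearEquiv.apply_symm_apply, shear_fst,
    shear_snd] at h1 h2
  exact deformedBracket_shear P _ θ _ _ _ h1 h2

theorem LiePair.exists_isDeformationOver {P : D.LiePair} (hP : P.IsIntegrable)
    {h : Submodule ℝ (So D.η)} (hle : P.env ≤ h) (hle' : h ≤ P.maxEnv)
    (hlie : ∀ A ∈ h, ∀ B ∈ h, ⁅A, B⁆ ∈ h) : ∃ F : D.Subdeformation, P.IsDeformationOver h F := by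
  obtain ⟨sec, hadm, -, θ, hθ, hint⟩ := hP
  have H := P.isFlat hadm hθ hint hle hle' hlie
  exact ⟨H.subdeformation P.cocycle_mem hθ.1,
    LiePair.isDeformationOver hle sec hθ (H.model P.cocycle_mem hθ.1)⟩

end PoincareData

/-! ### Parity, filtration and symbols of a presentation, and the flat model it yields -/

namespace PoincareData

universe u v

variable {V : Type u} {S : Type v} [AddCommGroup V] [Module ℝ V] [FiniteDimensional ℝ V]
  [AddCommGroup S] [Module ℝ S] [FiniteDimensional ℝ S] {D : PoincareData V S}

theorem degree_of_not_mem {k : ℤ} {x : D.Total} (h : x ∈ D.totalFil k)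
    (h' : x ∉ D.totalFil (k + 1)) : k = -2 ∨ k = -1 ∨ k = 0 := by
  have h1 : ¬ k + 1 ≤ -2 := fun hk => h' (mem_totalFil_of_le hk x)
  have h2 : ¬ 0 < k := fun hk => h' (by rw [eq_zero_of_mem_totalFil hk h]; exact zero_mem _)
  omega

theorem Subdeformation.symb_congr (F : D.Subdeformation) {k : ℤ} {x y : F.alg.fil k}
    (h : (x : F.carrier) - y ∈ F.alg.fil (k + 1)) : F.symb k x = F.symb k y := by
  rw [← sub_eq_zero, ← map_sub, F.symb_eq_zero_iff]
  exact h

namespace Presentation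

variable {F : D.Subdeformation} {N : Submodule ℝ S} {h : Submodule ℝ (So D.η)}
  (T : Presentation F N h)

theorem toEquiv_eq (x : V × N × h) : T.toEquiv x =
    T.toEquiv (x.1, 0, 0) + T.toEquiv (0, x.2.1, 0) + T.toEquiv (0, 0, x.2.2) := by
  rw [← map_add, ← map_add]
  simp

theorem toEquiv_even (v : V) (A : h) : T.toEquiv (v, 0, A) ∈ F.alg.parity 0 := by
  rw [T.toEquiv_eq]
  refine add_mem (add_mem (T.parity_V v) ?_) (T.parity_h A)
  rw [show ((0 : V), ((v, 0, A) : V × N × h).2.1, (0 : h)) = 0 from rfl, map_zero]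
  exact zero_mem _

theorem eq_zero_of_parity {F : D.Subdeformation} {x : F.carrier} (h0 : x ∈ F.alg.parity 0)
    (h1 : x ∈ F.alg.parity 1) : x = 0 :=
  Submodule.disjoint_def.1 F.alg.isCompl_parity.disjoint x h0 h1

theorem mem_even (x : V × N × h) : T.toEquiv x ∈ F.alg.parity 0 ↔ x.2.1 = 0 := by
  obtain ⟨v, s, A⟩ := x
  constructor
  · intro hx
    have h1 : T.toEquiv (v, s, A) - T.toEquiv (v, 0, A) = T.toEquiv (0, s, 0) := by
      rw [← map_sub]; simp
    have h2 := eq_zero_of_parity (h1 ▸ sub_mem hx (T.toEquiv_even v A)) (T.parity_S s)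
    simpa using h2
  · rintro h1
    change s = 0 at h1
    subst h1
    exact T.toEquiv_even v A

theorem mem_odd (x : V × N × h) : T.toEquiv x ∈ F.alg.parity 1 ↔ x.1 = 0 ∧ x.2.2 = 0 := by
  obtain ⟨v, s, A⟩ := x
  constructor
  · intro hx
    have h1 : T.toEquiv (v, s, A) - T.toEquiv (0, s, 0) = T.toEquiv (v, 0, A) := by
      rw [← map_sub]; simp
    have h2 := eq_zero_of_parity (T.toEquiv_even v A) (h1 ▸ sub_mem hx (T.parity_S s))
    simpa using h2
  · rintro ⟨h1, h2⟩
    change v = 0 at h1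
    change A = 0 at h2
    subst h1 h2
    exact T.parity_S s

/-- A presentation records only the symbols of its three summands. Since the symbol map of degree k
has kernel F^(k+1), the components can be peeled off from degree −2 upwards: an element deeper than
the degree of its lowest component has that component equal to zero. -/
theorem mem_fil (x : V × N × h) (k : ℤ) : T.toEquiv x ∈ F.alg.fil k ↔
    ((x.1, (x.2.1 : S), (x.2.2 : So D.η)) : D.Total) ∈ D.totalFil k := by
  obtain ⟨v, s, A⟩ := x
  have e : ∀ (v : V) (s : N) (A : h), T.toEquiv (v, s, A) = T.toEquiv (v, 0, 0) +
    T.toEquiv (0, s, 0) + T.toEquiv (0, 0, A) := fun v s A => T.toEquiv_eq (v, s, A)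
  have hA : ∀ {k : ℤ}, k ≤ 0 → T.toEquiv (0, 0, A) ∈ F.alg.fil k :=
    fun hk => F.alg.fil_antitone hk (T.fil_h A)
  have hs : ∀ {k : ℤ}, k ≤ -1 → T.toEquiv (0, s, 0) ∈ F.alg.fil k :=
    fun hk => F.alg.fil_antitone hk (T.fil_S s)
  have hv : ∀ {k : ℤ}, k ≤ -2 → T.toEquiv (v, 0, 0) ∈ F.alg.fil k :=
    fun hk => F.alg.fil_antitone hk (T.fil_V v)
  rw [mem_totalFil]
  constructor
  · intro hx
    have h1 : -2 < k → v = 0 := fun hk => by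
      have hx' : T.toEquiv (v, s, A) ∈ F.alg.fil (-2 + 1) := F.alg.fil_antitone (by omega) hx
      have hx'' : T.toEquiv (v, 0, 0) ∈ F.alg.fil (-2 + 1) := by
        have := sub_mem (sub_mem hx' (hA (by norm_num))) (hs (by norm_num))
        rwa [e v s A, add_sub_cancel_right, add_sub_cancel_right] at this
      have := T.symb_V v
      rw [(F.symb_eq_zero_iff (-2) ⟨_, T.fil_V v⟩).2 hx''] at this
      exact (congrArg Prod.fst this).symm
    have h2 : -1 < k → s = 0 := fun hk => by
      have hx' : T.toEquiv (v, s, A) ∈ F.alg.fil (-1 + 1) := F.alg.fil_antitone (by omega) hx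
      have hx'' : T.toEquiv (0, s, 0) ∈ F.alg.fil (-1 + 1) := by
        have := sub_mem hx' (hA (by norm_num))
        rw [e v s A, h1 (by omega), add_sub_cancel_right] at this
        simpa [show ((0 : V), (0 : N), (0 : h)) = 0 from rfl] using this
      have := T.symb_S s
      rw [(F.symb_eq_zero_iff (-1) ⟨_, T.fil_S s⟩).2 hx''] at this
      exact Subtype.ext (congrArg (fun x => x.2.1) this).symm
    have h3 : 0 < k → A = 0 := fun hk => by
      have hx' : T.toEquiv (v, s, A) ∈ F.alg.fil (0 + 1) := F.alg.fil_antitone (by omega) hx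
      rw [h1 (by omega), h2 (by omega)] at hx'
      have := T.symb_h A
      rw [(F.symb_eq_zero_iff 0 ⟨_, T.fil_h A⟩).2 hx'] at this
      exact Subtype.ext (congrArg (fun x => x.2.2) this).symm
    exact ⟨h1, fun hk => by simp [h2 hk], fun hk => by simp [h3 hk]⟩
  · rintro ⟨h1, h2, h3⟩
    rw [e v s A]
    refine add_mem (add_mem ?_ ?_) ?_
    · by_cases hk : k ≤ -2
      · exact hv hk
      · rw [show v = 0 from h1 (by omega), show ((0 : V), (0 : N), (0 : h)) = 0 from rfl, map_zero]
        exact zero_mem _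
    · by_cases hk : k ≤ -1
      · exact hs hk
      · rw [show s = 0 from Subtype.ext (h2 (by omega)),
          show ((0 : V), (0 : N), (0 : h)) = 0 from rfl, map_zero]
        exact zero_mem _
    · by_cases hk : k ≤ 0
      · exact hA hk
      · rw [show A = 0 from Subtype.ext (h3 (by omega)),
          show ((0 : V), (0 : N), (0 : h)) = 0 from rfl, map_zero]
        exact zero_mem _

theorem symb_toEquiv (x : V × N × h) (k : ℤ) (hx : T.toEquiv x ∈ F.alg.fil k) :
    F.symb k ⟨T.toEquiv x, hx⟩ =
      D.totalSymb k (x.1, (x.2.1 : S), (x.2.2 : So D.η)) := by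
  have hx' := (T.mem_fil x k).1 hx
  by_cases hk : ((x.1, (x.2.1 : S), (x.2.2 : So D.η)) : D.Total) ∈ D.totalFil (k + 1)
  · rw [(totalSymb_eq_zero_iff hx').2 hk, F.symb_eq_zero_iff]
    exact (T.mem_fil x (k + 1)).2 hk
  · obtain ⟨v, s, A⟩ := x
    rcases degree_of_not_mem hx' hk with rfl | rfl | rfl
    · rw [F.symb_congr (y := ⟨_, T.fil_V v⟩), T.symb_V, totalSymb_apply]
      · simp
      · change T.toEquiv (v, s, A) - T.toEquiv (v, 0, 0) ∈ _
        rw [← map_sub, T.mem_fil, mem_totalFil]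
        simp
    · have hv : v = 0 := hx'.1 (by norm_num)
      subst hv
      rw [F.symb_congr (y := ⟨_, T.fil_S s⟩), T.symb_S, totalSymb_apply]
      · simp
      · change T.toEquiv (0, s, A) - T.toEquiv (0, s, 0) ∈ _
        rw [← map_sub, T.mem_fil, mem_totalFil]
        simp
    · have hv : v = 0 := hx'.1 (by norm_num)
      have hs : s = 0 := Subtype.ext (hx'.2.1 (by norm_num))
      subst hv hs
      rw [T.symb_h, totalSymb_apply]
      simp

theorem toEquiv_bracket (x y : V × N × h) :
    T.toEquiv (T.bracket x y) = F.alg.bracket (T.toEquiv x) (T.toEquiv y) :=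
  T.toEquiv.apply_symm_apply _

/-- The dimension of the odd part. -/
theorem finrank_odd (T : Presentation F N h) : Module.finrank ℝ (F.alg.parity 1) = Module.finrank ℝ N := by
  let f : N →ₗ[ℝ] F.alg.parity 1 :=
    (T.toEquiv.toLinearMap ∘ₗ LinearMap.inr ℝ V (N × h) ∘ₗ LinearMap.inl ℝ N h).codRestrict _
      T.parity_S
  refine (LinearEquiv.ofBijective f ⟨fun s t hst => ?_, fun y => ?_⟩).finrank_eq.symm
  · have h1 : T.toEquiv (0, s, 0) = T.toEquiv (0, t, 0) := congrArg Subtype.val hst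
    simpa using h1
  · obtain ⟨x, hx⟩ := T.toEquiv.surjective y
    have := (T.mem_odd x).1 (hx ▸ y.2)
    refine ⟨x.2.1, Subtype.ext ?_⟩
    change T.toEquiv (0, x.2.1, 0) = y
    rw [← hx]
    congr 1
    exact Prod.ext this.1.symm (Prod.ext rfl this.2.symm)

/-- The flat model determined by a presentation. -/
def flatModel {b : D.BetaGamma} {θ : V →ₗ[ℝ] V →ₗ[ℝ] So D.η} {E : Submodule ℝ (V × So D.η)}
    {l : V →ₗ[ℝ] So D.η} (hE : ∀ x, x ∈ E ↔ x.2 - l x.1 ∈ h)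
    (h1 : ∀ x y, ((shear hE N (T.bracket x y)).1 : V × So D.η) =
      D.evenBracket θ (shear hE N x).1 (shear hE N y).1 +
        D.square b (shear hE N x).2 (shear hE N y).2)
    (h2 : ∀ x y, ((shear hE N (T.bracket x y)).2 : S) =
      D.evenAct b (shear hE N x).1 (shear hE N y).2 -
        D.evenAct b (shear hE N y).1 (shear hE N x).2) : FlatModel F b θ E N where
  equiv := T.toEquiv.symm.trans (shear hE N)
  mem_even x := by
    obtain ⟨x, rfl⟩ := T.toEquiv.surjective x
    rw [T.mem_even, LinearEquiv.trans_apply, LinearEquiv.symm_apply_apply, shear_snd]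
  mem_odd x := by
    obtain ⟨x, rfl⟩ := T.toEquiv.surjective x
    rw [T.mem_odd, LinearEquiv.trans_apply, LinearEquiv.symm_apply_apply, ← ZeroMemClass.coe_eq_zero,
      ← ZeroMemClass.coe_eq_zero (x := (shear hE N x).1), shear_fst]
    constructor
    · rintro ⟨e1, e2⟩
      simp [e1, e2]
    · intro e
      have e1 : x.1 = 0 := congrArg Prod.fst e
      have e2 : (x.2.2 : So D.η) + l x.1 = 0 := congrArg Prod.snd e
      rw [e1, map_zero, add_zero] at e2
      exact ⟨e1, e2⟩
  mem_fil k x := by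
    obtain ⟨x, rfl⟩ := T.toEquiv.surjective x
    rw [T.mem_fil, LinearEquiv.trans_apply, LinearEquiv.symm_apply_apply, shear_mem_totalFil]
  symb_eq k x := by
    obtain ⟨x, hx⟩ := x
    obtain ⟨x, rfl⟩ := T.toEquiv.surjective x
    rw [T.symb_toEquiv, LinearEquiv.trans_apply, LinearEquiv.symm_apply_apply,
      totalSymb_shear hE x k ((T.mem_fil x k).1 hx)]
  bracket_fst x y := by
    obtain ⟨x, rfl⟩ := T.toEquiv.surjective x
    obtain ⟨y, rfl⟩ := T.toEquiv.surjective y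
    rw [← T.toEquiv_bracket]
    simp only [LinearEquiv.trans_apply, LinearEquiv.symm_apply_apply]
    exact h1 x y
  bracket_snd x y := by
    obtain ⟨x, rfl⟩ := T.toEquiv.surjective x
    obtain ⟨y, rfl⟩ := T.toEquiv.surjective y
    rw [← T.toEquiv_bracket]
    simp only [LinearEquiv.trans_apply, LinearEquiv.symm_apply_apply]
    exact h2 x y

end Presentation

/-- A deformation over a Lie pair has a flat model. -/
theorem LiePair.IsDeformationOver.exists_flatModel {P : D.LiePair} {h : Submodule ℝ (So D.η)}
    {F : D.Subdeformation} (H : P.IsDeformationOver h F) (hle : P.env ≤ h) :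
    ∃ θ : V →ₗ[ℝ] V →ₗ[ℝ] So D.η,
      Nonempty (FlatModel F P.cocycle θ (D.evenSub P.sub P.cocycle h) P.sub) := by
  obtain ⟨sec, θ, T, hθ, hT⟩ := H
  have hl : ∀ v, (v, P.lam sec v) ∈ D.evenSub P.sub P.cocycle h :=
    fun v => squareSpan_le_evenSub (P.lam_mem sec v)
  have hE := fun x => mem_evenSub_iff P.cocycle_mem hle hl (x := x)
  have key : ∀ x y z : D.Total, z = P.deformedBracket (P.lam sec) θ x y →
      ((z.1, z.2.2 + P.lam sec z.1) : V × So D.η) =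
        D.evenBracket θ (x.1, x.2.2 + P.lam sec x.1) (y.1, y.2.2 + P.lam sec y.1) +
          D.square P.cocycle x.2.1 y.2.1 ∧
      z.2.1 = D.evenAct P.cocycle (x.1, x.2.2 + P.lam sec x.1) y.2.1 -
        D.evenAct P.cocycle (y.1, y.2.2 + P.lam sec y.1) x.2.1 := by
    intro x y z hz
    set e := D.evenBracket θ (x.1, x.2.2 + P.lam sec x.1) (y.1, y.2.2 + P.lam sec y.1) +
      D.square P.cocycle x.2.1 y.2.1 with he
    set n := D.evenAct P.cocycle (x.1, x.2.2 + P.lam sec x.1) y.2.1 -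
        D.evenAct P.cocycle (y.1, y.2.2 + P.lam sec y.1) x.2.1 with hn
    -- `deformedBracket_shear` passes from the flat formula to the deformed one. The flat formula
    -- determines the bracket, so applying the lemma to the unsheared flat value gives the converse.
    have := deformedBracket_shear P (P.lam sec) θ x y (e.1, n, e.2 - P.lam sec e.1)
      (by simp [← he]) rfl
    rw [hz, ← this]
    simp
  refine ⟨θ, ⟨T.flatModel hE (fun x y => ?_) (fun x y => ?_)⟩⟩
  · exact (key _ _ _ (hT x y)).1
  · exact (key _ _ _ (hT x y)).2

/-! ### Jacobi identities in a flat model, and isomorphisms between flat models -/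

namespace FlatModel

variable {F : D.Subdeformation} {b : D.BetaGamma} {θ : V →ₗ[ℝ] V →ₗ[ℝ] So D.η}
  {E : Submodule ℝ (V × So D.η)} {N : Submodule ℝ S} (m : FlatModel F b θ E N)

theorem symm_even (x : E) : m.equiv.symm (x, 0) ∈ F.alg.parity 0 := by
  rw [m.mem_even, LinearEquiv.apply_symm_apply]

theorem symm_odd (s : N) : m.equiv.symm (0, s) ∈ F.alg.parity 1 := by
  rw [m.mem_odd, LinearEquiv.apply_symm_apply]

theorem act_mem (m : FlatModel F b θ E N) {x : V × So D.η} (hx : x ∈ E) {s : S} (hs : s ∈ N) :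
    D.evenAct b x s ∈ N := by
  have := m.bracket_snd (m.equiv.symm (⟨x, hx⟩, 0)) (m.equiv.symm (0, ⟨s, hs⟩))
  simp only [LinearEquiv.apply_symm_apply, ZeroMemClass.coe_zero, map_zero, sub_zero] at this
  rw [← this]
  exact Subtype.coe_prop _

theorem bracket_even_even (x y : E) :
    ∃ hz : D.evenBracket θ x y ∈ E, F.alg.bracket (m.equiv.symm (x, 0)) (m.equiv.symm (y, 0)) =
      m.equiv.symm (⟨_, hz⟩, 0) := by
  have h1 := m.bracket_fst (m.equiv.symm (x, 0)) (m.equiv.symm (y, 0))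
  have h2 := m.bracket_snd (m.equiv.symm (x, 0)) (m.equiv.symm (y, 0))
  simp only [LinearEquiv.apply_symm_apply, ZeroMemClass.coe_zero, map_zero, sub_zero,
    add_zero] at h1 h2
  refine ⟨by rw [← h1]; exact Subtype.coe_prop _, ?_⟩
  rw [LinearEquiv.eq_symm_apply]
  exact Prod.ext (Subtype.ext h1) (Subtype.ext h2)

theorem bracket_even_odd (x : E) (s : N) :
    ∃ hz : D.evenAct b x s ∈ N, F.alg.bracket (m.equiv.symm (x, 0)) (m.equiv.symm (0, s)) =
      m.equiv.symm (0, ⟨_, hz⟩) := by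
  refine ⟨m.act_mem x.2 s.2, ?_⟩
  have h1 := m.bracket_fst (m.equiv.symm (x, 0)) (m.equiv.symm (0, s))
  have h2 := m.bracket_snd (m.equiv.symm (x, 0)) (m.equiv.symm (0, s))
  simp only [LinearEquiv.apply_symm_apply, ZeroMemClass.coe_zero, map_zero, sub_zero,
    add_zero, LinearMap.zero_apply] at h1 h2
  rw [LinearEquiv.eq_symm_apply]
  exact Prod.ext (Subtype.ext h1) (Subtype.ext h2)

theorem bracket_odd_odd (s t : N) :
    ∃ hz : D.square b s t ∈ E, F.alg.bracket (m.equiv.symm (0, s)) (m.equiv.symm (0, t)) =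
      m.equiv.symm (⟨_, hz⟩, 0) := by
  have h1 := m.bracket_fst (m.equiv.symm (0, s)) (m.equiv.symm (0, t))
  have h2 := m.bracket_snd (m.equiv.symm (0, s)) (m.equiv.symm (0, t))
  simp only [LinearEquiv.apply_symm_apply, ZeroMemClass.coe_zero, map_zero, sub_zero,
    zero_add, LinearMap.zero_apply] at h1 h2
  refine ⟨by rw [← h1]; exact Subtype.coe_prop _, ?_⟩
  rw [LinearEquiv.eq_symm_apply]
  exact Prod.ext (Subtype.ext h1) (Subtype.ext h2)

theorem jac₁ (m : FlatModel F b θ E N) {x y : V × So D.η} (hx : x ∈ E) (hy : y ∈ E) {s : S} (hs : s ∈ N) :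
    D.evenAct b x (D.evenAct b y s) =
      D.evenAct b (D.evenBracket θ x y) s + D.evenAct b y (D.evenAct b x s) := by
  have h := F.alg.bracket_jacobi (m.equiv.symm (0, ⟨s, hs⟩)) (m.symm_even ⟨x, hx⟩)
    (m.symm_even ⟨y, hy⟩)
  rw [koszulSign, if_neg (by simp), one_smul] at h
  obtain ⟨h1, e1⟩ := m.bracket_even_odd ⟨y, hy⟩ ⟨s, hs⟩
  obtain ⟨h2, e2⟩ := m.bracket_even_odd ⟨x, hx⟩ ⟨s, hs⟩
  obtain ⟨h3, e3⟩ := m.bracket_even_even ⟨x, hx⟩ ⟨y, hy⟩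
  rw [e1, e2, e3] at h
  obtain ⟨h4, e4⟩ := m.bracket_even_odd ⟨x, hx⟩ ⟨_, h1⟩
  obtain ⟨h5, e5⟩ := m.bracket_even_odd ⟨y, hy⟩ ⟨_, h2⟩
  obtain ⟨h6, e6⟩ := m.bracket_even_odd ⟨_, h3⟩ ⟨s, hs⟩
  rw [e4, e5, e6, ← map_add, m.equiv.symm.injective.eq_iff] at h
  exact congrArg (fun z => (z.2 : S)) h

/-- The Jacobi identity of F for one even and two odd elements. It expresses the bracket of an even
element with a square through β and γ alone, so θ is determined wherever it matters. -/
theorem jac₂ (m : FlatModel F b θ E N) {x : V × So D.η} (hx : x ∈ E) {s t : S} (hs : s ∈ N) (ht : t ∈ N) :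
    D.evenBracket θ x (D.square b s t) =
      D.square b (D.evenAct b x s) t + D.square b s (D.evenAct b x t) := by
  have h := F.alg.bracket_jacobi (m.equiv.symm (0, ⟨t, ht⟩)) (m.symm_even ⟨x, hx⟩)
    (m.symm_odd ⟨s, hs⟩)
  rw [koszulSign, if_neg (by simp), one_smul] at h
  obtain ⟨h1, e1⟩ := m.bracket_odd_odd ⟨s, hs⟩ ⟨t, ht⟩
  obtain ⟨h2, e2⟩ := m.bracket_even_odd ⟨x, hx⟩ ⟨s, hs⟩
  obtain ⟨h3, e3⟩ := m.bracket_even_odd ⟨x, hx⟩ ⟨t, ht⟩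
  rw [e1, e2, e3] at h
  obtain ⟨h4, e4⟩ := m.bracket_even_even ⟨x, hx⟩ ⟨_, h1⟩
  obtain ⟨h5, e5⟩ := m.bracket_odd_odd ⟨_, h2⟩ ⟨t, ht⟩
  obtain ⟨h6, e6⟩ := m.bracket_odd_odd ⟨s, hs⟩ ⟨_, h3⟩
  rw [e4, e5, e6, ← map_add, m.equiv.symm.injective.eq_iff] at h
  exact congrArg (fun z => (z.1 : V × So D.η)) h

theorem toEquiv_mem_totalFil (g : D.GrAut) (x : D.Total) (k : ℤ) :
    g.toEquiv x ∈ D.totalFil k ↔ x ∈ D.totalFil k := by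
  simp [mem_totalFil, GrAut.toEquiv_apply]

theorem totalSymb_toEquiv (g : D.GrAut) (x : D.Total) (k : ℤ) :
    D.totalSymb k (g.toEquiv x) = g.toEquiv (D.totalSymb k x) := by
  simp only [totalSymb_apply, GrAut.toEquiv_apply]
  refine Prod.ext ?_ (Prod.ext ?_ ?_)
  all_goals dsimp only; split_ifs <;> simp

/-- The action of a graded automorphism on `V ⊕ so(V)`. -/
def _root_.PoincareData.GrAut.onEven (g : D.GrAut) : (V × So D.η) ≃ₗ[ℝ] (V × So D.η) :=
  g.onV.prodCongr g.onSo

/-- A graded automorphism which intertwines the data of two flat models induces an isomorphism. -/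
theorem iso {N : Submodule ℝ S} {h : Submodule ℝ (So D.η)}
    (m : FlatModel F b θ (D.evenSub N b h) N)
    {F' : D.Subdeformation} {b' : D.BetaGamma} {θ' : V →ₗ[ℝ] V →ₗ[ℝ] So D.η}
    {E' : Submodule ℝ (V × So D.η)} {N' : Submodule ℝ S} (m' : FlatModel F' b' θ' E' N')
    (g : D.GrAut) (hE : E' = (D.evenSub N b h).map g.onEven.toLinearMap)
    (hN : N' = N.map g.onS.toLinearMap)
    (hβ : ∀ v, ∀ s ∈ N, b'.1 (g.onV v) (g.onS s) = g.onS (b.1 v s))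
    (hγ : ∀ s ∈ N, ∀ t ∈ N, b'.2 (g.onS s) (g.onS t) = g.onSo (b.2 s t)) : F.Iso F' := by
  subst hE hN
  have mapE : ∀ {x}, x ∈ D.evenSub N b h →
      g.onEven x ∈ (D.evenSub N b h).map g.onEven.toLinearMap :=
    fun hx => Submodule.mem_map_of_mem hx
  have mapN : ∀ {s}, s ∈ N → g.onS s ∈ N.map g.onS.toLinearMap :=
    fun hs => Submodule.mem_map_of_mem hs
  have hsq : ∀ s ∈ N, ∀ t ∈ N, D.square b' (g.onS s) (g.onS t) = g.onEven (D.square b s t) :=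
    fun s hs t ht => by
      rw [square_apply, square_apply, hγ s hs t ht, ← g.map_κ]; rfl
  have hact : ∀ x, ∀ s ∈ N, D.evenAct b' (g.onEven x) (g.onS s) = g.onS (D.evenAct b x s) :=
    fun x s hs => by
      rw [evenAct_apply, evenAct_apply, map_add, g.map_spin, ← hβ x.1 s hs]; rfl
  -- No relation between θ and θ' is assumed. Brackets with squares are governed by `jac₂`, and
  -- brackets with h do not involve θ.
  have hbr : ∀ x ∈ D.evenSub N b h, ∀ y ∈ D.evenSub N b h,
      D.evenBracket θ' (g.onEven x) (g.onEven y) = g.onEven (D.evenBracket θ x y) := by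
    intro x hx y hy
    have := evenSub_induction (S' := N) (b := b) (h := h)
      (N := LinearMap.eqLocus (D.evenBracket θ' (g.onEven x) ∘ₗ g.onEven.toLinearMap)
        (g.onEven.toLinearMap ∘ₗ D.evenBracket θ x)) ?_ ?_ hy
    · exact this
    · intro s hs t ht
      change D.evenBracket θ' (g.onEven x) (g.onEven (D.square b s t)) =
        g.onEven (D.evenBracket θ x (D.square b s t))
      rw [m.jac₂ hx hs ht, map_add, ← hsq s hs t ht, m'.jac₂ (mapE hx) (mapN hs) (mapN ht),
        hact x s hs, hact x t ht, hsq _ (m.act_mem hx hs) t ht, hsq s hs _ (m.act_mem hx ht)]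
    · intro A hA
      change D.evenBracket θ' (g.onV x.1, g.onSo x.2) (g.onV 0, g.onSo A) =
        g.onEven (D.evenBracket θ x (0, A))
      rw [evenBracket_apply, evenBracket_apply]
      refine Prod.ext ?_ ?_
      · simp [GrAut.onEven, g.map_vec]
      · simp [GrAut.onEven, g.map_lie]
  set e : (D.evenSub N b h × N) ≃ₗ[ℝ] _ :=
    (g.onEven.submoduleMap (D.evenSub N b h)).prodCongr (g.onS.submoduleMap N) with he
  have e1 : ∀ x, ((e x).1 : V × So D.η) = g.onEven x.1 := fun _ => rfl
  have e2 : ∀ x, ((e x).2 : S) = g.onS x.2 := fun _ => rfl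
  have etot : ∀ x, D.toTotal _ _ (e x) = g.toEquiv (D.toTotal _ _ x) := fun _ => rfl
  have hΦ : ∀ x, m'.equiv ((m.equiv.trans (e.trans m'.equiv.symm)) x) = e (m.equiv x) :=
    fun x => m'.equiv.apply_symm_apply _
  have hfil : ∀ k x, x ∈ F.alg.fil k ↔
      (m.equiv.trans (e.trans m'.equiv.symm)) x ∈ F'.alg.fil k := fun k x => by
    rw [m.mem_fil, m'.mem_fil, hΦ, etot, toEquiv_mem_totalFil]
  refine ⟨m.equiv.trans (e.trans m'.equiv.symm), fun x y => ?_, fun i x => ?_, hfil, g,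
    fun k x => ?_⟩
  · apply m'.equiv.injective
    refine Prod.ext (Subtype.ext ?_) (Subtype.ext ?_)
    · rw [m'.bracket_fst, hΦ, hΦ, hΦ, e1, e1, e1, e2, e2, m.bracket_fst, map_add,
        hbr _ (Subtype.coe_prop _) _ (Subtype.coe_prop _),
        hsq _ (Subtype.coe_prop _) _ (Subtype.coe_prop _)]
    · rw [m'.bracket_snd, hΦ, hΦ, hΦ, e1, e1, e2, e2, e2, m.bracket_snd, map_sub,
        hact _ _ (Subtype.coe_prop _), hact _ _ (Subtype.coe_prop _)]
  · have h2 : ∀ i : ZMod 2, i = 0 ∨ i = 1 := by decide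
    rcases h2 i with rfl | rfl
    · rw [m.mem_even, m'.mem_even, hΦ]
      simp [he]
    · rw [m.mem_odd, m'.mem_odd, hΦ]
      simp [he]
  · rw [m'.symb_eq, m.symb_eq]
    dsimp only
    rw [hΦ, etot, totalSymb_toEquiv]

end FlatModel

end PoincareData

namespace PoincareData

universe u v

variable {V : Type u} {S : Type v} [AddCommGroup V] [Module ℝ V] [FiniteDimensional ℝ V]
  [AddCommGroup S] [Module ℝ S] [FiniteDimensional ℝ S] {D : PoincareData V S}

/-! ### Weak equivalence -/

/-- On the image of `N` the β-part of φ vanishes, hence so does its γ-part by `gamma_eq_zero`;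
adding φ does not change any square. -/
theorem squareSpan_map (g : D.GrAut) (b : D.BetaGamma) {φ : D.BetaGamma} (N : Submodule ℝ S)
    (hφ : φ ∈ D.kernelCocycles (N.map g.onS.toLinearMap)) :
    D.squareSpan (N.map g.onS.toLinearMap) (D.smulBetaGamma g b + φ) =
      (D.squareSpan N b).map g.onEven.toLinearMap := by
  have mapN : ∀ s ∈ N, g.onS s ∈ N.map g.onS.toLinearMap :=
    fun s hs => Submodule.mem_map_of_mem hs
  have key : ∀ s ∈ N, ∀ t ∈ N, D.square (D.smulBetaGamma g b + φ) (g.onS s) (g.onS t) =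
      g.onEven (D.square b s t) := fun s hs t ht => by
    rw [square_apply, square_apply, Prod.snd_add, LinearMap.add_apply, LinearMap.add_apply,
      smulBetaGamma_map_snd, gamma_eq_zero hφ.1 hφ.2 (mapN s hs) (mapN t ht), add_zero,
      ← g.map_κ]
    rfl
  rw [squareSpan, squareSpan, Submodule.map_span]
  congr 1
  ext x
  constructor
  · rintro ⟨_, ⟨s, hs, rfl⟩, _, ⟨t, ht, rfl⟩, rfl⟩
    exact ⟨_, ⟨s, hs, t, ht, rfl⟩, (key s hs t ht).symm⟩
  · rintro ⟨_, ⟨s, hs, t, ht, rfl⟩, rfl⟩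
    exact ⟨_, Submodule.mem_map_of_mem hs, _, Submodule.mem_map_of_mem ht, (key s hs t ht).symm⟩

theorem evenSub_map (g : D.GrAut) (b : D.BetaGamma) {φ : D.BetaGamma} (N : Submodule ℝ S)
    (hφ : φ ∈ D.kernelCocycles (N.map g.onS.toLinearMap)) (h : Submodule ℝ (So D.η)) :
    D.evenSub (N.map g.onS.toLinearMap) (D.smulBetaGamma g b + φ) (h.map g.onSo.toLinearMap) =
      (D.evenSub N b h).map g.onEven.toLinearMap := by
  rw [evenSub, evenSub, squareSpan_map g b N hφ, Submodule.map_sup]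
  congr 1
  rw [← Submodule.map_comp, ← Submodule.map_comp]
  congr 1
  refine LinearMap.ext fun A => ?_
  exact Prod.ext (map_zero g.onV).symm rfl

theorem envelope_map (g : D.GrAut) {b : D.BetaGamma} (hb : b ∈ D.normCocycles) {φ : D.BetaGamma}
    (N : Submodule ℝ S) (hφ : φ ∈ D.kernelCocycles (N.map g.onS.toLinearMap)) :
    D.envelope (N.map g.onS.toLinearMap) (D.smulBetaGamma g b + φ) =
      (D.envelope N b).map g.onSo.toLinearMap := by
  have hb' := add_mem (smulBetaGamma_mem g hb) hφ.1
  ext A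
  obtain ⟨A, rfl⟩ := g.onSo.surjective A
  rw [mem_envelope_iff hb', squareSpan_map g b N hφ]
  have e : ((0, g.onSo A) : V × So D.η) = g.onEven (0, A) :=
    Prod.ext (map_zero g.onV).symm rfl
  rw [e]
  constructor
  · rintro ⟨x, hx, hxA⟩
    have : x = (0, A) := g.onEven.injective hxA
    exact ⟨A, (mem_envelope_iff hb).2 (this ▸ hx), rfl⟩
  · rintro ⟨B, hB, hBA⟩
    have : B = A := g.onSo.injective hBA
    exact ⟨(0, A), (mem_envelope_iff hb).1 (this ▸ hB), rfl⟩

theorem smul_mem_kernelCocycles (g : D.GrAut) {N : Submodule ℝ S} {φ : D.BetaGamma}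
    (hφ : φ ∈ D.kernelCocycles N) :
    D.smulBetaGamma g φ ∈ D.kernelCocycles (N.map g.onS.toLinearMap) := by
  refine ⟨smulBetaGamma_mem g hφ.1, ?_⟩
  rintro v _ ⟨s, hs, rfl⟩
  rw [smulBetaGamma_fst]
  simp [hφ.2 _ s hs]

theorem isInvariant_smul (g : D.GrAut) {h : Submodule ℝ (So D.η)} {φ : D.BetaGamma}
    (hφ : φ ∈ D.normCocycles) (H : D.IsInvariant h φ) :
    D.IsInvariant (h.map g.onSo.toLinearMap) (D.smulBetaGamma g φ) := by
  rw [isInvariant_iff (smulBetaGamma_mem g hφ)]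
  rintro _ ⟨A, hA, rfl⟩
  exact (actBeta_smul_eq_zero g φ).2 (H A hA).1

theorem map_symm_map (g : D.GrAut) (N : Submodule ℝ S) :
    (N.map g.onS.toLinearMap).map g.symm.onS.toLinearMap = N := by
  rw [← Submodule.map_comp]
  convert Submodule.map_id N
  exact LinearMap.ext fun s => g.onS.symm_apply_apply s

theorem map_symm_map_so (g : D.GrAut) (h : Submodule ℝ (So D.η)) :
    (h.map g.onSo.toLinearMap).map g.symm.onSo.toLinearMap = h := by
  rw [← Submodule.map_comp]
  convert Submodule.map_id h
  exact LinearMap.ext fun s => g.onSo.symm_apply_apply s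

namespace LiePair

/-- The envelope sees only γ on ⊙²S', which φ leaves unchanged. Because g carries one envelope to
the other, invariance of φ can be transported along g, as symmetry and transitivity of weak
equivalence require. -/
theorem env_eq_map {P Q : D.LiePair} {g : D.GrAut} {φ : D.BetaGamma}
    (hφ : φ ∈ D.kernelCocycles Q.sub) (hsub : Q.sub = P.sub.map g.onS.toLinearMap)
    (hcoc : Q.cocycle = D.smulBetaGamma g P.cocycle + φ) :
    Q.env = P.env.map g.onSo.toLinearMap := by
  rw [env, env, hcoc, hsub]
  exact envelope_map g P.cocycle_mem P.sub (hsub ▸ hφ)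

theorem weakEquiv_refl (P : D.LiePair) : P.WeakEquiv P :=
  ⟨GrAut.refl D, 0, zero_mem _,
    (isInvariant_iff (zero_mem _)).2 fun A _ => LinearMap.ext₂ fun v s => by simp,
    (Submodule.map_id _).symm, by rw [smulBetaGamma_refl, add_zero]⟩

theorem WeakEquiv.symm {P Q : D.LiePair} (H : P.WeakEquiv Q) : Q.WeakEquiv P := by
  obtain ⟨g, φ, hφ, hinv, hsub, hcoc⟩ := H
  have henv := env_eq_map hφ hsub hcoc
  have h1 := smul_mem_kernelCocycles g.symm hφ
  have h2 := isInvariant_smul g.symm hφ.1 hinv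
  rw [hsub, map_symm_map] at h1
  rw [henv, map_symm_map_so] at h2
  refine ⟨g.symm, -D.smulBetaGamma g.symm φ, neg_mem h1, ?_, ?_, ?_⟩
  · rw [isInvariant_iff (neg_mem h1.1)]
    intro A hA
    refine LinearMap.ext₂ fun v s => ?_
    have := LinearMap.congr_fun (LinearMap.congr_fun (h2 A hA).1 v) s
    rw [LinearMap.zero_apply, LinearMap.zero_apply, ← neg_eq_zero] at this
    rw [LinearMap.zero_apply, LinearMap.zero_apply, ← this]
    simp only [actBeta_apply, Prod.fst_neg, LinearMap.neg_apply, map_neg]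
    abel
  · rw [hsub, map_symm_map]
  · rw [hcoc, smulBetaGamma_add, smulBetaGamma_symm, add_neg_cancel_right]

theorem WeakEquiv.trans {P Q R : D.LiePair} (H : P.WeakEquiv Q) (H' : Q.WeakEquiv R) :
    P.WeakEquiv R := by
  obtain ⟨g, φ, hφ, hinv, hsub, hcoc⟩ := H
  obtain ⟨k, ψ, hψ, kinv, ksub, kcoc⟩ := H'
  have henv := env_eq_map hψ ksub kcoc
  have h1 := smul_mem_kernelCocycles k hφ
  have h2 := isInvariant_smul k hφ.1 hinv
  rw [← ksub] at h1
  rw [← henv] at h2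
  have h3 := add_mem h1 hψ
  refine ⟨g.trans k, D.smulBetaGamma k φ + ψ, h3, ?_, ?_, ?_⟩
  · rw [isInvariant_iff h3.1]
    intro A hA
    rw [Prod.fst_add, actBeta_add_right, (h2 A hA).1, (kinv A hA).1, add_zero]
  · rw [ksub, hsub, ← Submodule.map_comp]
    rfl
  · rw [kcoc, hcoc, smulBetaGamma_add, smulBetaGamma_trans, add_assoc]

theorem maxEnv_eq_map {P Q : D.LiePair} {g : D.GrAut}
    (hsub : Q.sub = P.sub.map g.onS.toLinearMap)
    (hcoc : Q.cocycle = D.smulBetaGamma g P.cocycle) :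
    Q.maxEnv = P.maxEnv.map g.onSo.toLinearMap := by
  ext A
  obtain ⟨A, rfl⟩ := g.onSo.surjective A
  have e : g.onSo A ∈ P.maxEnv.map g.onSo.toLinearMap ↔ A ∈ P.maxEnv :=
    ⟨fun ⟨_, hB, hBA⟩ => g.onSo.injective hBA ▸ hB, fun hA => ⟨A, hA, rfl⟩⟩
  rw [e]
  change (∀ s ∈ Q.sub, _) ∧ _ ↔ (∀ s ∈ P.sub, _) ∧ _
  rw [hcoc, actBeta_smul_eq_zero, hsub]
  refine and_congr_left fun _ => ?_
  have e' : ∀ s, g.onS s ∈ P.sub.map g.onS.toLinearMap ↔ s ∈ P.sub := fun s =>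
    ⟨fun ⟨_, ht, hts⟩ => g.onS.injective hts ▸ ht, fun hs => ⟨s, hs, rfl⟩⟩
  constructor
  · intro H s hs
    rw [← e', g.map_spin]
    exact H _ ((e' s).2 hs)
  · rintro H _ ⟨s, hs, rfl⟩
    change D.spin (g.onSo A) (g.onS s) ∈ _
    rw [← g.map_spin, e']
    exact H s hs

/-- Deformations over weakly equivalent Lie pairs are isomorphic. -/
theorem IsDeformationOver.iso {P Q : D.LiePair} {g : D.GrAut} {φ : D.BetaGamma}
    (hφ : φ ∈ D.kernelCocycles Q.sub) (hsub : Q.sub = P.sub.map g.onS.toLinearMap)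
    (hcoc : Q.cocycle = D.smulBetaGamma g P.cocycle + φ) {h h' : Submodule ℝ (So D.η)}
    (hle : P.env ≤ h) (hle' : Q.env ≤ h') (hh : h' = h.map g.onSo.toLinearMap)
    {F F' : D.Subdeformation} (H : P.IsDeformationOver h F) (H' : Q.IsDeformationOver h' F') :
    F.Iso F' := by
  obtain ⟨θ, ⟨m⟩⟩ := H.exists_flatModel hle
  obtain ⟨θ', ⟨m'⟩⟩ := H'.exists_flatModel hle'
  refine m.iso m' g ?_ hsub ?_ ?_
  · rw [hh, hcoc, hsub]
    exact evenSub_map g P.cocycle P.sub (hsub ▸ hφ) h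
  · intro v s hs
    rw [hcoc, Prod.fst_add, LinearMap.add_apply, LinearMap.add_apply, smulBetaGamma_map_fst,
      hφ.2 _ _ (hsub ▸ Submodule.mem_map_of_mem hs), add_zero]
  · intro s hs t ht
    rw [hcoc, Prod.snd_add, LinearMap.add_apply, LinearMap.add_apply, smulBetaGamma_map_snd,
      gamma_eq_zero hφ.1 hφ.2 (hsub ▸ Submodule.mem_map_of_mem hs)
        (hsub ▸ Submodule.mem_map_of_mem ht), add_zero]

/-- A family of elements of `so(V)` with `μᵢ wⱼ = μⱼ wᵢ`, where the `wᵢ` exhaust `V`, vanishes. -/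
theorem eq_zero_of_symm {ι : Type*} (w : ι → V) (hw : Function.Surjective w)
    (μ : ι → So D.η) (h : ∀ i j, D.vec (μ i) (w j) = D.vec (μ j) (w i)) (i : ι) : μ i = 0 := by
  have skew : ∀ i j k, D.η (D.vec (μ i) (w j)) (w k) = -D.η (D.vec (μ i) (w k)) (w j) :=
    fun i j k => by
      rw [D.lorentzian.symm (D.vec (μ i) (w k))]
      exact skew_apply (μ i) (w j) (w k)
  refine so_ext fun v => ?_
  obtain ⟨j, rfl⟩ := hw v
  rw [map_zero, LinearMap.zero_apply]
  refine D.lorentzian.nondegenerate.1 _ fun u => ?_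
  obtain ⟨k, rfl⟩ := hw u
  -- The expression is symmetric in i, j and skew in j, k. Alternating the two swaps three times
  -- returns to the start with the sign reversed, as in the uniqueness of the Levi-Civita
  -- connection.
  have : D.η (D.vec (μ i) (w j)) (w k) = -D.η (D.vec (μ i) (w j)) (w k) := by
    conv_lhs => rw [h i j, skew, h j k, skew, h k i, neg_neg, skew]
  linarith

theorem surj_evenSub {P : D.LiePair} {h : Submodule ℝ (So D.η)} (v : V) :
    ∃ A, (v, A) ∈ D.evenSub P.sub P.cocycle h := by
  obtain ⟨sec⟩ := exists_squaringSection (D := D) P.dim_lt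
  exact ⟨_, squareSpan_le_evenSub (P.lam_mem sec v)⟩

/-- Lie pairs with isomorphic deformations are weakly equivalent. -/
theorem weakEquiv_of_iso {P Q : D.LiePair} {h h' : Submodule ℝ (So D.η)}
    {F F' : D.Subdeformation} {θ θ' : V →ₗ[ℝ] V →ₗ[ℝ] So D.η}
    (m : FlatModel F P.cocycle θ (D.evenSub P.sub P.cocycle h) P.sub)
    (m' : FlatModel F' Q.cocycle θ' (D.evenSub Q.sub Q.cocycle h') Q.sub)
    (H : F.Iso F') : P.WeakEquiv Q := by
  obtain ⟨Φ, hbr, hpar, hfil, g, hg⟩ := H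
  set E := D.evenSub P.sub P.cocycle h with hE
  set E' := D.evenSub Q.sub Q.cocycle h' with hE'
  set Ψ : (E × P.sub) ≃ₗ[ℝ] (E' × Q.sub) := m.equiv.symm.trans (Φ.trans m'.equiv) with hΨ
  have hΨ' : ∀ x, Φ (m.equiv.symm x) = m'.equiv.symm (Ψ x) := fun x =>
    (m'.equiv.symm_apply_apply _).symm
  have Ψeven : ∀ x : E, Ψ (x, 0) = ((Ψ (x, 0)).1, 0) := fun x => by
    refine Prod.ext rfl ?_
    have := (hpar 0 _).1 (m.symm_even x)
    rw [hΨ', m'.mem_even, LinearEquiv.apply_symm_apply] at this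
    exact this
  have Ψodd : ∀ s : P.sub, Ψ (0, s) = (0, (Ψ (0, s)).2) := fun s => by
    refine Prod.ext ?_ rfl
    have := (hpar 1 _).1 (m.symm_odd s)
    rw [hΨ', m'.mem_odd, LinearEquiv.apply_symm_apply] at this
    exact this
  have Ψsymb : ∀ k x, D.toTotal E P.sub x ∈ D.totalFil k →
      D.totalSymb k (D.toTotal E' Q.sub (Ψ x)) =
        g.toEquiv (D.totalSymb k (D.toTotal E P.sub x)) := fun k x hx => by
    have h1 : m.equiv.symm x ∈ F.alg.fil k := by
      rwa [m.mem_fil, LinearEquiv.apply_symm_apply]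
    have h2 := hg k ⟨_, h1⟩
    rw [m.symb_eq, m'.symb_eq] at h2
    dsimp only at h2
    rwa [hΨ', LinearEquiv.apply_symm_apply, LinearEquiv.apply_symm_apply] at h2
  -- The V-component of an even element and the S-component of an odd one are its symbols, so there
  -- Ψ agrees with g. Only the so(V)-component could differ.
  have ΨV : ∀ x : E, (Ψ (x, 0)).1.1.1 = g.onV x.1.1 := fun x => by
    have := congrArg Prod.fst (Ψsymb (-2) (x, 0) (mem_totalFil_of_le le_rfl _))
    simpa [totalSymb_apply, GrAut.toEquiv_apply, toTotal_apply] using this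
  have ΨS : ∀ s : P.sub, ((Ψ (0, s)).2 : S) = g.onS s := fun s => by
    have := congrArg (fun x => x.2.1) (Ψsymb (-1) (0, s) (by simp [mem_totalFil, toTotal_apply]))
    simpa [totalSymb_apply, GrAut.toEquiv_apply, toTotal_apply] using this
  have brE : ∀ x y : E, D.vec (Ψ (x, 0)).1.1.2 (g.onV y.1.1) -
      D.vec (Ψ (y, 0)).1.1.2 (g.onV x.1.1) = g.onV (D.vec x.1.2 y.1.1 - D.vec y.1.2 x.1.1) := by
    intro x y
    have h1 := hbr (m.equiv.symm (x, 0)) (m.equiv.symm (y, 0))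
    obtain ⟨z1, e1⟩ := m.bracket_even_even x y
    rw [e1, hΨ', hΨ', hΨ', Ψeven x, Ψeven y] at h1
    obtain ⟨z2, e2⟩ := m'.bracket_even_even (Ψ (x, 0)).1 (Ψ (y, 0)).1
    rw [e2, m'.equiv.symm.injective.eq_iff] at h1
    have h2 : g.onV (D.evenBracket θ x y).1 =
        (D.evenBracket θ' (Ψ (x, 0)).1 (Ψ (y, 0)).1).1 :=
      (ΨV ⟨_, z1⟩).symm.trans (congrArg (fun z => z.1.1.1) h1)
    rw [evenBracket_apply, evenBracket_apply] at h2
    dsimp only at h2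
    rw [ΨV, ΨV] at h2
    exact h2.symm
  -- By `brE` the discrepancies μ_x in so(V) satisfy μ_x y = μ_y x on V-components. Since E projects
  -- onto V, `eq_zero_of_symm` kills them, and Ψ is the restriction of g.
  have Ψso : ∀ x : E, (Ψ (x, 0)).1.1.2 = g.onSo x.1.2 := fun x => by
    rw [← sub_eq_zero]
    refine eq_zero_of_symm (ι := E) (fun x => g.onV x.1.1) (fun v => ?_)
      (fun x => (Ψ (x, 0)).1.1.2 - g.onSo x.1.2) (fun x y => ?_) x
    · obtain ⟨v, rfl⟩ := g.onV.surjective v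
      obtain ⟨A, hA⟩ := surj_evenSub (P := P) (h := h) v
      exact ⟨⟨_, hA⟩, rfl⟩
    · have := brE x y
      rw [map_sub, g.map_vec, g.map_vec] at this
      simp only [map_sub, LinearMap.sub_apply]
      rw [sub_eq_sub_iff_add_eq_add] at this ⊢
      rw [this]
      abel
  have hβ : ∀ v, ∀ s ∈ P.sub, Q.cocycle.1 (g.onV v) (g.onS s) = g.onS (P.cocycle.1 v s) := by
    intro v s hs
    obtain ⟨A, hA⟩ := surj_evenSub (P := P) (h := h) v
    have h1 := hbr (m.equiv.symm (⟨_, hA⟩, 0)) (m.equiv.symm (0, ⟨s, hs⟩))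
    obtain ⟨z1, e1⟩ := m.bracket_even_odd ⟨_, hA⟩ ⟨s, hs⟩
    rw [e1, hΨ', hΨ', hΨ', Ψeven, Ψodd ⟨s, hs⟩] at h1
    obtain ⟨z2, e2⟩ := m'.bracket_even_odd (Ψ (⟨_, hA⟩, 0)).1 (Ψ (0, ⟨s, hs⟩)).2
    rw [e2, m'.equiv.symm.injective.eq_iff] at h1
    have h2 : g.onS (D.evenAct P.cocycle (v, A) s) = D.evenAct Q.cocycle
        (Ψ (⟨_, hA⟩, 0)).1 (Ψ (0, ⟨s, hs⟩)).2 :=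
      (ΨS ⟨_, z1⟩).symm.trans (congrArg (fun z => (z.2 : S)) h1)
    rw [evenAct_apply, evenAct_apply, ΨV, Ψso, ΨS, map_add, g.map_spin] at h2
    exact (add_right_cancel h2).symm
  have hsub : Q.sub = P.sub.map g.onS.toLinearMap := by
    apply le_antisymm
    · intro t ht
      obtain ⟨⟨x, s⟩, hxs⟩ := Ψ.surjective (0, ⟨t, ht⟩)
      have h1 : Ψ (x, 0) = (0, ⟨t, ht⟩) - Ψ (0, s) := by rw [← hxs, ← map_sub]; simp
      rw [Ψodd s] at h1
      have h2 : Ψ (x, 0) = 0 := by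
        rw [Ψeven x, h1]; simp
      rw [h2, eq_comm, sub_eq_zero] at h1
      have h3 := congrArg (fun z => (z.2 : S)) h1
      dsimp only at h3
      rw [ΨS] at h3
      exact ⟨s, s.2, h3.symm⟩
    · rintro _ ⟨s, hs, rfl⟩
      have := ΨS ⟨s, hs⟩
      change g.onS s ∈ _
      rw [← this]
      exact Subtype.coe_prop _
  have hφ : Q.cocycle - D.smulBetaGamma g P.cocycle ∈ D.kernelCocycles Q.sub := by
    refine ⟨sub_mem Q.cocycle_mem (smulBetaGamma_mem g P.cocycle_mem), fun v s hs => ?_⟩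
    rw [hsub] at hs
    obtain ⟨s, hs, rfl⟩ := hs
    obtain ⟨v, rfl⟩ := g.onV.surjective v
    have := hβ v s hs
    rw [← smulBetaGamma_map_fst, ← sub_eq_zero] at this
    exact this
  have hcoc : Q.cocycle =
      D.smulBetaGamma g P.cocycle + (Q.cocycle - D.smulBetaGamma g P.cocycle) := by abel
  refine ⟨g, _, hφ, ?_, hsub, hcoc⟩
  rw [isInvariant_iff hφ.1]
  intro A hA
  -- The envelope of Q annihilates the β-part of Q by definition and that of g · P because it is the
  -- image of the envelope of P. It therefore annihilates the difference.
  have h1 := Q.act_beta A hA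
  rw [env_eq_map hφ hsub hcoc] at hA
  obtain ⟨B, hB, rfl⟩ := hA
  have h2 := (actBeta_smul_eq_zero g P.cocycle).2 (P.act_beta B hB)
  change D.actBeta (g.onSo B) _ = 0 at h1
  change D.actBeta (g.onSo B) _ = 0
  rw [hcoc, Prod.fst_add, actBeta_add_right, h2, zero_add] at h1
  exact h1

/-- A Lie pair whose deformation exists is integrable. -/
theorem isIntegrable_of_flatModel {P : D.LiePair} {F : D.Subdeformation}
    {θ : V →ₗ[ℝ] V →ₗ[ℝ] So D.η} (hθ : ∀ v, θ v v = 0) {h : Submodule ℝ (So D.η)}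
    (m : FlatModel F P.cocycle θ (D.evenSub P.sub P.cocycle h) P.sub) : P.IsIntegrable := by
  -- Any section will do: its graph lies in the even subspace, and the Jacobi identities evaluated
  -- at (v, l(v)) are the integrability conditions.
  obtain ⟨sec⟩ := exists_squaringSection (D := D) P.dim_lt
  have hl : ∀ v, (v, P.lam sec v) ∈ D.evenSub P.sub P.cocycle h :=
    fun v => squareSpan_le_evenSub (P.lam_mem sec v)
  have hTheta : ∀ v, ∀ s ∈ P.sub, ∀ t ∈ P.sub,
      P.Theta (P.lam sec) v s t = θ v (D.κ s t) := by
    intro v s hs t ht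
    have := congrArg Prod.snd (m.jac₂ (hl v) hs ht)
    simp only [square_apply, evenBracket_apply, Prod.snd_add, evenAct_apply, map_add,
      LinearMap.add_apply] at this
    rw [Theta_apply, ← sub_eq_zero, ← sub_eq_zero.2 this.symm]
    abel
  have hTheta' : ∀ v (ω : P.sub ⊗[ℝ] P.sub), tensorLift P.sub (P.Theta (P.lam sec) v) ω =
      θ v (tensorLift P.sub D.κ ω) := by
    intro v ω
    induction ω using TensorProduct.induction_on with
    | zero => simp
    | tmul s t => exact hTheta v s s.2 t t.2
    | add x y hx hy => simp [hx, hy]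
  refine ⟨sec, fun v s hs => m.act_mem (hl v) hs, fun v ω hω => ?_, θ,
    ⟨hθ, fun v s hs => (hTheta v s hs s hs).symm⟩, fun v w s hs => ?_⟩
  · rw [hTheta', show tensorLift P.sub D.κ ω = 0 from hω.2, map_zero]
  · have := m.jac₁ (hl v) (hl w) hs
    simp only [evenAct_apply, evenBracket_apply, map_add, LinearMap.add_apply, map_sub,
      LinearMap.sub_apply, spin_lie] at this
    simp only [actBeta_apply]
    rw [← sub_eq_zero, ← sub_eq_zero.2 this.symm]
    abel

end LiePair

end PoincareData

namespace PoincareData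

universe u v

variable {V : Type u} {S : Type v} [AddCommGroup V] [Module ℝ V] [FiniteDimensional ℝ V]
  [AddCommGroup S] [Module ℝ S] [FiniteDimensional ℝ S] {D : PoincareData V S}

/-! ### Realisable subdeformations -/

namespace Presentation

variable {F : D.Subdeformation} {N : Submodule ℝ S} {h : Submodule ℝ (So D.η)}

/-- The leading part of the transported bracket is the Poincaré bracket. The components of the
deformed bracket that carry no deformation are read off from this, degree by degree. -/
theorem symb_bracket (T : Presentation F N h) {k l : ℤ} {x y : V × N × h}
    (hx : ((x.1, (x.2.1 : S), (x.2.2 : So D.η)) : D.Total) ∈ D.totalFil k)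
    (hy : ((y.1, (y.2.1 : S), (y.2.2 : So D.η)) : D.Total) ∈ D.totalFil l) :
    D.totalSymb (k + l) ((T.bracket x y).1, ((T.bracket x y).2.1 : S),
        ((T.bracket x y).2.2 : So D.η)) =
      D.bracket (D.totalSymb k (x.1, (x.2.1 : S), (x.2.2 : So D.η)))
        (D.totalSymb l (y.1, (y.2.1 : S), (y.2.2 : So D.η))) := by
  have hx' := (T.mem_fil x k).2 hx
  have hy' := (T.mem_fil y l).2 hy
  have h1 := T.symb_toEquiv (T.bracket x y) (k + l)
    (by rw [T.toEquiv_bracket]; exact F.alg.bracket_fil hx' hy')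
  rw [← h1, ← T.symb_toEquiv x k hx', ← T.symb_toEquiv y l hy',
    ← F.symb_bracket k l ⟨_, hx'⟩ ⟨_, hy'⟩]
  simp only [T.toEquiv_bracket]

theorem bracket_jacobi (T : Presentation F N h) {x y : V × N × h} (z : V × N × h)
    (hx : x.2.1 = 0) (hy : y.2.1 = 0) :
    T.bracket x (T.bracket y z) = T.bracket (T.bracket x y) z + T.bracket y (T.bracket x z) := by
  have hJ := F.alg.bracket_jacobi (T.toEquiv z) ((T.mem_even x).2 hx) ((T.mem_even y).2 hy)
  rw [koszulSign, if_neg (by simp), one_smul] at hJ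
  apply T.toEquiv.injective
  rw [map_add]
  simp only [T.toEquiv_bracket]
  exact hJ

theorem bracket_fst_of_h (T : Presentation F N h) (A : h) (y : V × N × h) :
    (T.bracket (0, 0, A) y).1 = D.vec A y.1 := by
  have := congrArg Prod.fst (T.symb_bracket (k := 0) (l := -2) (x := (0, 0, A)) (y := y)
    (by simp [mem_totalFil]) (mem_totalFil_of_le le_rfl _))
  simpa [totalSymb_apply, PoincareData.bracket_apply] using this

theorem bracket_h_fst (T : Presentation F N h) (A : h) (x : V × N × h) :
    (T.bracket x (0, 0, A)).1 = -D.vec A x.1 := by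
  have := congrArg Prod.fst (T.symb_bracket (k := -2) (l := 0) (x := x) (y := (0, 0, A))
    (mem_totalFil_of_le le_rfl _) (by simp [mem_totalFil]))
  simpa [totalSymb_apply, PoincareData.bracket_apply] using this

theorem bracket_h_odd (T : Presentation F N h) (A : h) (s : N) :
    ((T.bracket (0, 0, A) (0, s, 0)).2.1 : S) = D.spin A s := by
  have := congrArg (fun x => x.2.1) (T.symb_bracket (k := 0) (l := -1) (x := (0, 0, A))
    (y := (0, s, 0)) (by simp [mem_totalFil]) (by simp [mem_totalFil]))
  simpa [totalSymb_apply, PoincareData.bracket_apply] using this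

theorem bracket_odd_odd_fst (T : Presentation F N h) (s t : N) :
    (T.bracket (0, s, 0) (0, t, 0)).1 = D.κ s t := by
  have := congrArg Prod.fst (T.symb_bracket (k := -1) (l := -1) (x := (0, s, 0))
    (y := (0, t, 0)) (by simp [mem_totalFil]) (by simp [mem_totalFil]))
  simpa [totalSymb_apply, PoincareData.bracket_apply] using this

theorem bracket_even_even (T : Presentation F N h) (v w : V) (A B : h) :
    (T.bracket (v, 0, A) (w, 0, B)).2.1 = 0 := by
  rw [← T.mem_even, T.toEquiv_bracket]
  simpa using F.alg.bracket_mem (T.toEquiv_even v A) (T.toEquiv_even w B)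

theorem bracket_odd_odd (T : Presentation F N h) (s t : N) :
    (T.bracket (0, s, 0) (0, t, 0)).2.1 = 0 := by
  rw [← T.mem_even, T.toEquiv_bracket]
  exact F.alg.bracket_mem (T.parity_S s) (T.parity_S t)

theorem bracket_even_odd (T : Presentation F N h) (v : V) (A : h) (s : N) :
    T.bracket (v, 0, A) (0, s, 0) = (0, (T.bracket (v, 0, A) (0, s, 0)).2.1, 0) := by
  have h1 : T.toEquiv (T.bracket (v, 0, A) (0, s, 0)) ∈ F.alg.parity 1 := by
    rw [T.toEquiv_bracket]
    simpa using F.alg.bracket_mem (T.toEquiv_even v A) (T.parity_S s)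
  rw [T.mem_odd] at h1
  exact Prod.ext h1.1 (Prod.ext rfl h1.2)

theorem bracket_odd_even (T : Presentation F N h) (v : V) (A : h) (s : N) :
    T.bracket (0, s, 0) (v, 0, A) = -T.bracket (v, 0, A) (0, s, 0) := by
  apply T.toEquiv.injective
  rw [map_neg, T.toEquiv_bracket, T.toEquiv_bracket,
    F.alg.bracket_skew (T.parity_S s) (T.toEquiv_even v A), koszulSign, if_neg (by simp), one_smul]

theorem bracket_self (T : Presentation F N h) (v : V) (A : h) :
    T.bracket (v, 0, A) (v, 0, A) = 0 := by
  apply T.toEquiv.injective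
  rw [map_zero, T.toEquiv_bracket]
  have := F.alg.bracket_skew (T.toEquiv_even v A) (T.toEquiv_even v A)
  rw [koszulSign, if_neg (by simp), one_smul] at this
  have h2 : (2 : ℝ) • F.alg.bracket (T.toEquiv (v, 0, A)) (T.toEquiv (v, 0, A)) = 0 := by
    rw [two_smul]
    exact add_eq_zero_iff_eq_neg.2 this
  exact (smul_eq_zero.1 h2).resolve_left two_ne_zero

set_option maxHeartbeats 800000 in
/-- The flat model of a presentation whose cochain is admissible. -/
theorem exists_flatModel (hdim : Module.finrank ℝ S < 2 * Module.finrank ℝ N)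
    (T : Presentation F N h) {b : D.BetaGamma} (hb : b ∈ D.normCocycles)
    (hinv : D.IsInvariant h b) {l : V →ₗ[ℝ] So D.η}
    (hc : T.cochain = D.restrictCocycle N b + D.spencerD N l) :
    D.envelope N b ≤ h ∧ ∃ θ : V →ₗ[ℝ] V →ₗ[ℝ] So D.η, (∀ v, θ v v = 0) ∧
      Nonempty (FlatModel F b θ (D.evenSub N b h) N) := by
  have cα : ∀ v w, (T.bracket (v, 0, 0) (w, 0, 0)).1 = D.vec (l v) w - D.vec (l w) v :=
    fun v w => by
      have : T.cochain.1 v w = 0 + (D.vec (l v) w - D.vec (l w) v) :=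
        LinearMap.congr_fun₂ (congrArg Prod.fst hc) v w
      rw [zero_add] at this
      exact this
  have cβ : ∀ v (s : N), ((T.bracket (v, 0, 0) (0, s, 0)).2.1 : S) = b.1 v s + D.spin (l v) s :=
    fun v s => LinearMap.congr_fun₂ (congrArg (fun x => x.2.1) hc) v s
  have cγ : ∀ s t : N, ((T.bracket (0, s, 0) (0, t, 0)).2.2 : So D.η) =
      b.2 s t - l (D.κ s t) := fun s t => by
    have : T.cochain.2.2 s t = b.2 s t + -l (D.κ s t) :=
      LinearMap.congr_fun₂ (congrArg (fun x => x.2.2) hc) s t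
    rw [sub_eq_add_neg]
    exact this
  -- The so(V)-part of [s, t] lies in h because F is closed under the bracket. On the Dirac kernel
  -- the term with l drops out, which puts the envelope inside h.
  have hγ : ∀ s ∈ N, ∀ t ∈ N, b.2 s t - l (D.κ s t) ∈ h := fun s hs t ht => by
    have := cγ ⟨s, hs⟩ ⟨t, ht⟩
    rw [← this]
    exact Subtype.coe_prop _
  have hle : D.envelope N b ≤ h := by
    intro A hA
    have h1 : D.squareSpan N b ≤
        h.comap (LinearMap.snd ℝ V (So D.η) - l ∘ₗ LinearMap.fst ℝ V (So D.η)) := by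
      refine Submodule.span_le.2 ?_
      rintro _ ⟨s, hs, t, ht, rfl⟩
      rw [square_apply]
      exact hγ s hs t ht
    have h2 := h1 ((mem_envelope_iff hb).1 hA)
    simpa using h2
  -- This `l` need not come from a section. Subtracting the elements of h just found from the
  -- squares puts its graph over each κ(s, t) in the even subspace, and these vectors span V.
  have hl : ∀ v, (v, l v) ∈ D.evenSub N b h := by
    intro v
    refine eq_top_of_κ_mem (D := D) hdim
      (N := (D.evenSub N b h).comap (LinearMap.id.prod l)) (fun s hs t ht => ?_) v
    have h1 := sub_mem (squareSpan_le_evenSub (h := h) (square_mem (b := b) hs ht))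
      (inr_mem_evenSub (S' := N) (b := b) (hγ s hs t ht))
    rw [square_apply] at h1
    simpa using h1
  have hE := fun x => mem_evenSub_iff hb hle hl (x := x)
  have split : ∀ (v : V) (A : h), ((v, 0, A) : V × N × h) = (v, 0, 0) + (0, 0, A) :=
    fun v A => by simp
  have actE : ∀ (v : V) (A : h) (s : N), ((T.bracket (v, 0, A) (0, s, 0)).2.1 : S) =
      D.evenAct b (v, A + l v) s := fun v A s => by
    rw [split, map_add, LinearMap.add_apply]
    simp only [Prod.fst_add, Prod.snd_add, Submodule.coe_add, cβ, T.bracket_h_odd, evenAct_apply,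
      map_add, LinearMap.add_apply]
    abel
  have fstE : ∀ (v w : V) (A B : h), (T.bracket (v, 0, A) (w, 0, B)).1 =
      D.vec (A + l v) w - D.vec (B + l w) v := fun v w A B => by
    rw [split v A, map_add, LinearMap.add_apply, Prod.fst_add, T.bracket_fst_of_h, split w B,
      map_add, Prod.fst_add, T.bracket_h_fst, cα]
    simp only [Prod.fst_add, add_zero, map_add, LinearMap.add_apply]
    abel
  have jac : ∀ (v w : V) (A B : h) (s : N),
      D.spin ((T.bracket (v, 0, A) (w, 0, B)).2.2 + l (T.bracket (v, 0, A) (w, 0, B)).1) s =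
        b.1 v (b.1 w s) - b.1 w (b.1 v s) + D.actBeta (A + l v) b.1 w s -
          D.actBeta (B + l w) b.1 v s + D.spin ⁅(A : So D.η) + l v, (B : So D.η) + l w⁆ s := by
    intro v w A B s
    have hJ := T.bracket_jacobi (0, s, 0) (x := (v, 0, A)) (y := (w, 0, B)) rfl rfl
    have hz : T.bracket (v, 0, A) (w, 0, B) =
        ((T.bracket (v, 0, A) (w, 0, B)).1, 0, (T.bracket (v, 0, A) (w, 0, B)).2.2) :=
      Prod.ext rfl (Prod.ext (T.bracket_even_even v w A B) rfl)
    rw [T.bracket_even_odd w B s, T.bracket_even_odd v A s, hz] at hJ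
    have h2 := congrArg (fun x => (x.2.1 : S)) hJ
    dsimp only [Prod.snd_add, Prod.fst_add] at h2
    rw [Submodule.coe_add, actE, actE, actE, actE, actE] at h2
    simp only [evenAct_apply, fstE, map_add, map_sub, LinearMap.add_apply,
      LinearMap.sub_apply] at h2
    simp only [fstE, actBeta_apply, spin_lie, map_add, map_sub, LinearMap.add_apply,
      LinearMap.sub_apply]
    rw [← sub_eq_zero] at h2 ⊢
    rw [← neg_eq_zero, ← h2]
    abel
  -- The formula for [v, w] in the deformed bracket, solved for θ.
  let θ : V →ₗ[ℝ] V →ₗ[ℝ] So D.η :=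
    (T.bracket.compl₁₂ (LinearMap.inl ℝ V (N × h)) (LinearMap.inl ℝ V (N × h))).compr₂
      (h.subtype ∘ₗ LinearMap.snd ℝ N h ∘ₗ LinearMap.snd ℝ V (N × h) +
        l ∘ₗ LinearMap.fst ℝ V (N × h)) -
    (((LieAlgebra.ad ℝ (So D.η) : So D.η →ₗ⁅ℝ⁆ Module.End ℝ (So D.η)) :
      So D.η →ₗ[ℝ] Module.End ℝ (So D.η)) ∘ₗ l).compl₂ l
  have hθ : ∀ v w, θ v w = (T.bracket (v, 0, 0) (w, 0, 0)).2.2 +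
      l (T.bracket (v, 0, 0) (w, 0, 0)).1 - ⁅l v, l w⁆ := fun v w => rfl
  have hθ' : ∀ v w, ∀ s ∈ N, D.spin (θ v w) s = b.1 v (b.1 w s) - b.1 w (b.1 v s) +
      D.actBeta (l v) b.1 w s - D.actBeta (l w) b.1 v s := fun v w s hs => by
    have := jac v w 0 0 ⟨s, hs⟩
    rw [ZeroMemClass.coe_zero, zero_add, zero_add] at this
    rw [hθ, map_sub, LinearMap.sub_apply, this]
    abel
  have actβ : ∀ v (A : h), D.actBeta (A + l v) b.1 = D.actBeta (l v) b.1 := fun v A => by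
    have := actBeta_sub_left ((A : So D.η) + l v) (l v) b.1
    rw [add_sub_cancel_right, (hinv A A.2).1] at this
    exact (sub_eq_zero.1 this.symm)
  -- The cochain does not prescribe the so(V)-parts of the brackets with h. They are forced, because
  -- both sides act equally on S' and so(V) acts faithfully there.
  have sndE : ∀ (v w : V) (A B : h), ((T.bracket (v, 0, A) (w, 0, B)).2.2 : So D.η) +
      l (T.bracket (v, 0, A) (w, 0, B)).1 =
        ⁅(A : So D.η) + l v, (B : So D.η) + l w⁆ + θ v w := fun v w A B => by
    refine spin_faithful (D := D) hdim fun s hs => ?_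
    have := jac v w A B ⟨s, hs⟩
    rw [actβ, actβ] at this
    rw [this, map_add, LinearMap.add_apply, hθ' v w s hs]
    abel
  have full : ∀ x y : V × N × h, T.bracket x y =
      T.bracket (x.1, 0, x.2.2) (y.1, 0, y.2.2) + T.bracket (0, x.2.1, 0) (0, y.2.1, 0) +
        (T.bracket (x.1, 0, x.2.2) (0, y.2.1, 0) - T.bracket (y.1, 0, y.2.2) (0, x.2.1, 0)) := by
    intro x y
    have e : ∀ x : V × N × h, x = (x.1, 0, x.2.2) + (0, x.2.1, 0) := fun x => by simp
    conv_lhs => rw [e x, e y]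
    simp only [map_add, LinearMap.add_apply]
    rw [T.bracket_odd_even]
    abel
  have full1 : ∀ x y : V × N × h, (T.bracket x y).1 =
      D.vec (x.2.2 + l x.1) y.1 - D.vec (y.2.2 + l y.1) x.1 + D.κ x.2.1 y.2.1 := fun x y => by
    rw [full, T.bracket_even_odd, T.bracket_even_odd y.1]
    simp only [Prod.fst_add, Prod.fst_sub, sub_zero, add_zero, fstE, T.bracket_odd_odd_fst]
  have full3 : ∀ x y : V × N × h, ((T.bracket x y).2.2 : So D.η) + l (T.bracket x y).1 =
      ⁅(x.2.2 : So D.η) + l x.1, (y.2.2 : So D.η) + l y.1⁆ + θ x.1 y.1 + b.2 x.2.1 y.2.1 :=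
    fun x y => by
      rw [full, T.bracket_even_odd, T.bracket_even_odd y.1]
      simp only [Prod.fst_add, Prod.snd_add, Prod.fst_sub, Prod.snd_sub, sub_zero, add_zero,
        Submodule.coe_add, cγ, map_add, T.bracket_odd_odd_fst, ← sndE]
      abel
  have full2 : ∀ x y : V × N × h, ((T.bracket x y).2.1 : S) =
      D.evenAct b (x.1, x.2.2 + l x.1) y.2.1 - D.evenAct b (y.1, y.2.2 + l y.1) x.2.1 :=
    fun x y => by
      rw [full]
      simp only [Prod.fst_add, Prod.snd_add, Prod.fst_sub, Prod.snd_sub, zero_add,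
        Submodule.coe_sub, T.bracket_even_even, T.bracket_odd_odd, actE]
  refine ⟨hle, θ, fun v => ?_, ⟨T.flatModel hE (fun x y => ?_) (fun x y => ?_)⟩⟩
  · rw [hθ, T.bracket_self]
    simp
  · rw [evenBracket_apply, square_apply]
    simp only [shear_fst, shear_snd, full3]
    refine Prod.ext ?_ rfl
    exact full1 x y
  · exact full2 x y

end Presentation

/-- Brackets of odd elements are squares in the flat model. Under odd generation h therefore
contributes nothing beyond the squares, which forces it to coincide with the envelope. -/
theorem FlatModel.odd_generated_le {F : D.Subdeformation} (hF : F.IsOddGenerated)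
    {b : D.BetaGamma} {θ : V →ₗ[ℝ] V →ₗ[ℝ] So D.η} {E : Submodule ℝ (V × So D.η)}
    {N : Submodule ℝ S} (m : FlatModel F b θ E N) : E ≤ D.squareSpan N b := by
  intro x hx
  have h1 := m.symm_even ⟨x, hx⟩
  rw [hF] at h1
  have h2 : Submodule.span ℝ {z | ∃ x ∈ F.alg.parity 1, ∃ y ∈ F.alg.parity 1,
      z = F.alg.bracket x y} ≤ (D.squareSpan N b).comap
        (E.subtype ∘ₗ LinearMap.fst ℝ E N ∘ₗ m.equiv.toLinearMap) := by
    refine Submodule.span_le.2 ?_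
    rintro _ ⟨x, hx, y, hy, rfl⟩
    change ((m.equiv (F.alg.bracket x y)).1 : V × So D.η) ∈ D.squareSpan N b
    rw [m.bracket_fst, (m.mem_odd x).1 hx]
    simp only [ZeroMemClass.coe_zero, map_zero, LinearMap.zero_apply, zero_add]
    exact square_mem (Subtype.coe_prop _) (Subtype.coe_prop _)
  have h3 : ((m.equiv (m.equiv.symm (⟨x, hx⟩, 0))).1 : V × So D.η) ∈ D.squareSpan N b := h2 h1
  rwa [LinearEquiv.apply_symm_apply] at h3

/-- Every highly supersymmetric, odd-generated, realisable subdeformation arises from an integrable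
Lie pair. -/
theorem exists_liePair (F : D.Subdeformation) (hF : F.IsOddGenerated) (hF' : F.IsRealisable) :
    ∃ P : D.LiePair, P.IsIntegrable ∧ ∃ θ : V →ₗ[ℝ] V →ₗ[ℝ] So D.η,
      Nonempty (FlatModel F P.cocycle θ (D.evenSub P.sub P.cocycle P.env) P.sub) := by
  obtain ⟨hsusy, N, h, T, b, hb, hinv, l, hc⟩ := hF'
  have hdim : Module.finrank ℝ S < 2 * Module.finrank ℝ N := by
    rw [← T.finrank_odd]
    exact hsusy
  obtain ⟨hle, θ, hθ, ⟨m⟩⟩ := T.exists_flatModel hdim hb hinv hc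
  have henv : D.envelope N b = h := le_antisymm hle fun A hA =>
    (mem_envelope_iff hb).2 (m.odd_generated_le hF (inr_mem_evenSub hA))
  subst henv
  let P : D.LiePair :=
    { sub := N
      cocycle := b
      dim_lt := hdim
      cocycle_mem := hb
      act_beta := fun A hA => (hinv A hA).1
      act_sub := fun A hA s hs => by
        have := m.act_mem (inr_mem_evenSub hA) hs
        simpa [evenAct_apply] using this }
  exact ⟨P, LiePair.isIntegrable_of_flatModel (P := P) hθ m, θ, ⟨m⟩⟩

namespace LiePair

theorem IsDeformationOver.isHighlySusy {P : D.LiePair} {h : Submodule ℝ (So D.η)}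
    {F : D.Subdeformation} (H : P.IsDeformationOver h F) : F.IsHighlySusy := by
  obtain ⟨-, -, T, -⟩ := H
  rw [Subdeformation.IsHighlySusy, T.finrank_odd]
  exact P.dim_lt

/-- The cochain of the defining presentation is the restricted cocycle plus the coboundary of l = γ
∘ Σ. The bound by `maxEnv` only serves to make the cocycle h-invariant. -/
theorem IsDeformationOver.isRealisable {P : D.LiePair} {h : Submodule ℝ (So D.η)}
    {F : D.Subdeformation} (H : P.IsDeformationOver h F) (hle : h ≤ P.maxEnv) :
    F.IsRealisable := by
  refine ⟨H.isHighlySusy, ?_⟩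
  obtain ⟨sec, θ, T, hθ, hT⟩ := H
  refine ⟨P.sub, h, T, P.cocycle, P.cocycle_mem,
    (isInvariant_iff P.cocycle_mem).2 fun A hA => (hle hA).2, P.lam sec, ?_⟩
  refine Prod.ext (LinearMap.ext₂ fun v w => ?_)
    (Prod.ext (LinearMap.ext₂ fun v s => ?_) (LinearMap.ext₂ fun s t => ?_))
  · have := congrArg Prod.fst (hT (v, 0, 0) (w, 0, 0))
    change (T.bracket (v, 0, 0) (w, 0, 0)).1 = 0 + (D.vec (P.lam sec v) w - D.vec (P.lam sec w) v)
    simpa [deformedBracket] using this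
  · have := congrArg (fun x => x.2.1) (hT (v, 0, 0) (0, s, 0))
    change ((T.bracket (v, 0, 0) (0, s, 0)).2.1 : S) =
      P.cocycle.1 v s + D.spin (P.lam sec v) s
    simpa [deformedBracket] using this
  · have := congrArg (fun x => x.2.2) (hT (0, s, 0) (0, t, 0))
    change ((T.bracket (0, s, 0) (0, t, 0)).2.2 : So D.η) =
      P.cocycle.2 s t + -P.lam sec (D.κ s t)
    simpa [deformedBracket, sub_eq_add_neg] using this

/-- When h is the envelope it already lies in the span of the squares, so the even part is spanned
by brackets of odd elements. -/
theorem IsAssociated.isOddGenerated {P : D.LiePair} {F : D.Subdeformation}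
    (H : P.IsAssociated F) : F.IsOddGenerated := by
  obtain ⟨θ, ⟨m⟩⟩ := IsDeformationOver.exists_flatModel H le_rfl
  apply le_antisymm
  · intro x hx
    rw [m.mem_even] at hx
    have hle : D.evenSub P.sub P.cocycle P.env ≤ D.squareSpan P.sub P.cocycle :=
      evenSub_induction (fun s hs t ht => square_mem hs ht)
        fun A hA => (mem_envelope_iff P.cocycle_mem).1 hA
    have key : ∀ z ∈ D.squareSpan P.sub P.cocycle, ∀ hz : z ∈ D.evenSub P.sub P.cocycle P.env,
        m.equiv.symm (⟨z, hz⟩, 0) ∈ Submodule.span ℝ {z | ∃ x ∈ F.alg.parity 1,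
          ∃ y ∈ F.alg.parity 1, z = F.alg.bracket x y} := by
      intro z hz
      induction hz using Submodule.span_induction with
      | mem z hz =>
        obtain ⟨s, hs, t, ht, rfl⟩ := hz
        intro hz
        obtain ⟨h1, h2⟩ := m.bracket_odd_odd ⟨s, hs⟩ ⟨t, ht⟩
        exact Submodule.subset_span ⟨_, m.symm_odd _, _, m.symm_odd _, h2.symm⟩
      | zero =>
        intro hz
        rw [show ((⟨0, hz⟩, 0) : D.evenSub P.sub P.cocycle P.env × P.sub) = 0 from rfl, map_zero]
        exact zero_mem _
      | add y z hy hz hy' hz' =>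
        intro _
        have := add_mem (hy' (squareSpan_le_evenSub hy)) (hz' (squareSpan_le_evenSub hz))
        rw [← map_add, Prod.mk_add_mk, add_zero] at this
        exact this
      | smul r y hy hy' =>
        intro _
        have := Submodule.smul_mem _ r (hy' (squareSpan_le_evenSub hy))
        rw [← map_smul, Prod.smul_mk, smul_zero] at this
        exact this
    have := key _ (hle (m.equiv x).1.2) (m.equiv x).1.2
    rwa [show ((⟨_, (m.equiv x).1.2⟩, 0) : D.evenSub P.sub P.cocycle P.env × P.sub) = m.equiv x
      from Prod.ext rfl hx.symm, LinearEquiv.symm_apply_apply] at this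
  · refine Submodule.span_le.2 ?_
    rintro _ ⟨x, hx, y, hy, rfl⟩
    exact F.alg.bracket_mem hx hy

end LiePair

/-! ### Isomorphism of subdeformations -/

theorem Subdeformation.iso_refl (F : D.Subdeformation) : F.Iso F :=
  ⟨.refl ℝ _, fun _ _ => rfl, fun _ _ => Iff.rfl, fun _ _ => Iff.rfl, GrAut.refl D, fun _ _ => rfl⟩

theorem Subdeformation.Iso.symm {F F' : D.Subdeformation} (H : F.Iso F') : F'.Iso F := by
  obtain ⟨Φ, hbr, hpar, hfil, g, hg⟩ := H
  have hfil' : ∀ k x, x ∈ F'.alg.fil k ↔ Φ.symm x ∈ F.alg.fil k := fun k x => by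
    rw [hfil, LinearEquiv.apply_symm_apply]
  refine ⟨Φ.symm, fun x y => ?_, fun i x => ?_, hfil', g.symm, fun k x => ?_⟩
  · rw [LinearEquiv.symm_apply_eq, hbr]
    simp
  · rw [hpar, LinearEquiv.apply_symm_apply]
  · have h1 := hg k ⟨Φ.symm x, (hfil' k x).1 x.2⟩
    apply g.toEquiv.injective
    rw [← h1]
    have h2 : ∀ y, g.toEquiv (g.symm.toEquiv y) = y := fun y => g.toEquiv.apply_symm_apply y
    rw [h2]
    congr 1
    exact Subtype.ext (Φ.apply_symm_apply _)

theorem Subdeformation.Iso.trans {F F' F'' : D.Subdeformation} (H : F.Iso F') (H' : F'.Iso F'') :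
    F.Iso F'' := by
  obtain ⟨Φ, hbr, hpar, hfil, g, hg⟩ := H
  obtain ⟨Ψ, kbr, kpar, kfil, k, hk⟩ := H'
  refine ⟨Φ.trans Ψ, fun x y => ?_, fun i x => (hpar i x).trans (kpar i _),
    fun j x => (hfil j x).trans (kfil j _), g.trans k, fun j x => ?_⟩
  · simp [hbr, kbr]
  · have h1 := hk j ⟨Φ x, (hfil j x).1 x.2⟩
    rw [hg j x] at h1
    exact h1

/-! ### The correspondence between Lie pairs and subdeformations -/

namespace LiePair

theorem WeakEquiv.iso {P Q : D.LiePair} (H : P.WeakEquiv Q) {F F' : D.Subdeformation}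
    (hF : P.IsAssociated F) (hF' : Q.IsAssociated F') : F.Iso F' := by
  obtain ⟨g, φ, hφ, -, hsub, hcoc⟩ := H
  exact IsDeformationOver.iso hφ hsub hcoc le_rfl le_rfl (env_eq_map hφ hsub hcoc) hF hF'

theorem StrongEquiv.iso {P Q : D.LiePair} (H : P.StrongEquiv Q) {F F' : D.Subdeformation}
    (hF : P.IsMaxAssociated F) (hF' : Q.IsMaxAssociated F') : F.Iso F' := by
  obtain ⟨g, hsub, hcoc⟩ := H
  exact IsDeformationOver.iso (zero_mem _) hsub (by rw [hcoc, add_zero]) P.env_le_maxEnv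
    Q.env_le_maxEnv (maxEnv_eq_map hsub hcoc) hF hF'

theorem IsAssociated.mem {P : D.LiePair} {F : D.Subdeformation} (H : P.IsAssociated F) :
    F.IsHighlySusy ∧ F.IsOddGenerated ∧ F.IsRealisable :=
  ⟨IsDeformationOver.isHighlySusy H, H.isOddGenerated,
    IsDeformationOver.isRealisable H P.env_le_maxEnv⟩

theorem exists_isAssociated {P : D.LiePair} (hP : P.IsIntegrable) :
    ∃ F : D.Subdeformation, P.IsAssociated F :=
  exists_isDeformationOver hP le_rfl P.env_le_maxEnv
    fun _ hA _ hB => P.env_lie (P.env_le_maxEnv hA) hB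

theorem exists_isMaxAssociated {P : D.LiePair} (hP : P.IsIntegrable) :
    ∃ F : D.Subdeformation, P.IsMaxAssociated F :=
  exists_isDeformationOver hP P.env_le_maxEnv le_rfl fun _ hA _ hB => P.maxEnv_lie hA hB

end LiePair

/-- F and any subdeformation associated with its Lie pair have flat models with the same β + γ, E
and S'. They could differ only in θ, which `FlatModel.iso` does not compare, so the identity of s
induces an isomorphism. -/
theorem exists_iso_of_mem (F : D.OddGenRealisable) :
    ∃ P : D.IntegrableLiePair, ∀ F' : D.Subdeformation, P.1.IsAssociated F' → F'.Iso F.1 := by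
  obtain ⟨P, hP, θ, ⟨m⟩⟩ := exists_liePair F.1 F.2.2.1 F.2.2.2
  refine ⟨⟨P, hP⟩, fun F' hF' => ?_⟩
  obtain ⟨θ', ⟨m'⟩⟩ := LiePair.IsDeformationOver.exists_flatModel hF' le_rfl
  exact m'.iso m (GrAut.refl D) (Submodule.map_id _).symm (Submodule.map_id _).symm
    (fun _ _ _ => rfl) (fun _ _ _ _ => rfl)

end PoincareData

end

theorem proposition4p27 {V : Type*} {S : Type*} [AddCommGroup V] [Module ℝ V]
    [FiniteDimensional ℝ V] [AddCommGroup S] [Module ℝ S] [FiniteDimensional ℝ S]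
    (D : PoincareData V S) :
    Equivalence (fun P Q : D.IntegrableLiePair => P.1.WeakEquiv Q.1) ∧
    Equivalence (fun F F' : D.OddGenRealisable => F.1.Iso F'.1) ∧
    (∃ f : Quot (fun P Q : D.IntegrableLiePair => P.1.WeakEquiv Q.1) ≃
        Quot (fun F F' : D.OddGenRealisable => F.1.Iso F'.1),
      ∀ P : D.IntegrableLiePair,
        (∃ F : D.Subdeformation, P.1.IsAssociated F) ∧
        ∀ F : D.Subdeformation, P.1.IsAssociated F →
          ∃ hF : F.IsHighlySusy ∧ F.IsOddGenerated ∧ F.IsRealisable,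
            f (Quot.mk _ P) = Quot.mk _ ⟨F, hF⟩) ∧
    (∀ P : D.IntegrableLiePair,
      (∃ F : D.Subdeformation, P.1.IsMaxAssociated F) ∧
      ∀ F : D.Subdeformation, P.1.IsMaxAssociated F → F.IsRealisable) ∧
    (∀ P Q : D.IntegrableLiePair, P.1.StrongEquiv Q.1 →
      ∀ F F' : D.Subdeformation, P.1.IsMaxAssociated F → Q.1.IsMaxAssociated F' →
        F.Iso F') := by
  have eqv : Equivalence (fun P Q : D.IntegrableLiePair => P.1.WeakEquiv Q.1) :=
    ⟨fun P => P.1.weakEquiv_refl, fun H => H.symm, fun H H' => H.trans H'⟩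
  have eqv' : Equivalence (fun F F' : D.OddGenRealisable => F.1.Iso F'.1) :=
    ⟨fun F => F.1.iso_refl, fun H => H.symm, fun H H' => H.trans H'⟩
  refine ⟨eqv, eqv', ?_, fun P => ⟨PoincareData.LiePair.exists_isMaxAssociated P.2, fun F hF =>
    PoincareData.LiePair.IsDeformationOver.isRealisable hF le_rfl⟩,
    fun P Q H F F' hF hF' => H.iso hF hF'⟩
  -- The associated subdeformation is defined up to isomorphism only, so a representative is chosen.
  -- Reflexivity of weak equivalence shows at the end that every other choice gives the same class.
  choose assoc hassoc using fun P : D.IntegrableLiePair =>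
    PoincareData.LiePair.exists_isAssociated P.2
  let f : Quot (fun P Q : D.IntegrableLiePair => P.1.WeakEquiv Q.1) →
      Quot (fun F F' : D.OddGenRealisable => F.1.Iso F'.1) :=
    Quot.map (fun P => ⟨assoc P, (hassoc P).mem⟩) fun P Q H => H.iso (hassoc P) (hassoc Q)
  have hf : Function.Bijective f := by
    constructor
    · rintro ⟨P⟩ ⟨Q⟩ hPQ
      -- Equality in `Quot` gives only the generated equivalence relation; `eqv'` turns it back into
      -- a single isomorphism.
      have hiso : (assoc P).Iso (assoc Q) := (eqv'.quot_mk_eq_iff _ _).1 hPQ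
      obtain ⟨θ, ⟨m⟩⟩ :=
        PoincareData.LiePair.IsDeformationOver.exists_flatModel (hassoc P) le_rfl
      obtain ⟨θ', ⟨m'⟩⟩ :=
        PoincareData.LiePair.IsDeformationOver.exists_flatModel (hassoc Q) le_rfl
      exact Quot.sound (PoincareData.LiePair.weakEquiv_of_iso m m' hiso)
    · rintro ⟨F⟩
      obtain ⟨P, hP⟩ := PoincareData.exists_iso_of_mem F
      exact ⟨Quot.mk _ P, Quot.sound (hP _ (hassoc P))⟩
  exact ⟨Equiv.ofBijective f hf, fun P => ⟨⟨assoc P, hassoc P⟩, fun F hF => ⟨hF.mem,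
    Quot.sound ((P.1.weakEquiv_refl).iso (hassoc P) hF)⟩⟩⟩
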